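/- Let $T$ be a finite tree, let $\ell:V(T)\to\mathbb Z_{\ge 0}$ be a function, and let $\Gamma=(T,\ell)$ be the \emph{bunch of grapes} obtained from $T$ by attaching $\ell(v)$ triangles ($3$-cycles) at each vertex $v$ of $T$. Suppose that $\Gamma$ is \emph{large}, i.e. $\ell(v)>0$ for at least two distinct vertices $v$ of $T$, and \emph{normal}, i.e. every vertex of $T$ has valency at least $3$ in $\Gamma$. Let $UC_2(\Gamma)$ be the space of unordered pairs of distinct points of the topological graph $\Gamma$, and $\mathbb B_2(\Gamma)=\pi_1(UC_2(\Gamma))$ the $2$-braid group of $\Gamma$. Let $UD_2(\Gamma)\subset UC_2(\Gamma)$ be the unordered discrete $2$-configuration space, i.e. the square complex whose cells are the unordered pairs $\{\sigma,\tau\}$ of disjoint closed cells (vertices or edges) of $\Gamma$. A combinatorial map of square complexes is a \emph{local isometry} if at every vertex it induces an injective map of links whose image is an induced subcomplex; a subcomplex is \emph{locally convex} if its inclusion is a local isometry. A \emph{product structure} is a local isometry $\iota:\Delta_1\times\Delta_2\to UD_2(\Gamma)$, where $\Delta_1,\Delta_2$ are connected $1$-dimensional graphs, which restricts to isomorphisms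 of $\Delta_1\times\{v_2\}$ and of $\{v_1\}\times\Delta_2$ onto their images for some vertices $v_i\in\Delta_i$. A \emph{standard product subcomplex} of $UD_2(\Gamma)$ is the image of a product structure for which $\Delta_1$ and $\Delta_2$ are finite graphs without leaves (vertices of valency one), and a \emph{maximal product subcomplex} is a standard product subcomplex that is maximal under inclusion. Let $UP_2(\Gamma)$ be the union of all maximal product subcomplexes of $UD_2(\Gamma)$. Then $UP_2(\Gamma)$ is a (non-empty, path-connected) locally convex subcomplex of $UD_2(\Gamma)$. Moreover, there is an integer $n\ge 2$ such that $$\mathbb B_2(\Gamma)\;\cong\;\pi_1(UP_2(\Gamma))*\mathbb F_n ,$$ where $\mathbb F_n$ is the free group of rank $n$ (for any choice of base points). -/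

import Mathlib

open scoped Monoid.Coprod

universe u v w

namespace GrapeBraid

/-! ### Cube complexes

A cube complex all of whose cells are embedded cubes that are determined by their vertex sets is
recorded as the family `X : Set (Set α)` of the vertex sets of its cells: a vertex `a` is the
cell `{a}`, an edge is a cell with two elements, and `d` is a face of `c` when `d ∈ X`, `d ⊆ c`. -/

/-- The cells of `X` that contain `a`. They are the simplices of the link of `a` in `X`
(the cell `{a}` itself stands for the empty simplex). -/
def cellsAt {α : Type u} (X : Set (Set α)) (a : α) : Set (Set α) :=
  {c | c ∈ X ∧ a ∈ c}

/-- The edges of `X` that contain `a`, that is, the vertices of the link of `a` in `X`. -/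
def edgesAt {α : Type u} (X : Set (Set α)) (a : α) : Set (Set α) :=
  {e | e ∈ X ∧ a ∈ e ∧ e.ncard = 2}

/-- Combinatorial maps: every cell is mapped isomorphically onto a cell. -/
def IsCombinatorialMap {α : Type u} {β : Type v} (X : Set (Set α)) (Y : Set (Set β))
    (f : α → β) : Prop :=
  ∀ c ∈ X, Set.InjOn f c ∧ f '' c ∈ Y

/-- Immersions: combinatorial maps that induce injective maps on the links of vertices. -/
def IsImmersion {α : Type u} {β : Type v} (X : Set (Set α)) (Y : Set (Set β))
    (f : α → β) : Prop :=
  IsCombinatorialMap X Y f ∧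
    ∀ a, {a} ∈ X → Set.InjOn (fun c : Set α => f '' c) (cellsAt X a)

/-- Local isometries: immersions such that the image of the link of every vertex `a` is an induced
subcomplex of the link of `f a`, i.e. every simplex of the latter all of whose vertices are in the
image is itself in the image. -/
def IsLocalIsometry {α : Type u} {β : Type v} (X : Set (Set α)) (Y : Set (Set β))
    (f : α → β) : Prop :=
  IsImmersion X Y f ∧
    ∀ a, {a} ∈ X → ∀ d ∈ cellsAt Y (f a),
      (∀ e ∈ edgesAt Y (f a), e ⊆ d → ∃ e' ∈ edgesAt X a, f '' e' = e) →
        ∃ c ∈ cellsAt X a, f '' c = d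

/-- `K` is a subcomplex of `Y`. -/
def IsSubcomplex {α : Type u} (K Y : Set (Set α)) : Prop :=
  K ⊆ Y ∧ ∀ c ∈ K, ∀ d ∈ Y, d ⊆ c → d ∈ K

/-- `K` is a locally convex subcomplex of `Y`: the inclusion is a local isometry. -/
def IsLocallyConvex {α : Type u} (K Y : Set (Set α)) : Prop :=
  IsSubcomplex K Y ∧ IsLocalIsometry K Y id

/-! ### Graphs and products of graphs -/

/-- The vertex sets of the cells (vertices and edges) of a simple graph. -/
def IsCell {α : Type u} (G : SimpleGraph α) (σ : Set α) : Prop :=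
  (∃ a, σ = {a}) ∨ ∃ a b, G.Adj a b ∧ σ = {a, b}

/-- The product of two graphs, as a square complex. -/
def prodComplex {α : Type u} {β : Type v} (G : SimpleGraph α) (H : SimpleGraph β) :
    Set (Set (α × β)) :=
  {c | ∃ σ τ, IsCell G σ ∧ IsCell H τ ∧ c = σ ×ˢ τ}

/-- A graph has no leaves if it has no vertex of valency one. -/
def NoLeaves {α : Type u} (G : SimpleGraph α) : Prop :=
  ∀ a, (G.neighborSet a).ncard ≠ 1

/-- A product structure: a local isometry from the product of two graphs which is an isomorphism
onto its image on some slice in each of the two directions. -/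
def IsProductStructure {α : Type u} {β : Type v} {γ : Type w} (G : SimpleGraph α)
    (H : SimpleGraph β) (Y : Set (Set γ)) (f : α × β → γ) : Prop :=
  IsLocalIsometry (prodComplex G H) Y f ∧
    (∃ b, Function.Injective fun a => f (a, b)) ∧ ∃ a, Function.Injective fun b => f (a, b)

/-- Standard product subcomplexes of `Y`: images of product structures whose domain is the product
of two connected one-dimensional graphs without leaves. (A factor of a product structure embeds in
`Y`, so when the one-skeleton of `Y` is a finite simple graph it is enough to consider finite
simple graphs with vertices in the universe of `Y`.) -/
def IsStandardProduct {γ : Type u} (Y K : Set (Set γ)) : Prop :=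
  ∃ (α β : Type u) (_ : Finite α) (_ : Finite β) (G : SimpleGraph α) (H : SimpleGraph β)
    (f : α × β → γ),
    G.Connected ∧ H.Connected ∧ Nontrivial α ∧ Nontrivial β ∧ NoLeaves G ∧ NoLeaves H ∧
      IsProductStructure G H Y f ∧ K = (fun c => f '' c) '' prodComplex G H

/-- Maximal product subcomplexes: the standard product subcomplexes that are maximal with respect
to inclusion. -/
def IsMaximalProduct {γ : Type u} (Y K : Set (Set γ)) : Prop :=
  Maximal (IsStandardProduct Y) K

/-- The union of all maximal product subcomplexes of `Y`. -/
def unionMaximalProducts {γ : Type u} (Y : Set (Set γ)) : Set (Set γ) :=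
  {c | ∃ K, IsMaximalProduct Y K ∧ c ∈ K}

/-! ### Discrete configuration spaces -/

/-- The vertex set of the unordered product of two disjoint cells `σ` and `τ` of a graph. -/
def pairCell {α : Type u} (σ τ : Set α) : Set (Sym2 α) :=
  Set.image2 (fun a b => s(a, b)) σ τ

/-- The unordered discrete 2-configuration space of a simple graph: its cells are the unordered
pairs of disjoint closed cells of the graph. -/
def UD₂ {α : Type u} (G : SimpleGraph α) : Set (Set (Sym2 α)) :=
  {c | ∃ σ τ, IsCell G σ ∧ IsCell G τ ∧ Disjoint σ τ ∧ c = pairCell σ τ}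

/-- The union of all maximal product subcomplexes of the discrete 2-configuration space. -/
def UP₂ {α : Type u} (G : SimpleGraph α) : Set (Set (Sym2 α)) :=
  unionMaximalProducts (UD₂ G)

/-! ### Configuration spaces and braid groups -/

/-- The geometric realization of a finite simple graph, in barycentric coordinates. -/
def Realization {α : Type u} [Fintype α] (G : SimpleGraph α) : Type u :=
  {x : α → ℝ // x ∈ stdSimplex ℝ α ∧ IsCell G (Function.support x)}

instance {α : Type u} [Fintype α] (G : SimpleGraph α) : TopologicalSpace (Realization G) :=
  inferInstanceAs
    (TopologicalSpace {x : α → ℝ // x ∈ stdSimplex ℝ α ∧ IsCell G (Function.support x)})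

/-- The ordered 2-configuration space of a space. -/
abbrev C₂ (X : Type u) : Type u := {p : X × X // p.1 ≠ p.2}

/-- Two ordered configurations are identified when they differ by exchanging the two points. -/
def swapSetoid (X : Type u) : Setoid (C₂ X) where
  r p q := q.1 = p.1 ∨ q.1 = p.1.swap
  iseqv :=
    { refl := fun _ => Or.inl rfl
      symm := by
        rintro p q (h | h)
        · exact Or.inl h.symm
        · exact Or.inr (by rw [h, Prod.swap_swap])
      trans := by
        rintro p q r (h | h) (h' | h')
        · exact Or.inl (h'.trans h)
        · exact Or.inr (by rw [h', h])
        · exact Or.inr (by rw [h', h])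
        · exact Or.inl (by rw [h', h, Prod.swap_swap]) }

/-- The unordered 2-configuration space of a space, with the quotient topology. -/
def UC₂ (X : Type u) : Type u := Quotient (swapSetoid X)

instance (X : Type u) [TopologicalSpace X] : TopologicalSpace (UC₂ X) :=
  inferInstanceAs (TopologicalSpace (Quotient (swapSetoid X)))

/-- The 2-braid group of a finite graph: the fundamental group of its unordered 2-configuration
space. -/
abbrev braidGroup₂ {α : Type u} [Fintype α] (G : SimpleGraph α) (q : UC₂ (Realization G)) :
    Type u :=
  FundamentalGroup (UC₂ (Realization G)) q

/-- The space underlying a subcomplex `K` of the discrete 2-configuration space, as a subspace of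
the unordered 2-configuration space: a configuration `{x, y}` lies in the interior of the cell
which is the product of the smallest cells containing `x` and `y`. -/
def polyhedron {α : Type u} [Fintype α] (G : SimpleGraph α) (K : Set (Set (Sym2 α))) :
    Set (UC₂ (Realization G)) :=
  {z | ∃ p : C₂ (Realization G), z = Quotient.mk (swapSetoid _) p ∧
    pairCell (Function.support p.1.1.1) (Function.support p.1.2.1) ∈ K}

/-! ### Bunches of grapes -/

/-- The vertices of the bunch of grapes with `ℓ v` grapes at the vertex `v` of the stem: the
vertices of the stem, and two further vertices for each grape. -/
abbrev GrapeVertex {V : Type u} (ℓ : V → ℕ) : Type u :=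
  V ⊕ ((Σ v : V, Fin (ℓ v)) × Bool)

/-- The graph obtained from the stem `T` by attaching `ℓ v` triangles at each vertex `v`. -/
def bunch {V : Type u} (T : SimpleGraph V) (ℓ : V → ℕ) : SimpleGraph (GrapeVertex ℓ) where
  Adj
    | .inl a, .inl b => T.Adj a b
    | .inl a, .inr (g, _) => a = g.1
    | .inr (g, _), .inl a => a = g.1
    | .inr (g, i), .inr (h, j) => g = h ∧ i ≠ j
  symm := by
    constructor
    rintro (a | ⟨g, i⟩) (b | ⟨h, j⟩) hab
    · exact SimpleGraph.Adj.symm (G := T) hab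
    · exact hab
    · exact hab
    · exact ⟨hab.1.symm, hab.2.symm⟩
  loopless := by
    constructor
    rintro (a | ⟨g, i⟩) haa
    · exact SimpleGraph.irrefl T haa
    · exact haa.2 rfl

/-- At least two distinct vertices of the stem carry grapes. -/
def IsLarge {V : Type u} (ℓ : V → ℕ) : Prop :=
  ∃ v w, v ≠ w ∧ 0 < ℓ v ∧ 0 < ℓ w

/-- Every vertex of the stem has valency at least three in the bunch of grapes. -/
def IsNormal {V : Type u} (T : SimpleGraph V) (ℓ : V → ℕ) : Prop :=
  ∀ v, 3 ≤ ((bunch T ℓ).neighborSet (Sum.inl v)).ncard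

end GrapeBraid

open GrapeBraid

/-!
The points of the 2-configuration space of a bunch of grapes are compared by means of the map that
collapses all grapes to the stem `T`.

*The union of the maximal product subcomplexes.* It consists of the separated cells, those whose
two factors lie over disjoint parts of `T` (`UP₂_bunch`). In a product of leafless graphs each of
the two points can be moved in two ways independently of the other one, and if both points lay
over the same vertex of `T`, then both could move to this vertex, or one of them could move to the
place of the other. Conversely, disjoint cells of the tree are separated by an edge
(`exists_separation`), and by normality the parts of the bunch over the two sides of this edge are
leafless, so that their product is a standard product subcomplex (`isStandardProduct_pairMap`).
Local convexity (`isLocallyConvex_separated`) and connectedness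
(`isPathConnected_polyhedron_separated`) can be checked directly on the separated cells.

*Configurations with different projections.* If the projections of the two points to `T` differ,
then the points can be pushed apart by moving their barycentric coordinates `P` and `Q` towards
the normalized positive parts of `P - Q` and `Q - P`. This is a deformation retraction of the open
set of these configurations onto the polyhedron of the separated cells
(`exists_homotopyEquiv_stemDistinct`).

*The remaining configurations.* If the projections agree, then both points lie over the same
vertex `v` of `T`, and at least one of them is on a grape at `v`. These configurations are added
in the form of simply connected open sets: for every grape the configurations of a point on it and
a point closer to the stem (`isAttachment_nearStem`), then for every grape the configurations of
two points on it (`isAttachment_sameGrape`), then for every pair of grapes at the same vertex the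
configurations with a point on each of them (`isAttachment_box`). These sets meet what is already
there in simply connected sets, whose numbers are the valency of `v` in `T`, two, and four. By the
theorem of Seifert and van Kampen, attaching a simply connected set along `m` simply connected
components has the effect of a free product with a free group of rank `m - 1`
(`IsAttachment.nonempty_mulEquiv`). Since every grape contributes a generator when the
configurations of two points on it are attached, the total rank is at least two.

The theorem of Seifert and van Kampen is used in the form that compatible homomorphisms from the
fundamental groupoids of the members of an open cover to a group extend uniquely to the
fundamental groupoid of the space (`LocalPathHom.glue`, `PathHom.eq_of_cover`). The value of the
extension on a path is the total change of a potential, a function on the interval whose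
increments on short subintervals are prescribed by the given homomorphisms.
-/

namespace GrapeBraid

open Set Topology

/-! ### Homomorphisms from fundamental groupoids to groups -/

/-- Homotopy classes of paths from `a` to `b`, relative to the endpoints. -/
abbrev PathClass {X : Type*} [TopologicalSpace X] (a b : X) := Path.Homotopic.Quotient a b

/-- A homomorphism from the fundamental groupoid of `X` to the group `G`. As in the fundamental
group, whose multiplication is that of endomorphisms, the later path is the left factor. -/
structure PathHom (X : Type*) [TopologicalSpace X] (G : Type*) [Group G] where
  /-- The value on a homotopy class of paths. -/
  toFun : ∀ {a b : X}, PathClass a b → G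
  map_trans' : ∀ {a b c : X} (p : PathClass a b) (q : PathClass b c),
    toFun (p.trans q) = toFun q * toFun p

namespace PathHom

variable {X Y Z : Type*} [TopologicalSpace X] [TopologicalSpace Y] [TopologicalSpace Z]
  {G H : Type*} [Group G] [Group H]

instance : CoeFun (PathHom X G) fun _ => ∀ {a b : X}, PathClass a b → G :=
  ⟨fun W => W.toFun⟩

theorem map_trans (W : PathHom X G) {a b c : X} (p : PathClass a b)
    (q : PathClass b c) : W (p.trans q) = W q * W p :=
  W.map_trans' p q

theorem map_refl (W : PathHom X G) (a : X) : W (Path.Homotopic.Quotient.refl a) = 1 := by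
  have h := W.map_trans (Path.Homotopic.Quotient.refl a) (Path.Homotopic.Quotient.refl a)
  rw [Path.Homotopic.Quotient.refl_trans] at h
  exact left_eq_mul.mp h

theorem map_symm (W : PathHom X G) {a b : X} (p : PathClass a b) :
    W p.symm = (W p)⁻¹ := by
  rw [eq_inv_iff_mul_eq_one, ← W.map_trans, Path.Homotopic.Quotient.trans_symm, W.map_refl]

/-- The pullback of a homomorphism along a continuous map. -/
def comap (W : PathHom X G) (f : C(Y, X)) : PathHom Y G where
  toFun p := W (p.map f)
  map_trans' p q := by
    induction p using Path.Homotopic.Quotient.ind with | mk p =>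
    induction q using Path.Homotopic.Quotient.ind with | mk q =>
    rw [← Path.Homotopic.Quotient.mk_trans, ← Path.Homotopic.Quotient.mk_map, Path.map_trans,
      Path.Homotopic.Quotient.mk_trans, W.map_trans]
    rfl

/-- The restriction of a homomorphism to the fundamental group at a point. -/
def toMonoidHom (W : PathHom X G) (x : X) : FundamentalGroup X x →* G where
  toFun p := W (FundamentalGroup.toPath p)
  map_one' := W.map_refl x
  map_mul' p q := W.map_trans q p

/-- The homomorphism obtained by composing with a group homomorphism. -/
def postcomp (W : PathHom X G) (φ : G →* H) : PathHom X H where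
  toFun p := φ (W p)
  map_trans' p q := by rw [W.map_trans, map_mul]

/-- The coboundary of a function `h`. -/
def coboundary (h : X → G) : PathHom X G where
  toFun {a b} _ := h b * (h a)⁻¹
  map_trans' _ _ := by group

end PathHom

/-! ### Homomorphisms on the members of a cover -/

/-- Homomorphisms on the fundamental groupoids of the members of a family of subsets `c i`, which
agree on the intersections of any two of them. -/
structure LocalPathHom {X : Type*} [TopologicalSpace X] {ι : Type*} (c : ι → Set X)
    (G : Type*) [Group G] where
  /-- The homomorphism on the fundamental groupoid of `c i`. -/
  hom : ∀ i, PathHom (c i) G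
  agree : ∀ i j (a b : ↥(c i ∩ c j)) (p : Path a b),
    hom i (Path.Homotopic.Quotient.mk
      (p.map (f := Set.inclusion Set.inter_subset_left) (continuous_inclusion _))) =
    hom j (Path.Homotopic.Quotient.mk
      (p.map (f := Set.inclusion Set.inter_subset_right) (continuous_inclusion _)))

theorem line_mem {E : Type*} [AddCommGroup E] [Module ℝ E] {K : Set E} (hK : Convex ℝ K)
    {p q : E} (hp : p ∈ K) (hq : q ∈ K) {t : ℝ}
    (ht : t ∈ Icc (0 : ℝ) 1) : (1 - t) • p + t • q ∈ K :=
  hK hp hq (by linarith [ht.2]) ht.1 (by ring)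

namespace LocalPathHom

variable {X : Type*} [TopologicalSpace X] {ι : Type*} {c : ι → Set X} {G : Type*} [Group G]
  {E : Type*} [AddCommGroup E] [Module ℝ E] [TopologicalSpace E] [ContinuousAdd E]
  [ContinuousSMul ℝ E]

/-- The image in `s` of the straight line from `p` to `q`, under a map which sends it to `s`. -/
def linePath (f : C(E, X)) (s : Set X) (p q : E)
    (h : ∀ t ∈ Icc (0 : ℝ) 1, f ((1 - t) • p + t • q) ∈ s) :
    Path (⟨f p, by simpa using h 0 (by simp)⟩ : s) ⟨f q, by simpa using h 1 (by simp)⟩ where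
  toFun t := ⟨f ((1 - (t : ℝ)) • p + (t : ℝ) • q), h t t.2⟩
  continuous_toFun := by
    refine Continuous.subtype_mk (f.continuous.comp ?_) _
    fun_prop
  source' := by simp
  target' := by simp

open Classical in
/-- The value of `w.hom i` on the image under `f` of the straight line from `p` to `q`; it is `1`
if this image is not contained in `c i`. -/
noncomputable def disp (w : LocalPathHom c G) (i : ι) (f : C(E, X)) (p q : E) : G :=
  if h : ∀ t ∈ Icc (0 : ℝ) 1, f ((1 - t) • p + t • q) ∈ c i then
    w.hom i (Path.Homotopic.Quotient.mk (linePath f (c i) p q h)) else 1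

variable (w : LocalPathHom c G)

/-- On a convex set which is mapped to `c i`, displacements can be computed along any path, because
the convex set is simply connected. -/
theorem disp_eq_of_mapsTo {f : C(E, X)} {i : ι} {K : Set E} (hK : Convex ℝ K)
    (hf : MapsTo f K (c i)) (p q : K) (P : PathClass p q) :
    w.disp i f p q =
      (w.hom i).comap ⟨hf.restrict f K (c i), f.continuous.continuousOn.mapsToRestrict hf⟩ P := by
  have h : ∀ t ∈ Icc (0 : ℝ) 1, f ((1 - t) • (p : E) + t • (q : E)) ∈ c i :=
    fun t ht => hf (line_mem hK p.2 q.2 ht)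
  have := hK.contractibleSpace ⟨p, p.2⟩
  rw [disp, dif_pos h]
  let L : Path p q :=
    { toFun := fun t => ⟨(1 - (t : ℝ)) • (p : E) + (t : ℝ) • (q : E), line_mem hK p.2 q.2 t.2⟩
      continuous_toFun := by
        refine Continuous.subtype_mk ?_ _
        fun_prop
      source' := by simp
      target' := by simp }
  rw [Subsingleton.elim P (Path.Homotopic.Quotient.mk L)]
  rfl

theorem disp_mul_disp {f : C(E, X)} {i : ι} {K : Set E} (hK : Convex ℝ K)
    (hf : MapsTo f K (c i)) {p q r : E} (hp : p ∈ K) (hq : q ∈ K) (hr : r ∈ K) :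
    w.disp i f q r * w.disp i f p q = w.disp i f p r := by
  have := hK.contractibleSpace ⟨p, hp⟩
  let P : PathClass (⟨p, hp⟩ : K) ⟨q, hq⟩ := ⟦PathConnectedSpace.somePath _ _⟧
  let Q : PathClass (⟨q, hq⟩ : K) ⟨r, hr⟩ := ⟦PathConnectedSpace.somePath _ _⟧
  have h1 := w.disp_eq_of_mapsTo hK hf _ _ P
  have h2 := w.disp_eq_of_mapsTo hK hf _ _ Q
  have h3 := w.disp_eq_of_mapsTo hK hf _ _ (P.trans Q)
  rw [PathHom.map_trans, ← h1, ← h2] at h3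
  exact h3.symm

theorem disp_self {f : C(E, X)} {i : ι} {p : E} (hf : f p ∈ c i) : w.disp i f p p = 1 :=
  left_eq_mul.mp (w.disp_mul_disp (convex_singleton p) (f := f) (i := i)
    (by rintro _ rfl; exact hf) rfl rfl rfl).symm

/-- On a line which is mapped to `c i ∩ c j`, the displacements for `i` and `j` agree. -/
theorem disp_congr_index {f : C(E, X)} {i j : ι} {K : Set E} (hK : Convex ℝ K)
    (hi : MapsTo f K (c i)) (hj : MapsTo f K (c j)) {p q : E} (hp : p ∈ K) (hq : q ∈ K) :
    w.disp i f p q = w.disp j f p q := by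
  have h : ∀ t ∈ Icc (0 : ℝ) 1, f ((1 - t) • p + t • q) ∈ c i ∩ c j :=
    fun t ht => ⟨hi (line_mem hK hp hq ht), hj (line_mem hK hp hq ht)⟩
  rw [disp, dif_pos fun t ht => (h t ht).1, disp, dif_pos fun t ht => (h t ht).2]
  exact w.agree i j _ _ (linePath f (c i ∩ c j) p q h)

theorem disp_congr {F : Type*} [AddCommGroup F] [Module ℝ F] [TopologicalSpace F]
    [ContinuousAdd F] [ContinuousSMul ℝ F] {f : C(E, X)} {g : C(F, X)} {i : ι} {p q : E} {p' q' : F}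
    (h : ∀ t ∈ Icc (0 : ℝ) 1, f ((1 - t) • p + t • q) = g ((1 - t) • p' + t • q')) :
    w.disp i f p q = w.disp i g p' q' := by
  by_cases hf : ∀ t ∈ Icc (0 : ℝ) 1, f ((1 - t) • p + t • q) ∈ c i
  · have hg : ∀ t ∈ Icc (0 : ℝ) 1, g ((1 - t) • p' + t • q') ∈ c i := fun t ht => h t ht ▸ hf t ht
    have h0 : f p = g p' := by simpa using h 0 (by simp)
    have h1 : f q = g q' := by simpa using h 1 (by simp)
    rw [disp, dif_pos hf, disp, dif_pos hg]
    have key : ∀ (a b a' b' : c i) (P : Path a b) (Q : Path a' b'), a = a' → b = b' →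
        (∀ t, P t = Q t) → w.hom i (Path.Homotopic.Quotient.mk P) =
          w.hom i (Path.Homotopic.Quotient.mk Q) := by
      rintro a b _ _ P Q rfl rfl hPQ
      rw [show P = Q from Path.ext (funext hPQ)]
    exact key _ _ _ _ _ _ (Subtype.ext h0) (Subtype.ext h1) fun t => Subtype.ext (h t t.2)
  · have hg : ¬ ∀ t ∈ Icc (0 : ℝ) 1, g ((1 - t) • p' + t • q') ∈ c i :=
      fun hg => hf fun t ht => (h t ht).symm ▸ hg t ht
    rw [disp, dif_neg hf, disp, dif_neg hg]

theorem disp_eq_one_of_const {f : C(E, X)} {i : ι} {p q : E} (x : X)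
    (h : ∀ t ∈ Icc (0 : ℝ) 1, f ((1 - t) • p + t • q) = x) : w.disp i f p q = 1 := by
  by_cases hx : x ∈ c i
  · rw [w.disp_congr (g := ContinuousMap.const E x) (p' := p) (q' := p) (by simpa using h)]
    exact w.disp_self hx
  · rw [disp, dif_neg]
    intro hf
    exact hx (h 0 (by simp) ▸ hf 0 (by simp))

end LocalPathHom
namespace LocalPathHom

variable {X : Type*} [TopologicalSpace X] {ι : Type*} {c : ι → Set X} {G : Type*} [Group G]
  (w : LocalPathHom c G)

/-- A potential along `f` on the interval from `0` to `T`: a function whose increments on the short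
intervals, those which `f` maps to some `c i`, are the displacements. -/
def IsPotential (f : C(ℝ, X)) (T : ℝ) (Φ : ℝ → G) : Prop :=
  ∀ i a b, 0 ≤ a → a ≤ b → b ≤ T → MapsTo f (Icc a b) (c i) → Φ b = w.disp i f a b * Φ a

/-- Restrictions of potentials to subintervals are potentials, after an affine change of the
parameter. -/
theorem IsPotential.comp_affine {f g : C(ℝ, X)} {T r s : ℝ} {Φ : ℝ → G} (hr : 0 < r) (hs : 0 ≤ s)
    (hΦ : w.IsPotential f T Φ) (S : ℝ) (hST : r * S + s ≤ T)
    (hg : ∀ t ∈ Icc 0 S, g t = f (r * t + s)) :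
    w.IsPotential g S fun t => Φ (r * t + s) := by
  intro i a b ha hab hb hgi
  have hfi : MapsTo f (Icc (r * a + s) (r * b + s)) (c i) := by
    intro t ht
    have h1 : a ≤ (t - s) / r := by rw [le_div_iff₀ hr]; linarith [ht.1]
    have h2 : (t - s) / r ≤ b := by rw [div_le_iff₀ hr]; linarith [ht.2]
    have h3 := hgi ⟨h1, h2⟩
    rw [hg _ ⟨ha.trans h1, h2.trans hb⟩] at h3
    rwa [show r * ((t - s) / r) + s = t by field_simp; ring] at h3
  have hb' : r * b + s ≤ T := by nlinarith
  dsimp only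
  rw [hΦ i (r * a + s) (r * b + s) (by positivity) (by nlinarith) hb' hfi]
  congr 1
  refine w.disp_congr fun t ht => ?_
  have h1 := line_mem (convex_Icc a b) (left_mem_Icc.mpr hab) (right_mem_Icc.mpr hab) ht
  rw [hg _ ⟨ha.trans h1.1, h1.2.trans hb⟩]
  congr 1
  simp only [smul_eq_mul]
  ring

variable (hc : ∀ i, IsOpen (c i)) (hcov : ∀ x, ∃ i, x ∈ c i)

include hc hcov in
theorem exists_subdivision (f : C(ℝ, X)) : ∃ t : ℕ → ℝ, t 0 = 0 ∧ Monotone t ∧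
    (∃ m, t m = 1) ∧ (∀ n, t n ∈ Icc (0 : ℝ) 1) ∧
      ∀ n, ∃ i, MapsTo f (Icc (t n) (t (n + 1))) (c i) := by
  obtain ⟨t, h0, hm, ⟨m, h1⟩, ht⟩ := exists_monotone_Icc_subset_open_cover_unitInterval
    (c := fun i => (fun s : unitInterval => f s) ⁻¹' c i)
    (fun i => (hc i).preimage (f.continuous.comp continuous_subtype_val))
    (fun s _ => mem_iUnion.mpr (hcov (f s)))
  refine ⟨fun n => t n, by simp [h0], fun a b hab => hm hab, ⟨m, by simp [h1 m le_rfl]⟩,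
    fun n => (t n).2, fun n => ?_⟩
  obtain ⟨i, hi⟩ := ht n
  refine ⟨i, fun s hs => ?_⟩
  exact @hi ⟨s, (t n).2.1.trans hs.1, hs.2.trans (t (n + 1)).2.2⟩ hs

include hc hcov in
/-- A potential is extended over one interval of a subdivision after the other, by means of the
displacements in a member of the cover that contains the image of the interval. -/
theorem exists_isPotential (f : C(ℝ, X)) : ∃ Φ : ℝ → G, Φ 0 = 1 ∧ w.IsPotential f 1 Φ := by
  obtain ⟨t, h0, hm, ⟨m, h1⟩, -, ht⟩ := exists_subdivision hc hcov f
  suffices h : ∀ n, ∃ Φ : ℝ → G, Φ 0 = 1 ∧ w.IsPotential f (t n) Φ by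
    rw [← h1]; exact h m
  intro n
  induction n with
  | zero =>
    refine ⟨fun _ => 1, rfl, fun i a b ha hab hb hf => ?_⟩
    rw [h0] at hb
    obtain rfl : a = b := by linarith
    rw [w.disp_self (hf (left_mem_Icc.mpr le_rfl)), one_mul]
  | succ n ih =>
    obtain ⟨Φ, hΦ0, hΦ⟩ := ih
    obtain ⟨k, hk⟩ := ht n
    have ht0 : 0 ≤ t n := h0 ▸ hm (Nat.zero_le n)
    refine ⟨fun s => if s ≤ t n then Φ s else w.disp k f (t n) s * Φ (t n), by simp [ht0, hΦ0],
      fun i a b ha hab hb hf => ?_⟩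
    dsimp only
    by_cases hbn : b ≤ t n
    · rw [if_pos hbn, if_pos (hab.trans hbn)]
      exact hΦ i a b ha hab hbn hf
    push Not at hbn
    rw [if_neg hbn.not_ge]
    by_cases han : a ≤ t n
    · rw [if_pos han, hΦ i a (t n) ha han le_rfl
        (hf.mono_left (Icc_subset_Icc_right hbn.le)), ← mul_assoc]
      congr 1
      rw [w.disp_congr_index (convex_Icc (t n) b) (hk.mono_left (Icc_subset_Icc_right hb))
        (hf.mono_left (Icc_subset_Icc_left han)) (left_mem_Icc.mpr hbn.le)
        (right_mem_Icc.mpr hbn.le)]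
      exact w.disp_mul_disp (convex_Icc a b) hf ⟨le_rfl, hab⟩ ⟨han, hbn.le⟩ ⟨hab, le_rfl⟩
    · push Not at han
      rw [if_neg han.not_ge, ← mul_assoc, w.disp_congr_index (convex_Icc a b) hf
        (hk.mono_left (Icc_subset_Icc han.le hb)) ⟨le_rfl, hab⟩ ⟨hab, le_rfl⟩]
      congr 1
      exact (w.disp_mul_disp (convex_Icc (t n) (t (n + 1))) hk ⟨le_rfl, hbn.le.trans hb⟩
        ⟨han.le, hab.trans hb⟩ ⟨hbn.le, hb⟩).symm

variable {w} in
include hc hcov in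
/-- A potential is unique up to right multiplication by a constant. -/
theorem IsPotential.div_eq {f : C(ℝ, X)} {Φ Ψ : ℝ → G} (hΦ : w.IsPotential f 1 Φ)
    (hΨ : w.IsPotential f 1 Ψ) : Φ 1 * (Φ 0)⁻¹ = Ψ 1 * (Ψ 0)⁻¹ := by
  obtain ⟨t, h0, hm, ⟨m, h1⟩, ht01, ht⟩ := exists_subdivision hc hcov f
  rw [← h1]
  generalize m = n
  induction n with
  | zero => rw [h0]; simp
  | succ n ih =>
    obtain ⟨i, hi⟩ := ht n
    rw [hΦ i _ _ (ht01 n).1 (hm n.le_succ) (ht01 _).2 hi,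
      hΨ i _ _ (ht01 n).1 (hm n.le_succ) (ht01 _).2 hi, mul_assoc, ih, mul_assoc]

/-- The total displacement along `f` from `0` to `1`. -/
noncomputable def total (f : C(ℝ, X)) : G :=
  (w.exists_isPotential hc hcov f).choose 1

variable {w} in
theorem IsPotential.div_eq_total {f : C(ℝ, X)} {Φ : ℝ → G} (hΦ : w.IsPotential f 1 Φ) :
    Φ 1 * (Φ 0)⁻¹ = w.total hc hcov f := by
  obtain ⟨h0, h⟩ := (w.exists_isPotential hc hcov f).choose_spec
  rw [hΦ.div_eq hc hcov h, h0, inv_one, mul_one]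
  rfl

/-- Totals are invariant under homotopies relative to the endpoints. In a sufficiently fine grid
each small rectangle is mapped to a member of the cover, hence potentials along adjacent rows
differ by the displacements along the vertical edges, and these are trivial at both ends. -/
theorem total_eq_of_homotopy (F : C(unitInterval × unitInterval, X)) {x y : X} {f g : C(ℝ, X)}
    (h0 : ∀ s, F (s, 0) = x) (h1 : ∀ s, F (s, 1) = y)
    (hf : ∀ t : unitInterval, f t = F (0, t)) (hg : ∀ t : unitInterval, g t = F (1, t)) :
    w.total hc hcov f = w.total hc hcov g := by
  obtain ⟨t, t0, tm, ⟨m, t1⟩, ht⟩ := exists_monotone_Icc_subset_open_cover_unitInterval_prod_self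
    (c := fun i => F ⁻¹' c i) (fun i => (hc i).preimage F.continuous)
    (fun s _ => mem_iUnion.mpr (hcov (F s)))
  let P : ℝ → unitInterval := projIcc 0 1 zero_le_one
  have hP : Continuous P := continuous_projIcc
  have P0 : P 0 = 0 := projIcc_left _
  have P1 : P 1 = 1 := projIcc_right _
  have Pt : ∀ n, P (t n) = t n := fun n => projIcc_val _ _
  let H : C(ℝ × ℝ, X) := ⟨fun z => F (P z.1, P z.2), by fun_prop⟩
  let row (s : ℝ) : C(ℝ, X) := ⟨fun z => H (s, z), by fun_prop⟩
  have hbox : ∀ n k, ∃ i, MapsTo H (Icc ((t k : ℝ)) (t (k + 1)) ×ˢ Icc ((t n : ℝ)) (t (n + 1)))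
      (c i) := by
    intro n k
    obtain ⟨i, hi⟩ := ht k n
    refine ⟨i, fun z hz => hi ⟨?_, ?_⟩⟩
    · rw [← Pt k, ← Pt (k + 1)]
      exact ⟨monotone_projIcc _ hz.1.1, monotone_projIcc _ hz.1.2⟩
    · rw [← Pt n, ← Pt (n + 1)]
      exact ⟨monotone_projIcc _ hz.2.1, monotone_projIcc _ hz.2.2⟩
  -- adjacent rows have the same total
  have step : ∀ k, w.total hc hcov (row (t k)) = w.total hc hcov (row (t (k + 1))) := by
    intro k
    obtain ⟨Φ, Φ0, hΦ⟩ := w.exists_isPotential hc hcov (row (t k))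
    obtain ⟨Ψ, Ψ0, hΨ⟩ := w.exists_isPotential hc hcov (row (t (k + 1)))
    have hk : (t k : ℝ) ≤ t (k + 1) := tm k.le_succ
    have key : ∀ n i, MapsTo H (Icc ((t k : ℝ)) (t (k + 1)) ×ˢ {(t n : ℝ)}) (c i) →
        Ψ (t n) = w.disp i H ((t k : ℝ), (t n : ℝ)) ((t (k + 1) : ℝ), (t n : ℝ)) * Φ (t n) := by
      intro n
      induction n with
      | zero =>
        intro i hi
        rw [w.disp_eq_one_of_const x, t0]
        · simp [Φ0, Ψ0]
        · intro s _
          simp [H, t0, P0, h0]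
      | succ n ih =>
        intro j hj
        obtain ⟨i, hi⟩ := hbox n k
        have hn : (t n : ℝ) ≤ t (n + 1) := tm n.le_succ
        have hcv : Convex ℝ (Icc ((t k : ℝ)) (t (k + 1)) ×ˢ Icc ((t n : ℝ)) (t (n + 1))) :=
          (convex_Icc _ _).prod (convex_Icc _ _)
        have hrow : ∀ s ∈ Icc ((t k : ℝ)) (t (k + 1)), ∀ Θ, w.IsPotential (row s) 1 Θ →
            Θ (t (n + 1)) = w.disp i H (s, (t n : ℝ)) (s, (t (n + 1) : ℝ)) * Θ (t n) := by
          intro s hs Θ hΘ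
          rw [hΘ i _ _ (t n).2.1 hn (t (n + 1)).2.2 (fun z hz => hi ⟨hs, hz⟩)]
          congr 1
          refine w.disp_congr fun z _ => ?_
          change H _ = H _
          congr 1
          ext
          · simp only [Prod.fst_add, Prod.smul_fst, smul_eq_mul]; ring
          · simp
        rw [hrow _ ⟨hk, le_rfl⟩ Ψ hΨ, hrow _ ⟨le_rfl, hk⟩ Φ hΦ,
          ih i (hi.mono_left (prod_mono_right (by simpa using hn))),
          ← w.disp_congr_index (((convex_Icc _ _).prod (convex_singleton _)))
            (hi.mono_left (prod_mono_right (by simpa using hn))) hj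
            (p := ((t k : ℝ), (t (n + 1) : ℝ))) (q := ((t (k + 1) : ℝ), (t (n + 1) : ℝ)))
            ⟨⟨le_rfl, hk⟩, rfl⟩ ⟨⟨hk, le_rfl⟩, rfl⟩, ← mul_assoc, ← mul_assoc,
          w.disp_mul_disp hcv hi ⟨⟨le_rfl, hk⟩, ⟨le_rfl, hn⟩⟩ ⟨⟨hk, le_rfl⟩, ⟨le_rfl, hn⟩⟩
            ⟨⟨hk, le_rfl⟩, ⟨hn, le_rfl⟩⟩,
          w.disp_mul_disp hcv hi ⟨⟨le_rfl, hk⟩, ⟨le_rfl, hn⟩⟩ ⟨⟨le_rfl, hk⟩, ⟨hn, le_rfl⟩⟩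
            ⟨⟨hk, le_rfl⟩, ⟨hn, le_rfl⟩⟩]
    have hend : Ψ 1 = Φ 1 := by
      obtain ⟨i, hi⟩ := hcov y
      have h := key m i (by
        rintro ⟨a, b⟩ ⟨-, rfl⟩
        simpa [H, t1 m le_rfl, P1, h1] using hi)
      rw [w.disp_eq_one_of_const y, t1 m le_rfl, one_mul] at h
      · exact h
      · intro s _
        simp [H, t1 m le_rfl, P1, h1]
    rw [← hΦ.div_eq_total hc hcov, ← hΨ.div_eq_total hc hcov, Φ0, Ψ0, hend]
  have all : ∀ k, w.total hc hcov (row (t 0)) = w.total hc hcov (row (t k)) := by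
    intro k
    induction k with
    | zero => rfl
    | succ k ih => rw [ih, step]
  have hcongr : ∀ {f g : C(ℝ, X)}, (∀ s ∈ Icc (0 : ℝ) 1, f s = g s) →
      w.total hc hcov f = w.total hc hcov g := by
    intro f g hfg
    obtain ⟨Φ, Φ0, hΦ⟩ := w.exists_isPotential hc hcov f
    have := IsPotential.comp_affine w one_pos le_rfl hΦ 1 (by norm_num) (g := g)
      (fun s hs => by simp [hfg s hs])
    rw [← hΦ.div_eq_total hc hcov, ← this.div_eq_total hc hcov]
    simp
  rw [hcongr (f := f) (g := row (t 0)), hcongr (f := g) (g := row (t m)), all m]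
  · intro s hs
    simp only [row, H, ContinuousMap.coe_mk, t1 m le_rfl, Icc.coe_one, P1]
    exact (hg ⟨s, hs⟩).trans (by rw [show P s = ⟨s, hs⟩ from projIcc_of_mem _ hs])
  · intro s hs
    simp only [row, H, ContinuousMap.coe_mk, t0, Icc.coe_zero, P0]
    exact (hf ⟨s, hs⟩).trans (by rw [show P s = ⟨s, hs⟩ from projIcc_of_mem _ hs])

/-- The extension of compatible homomorphisms on the members of an open cover to the fundamental
groupoid of the whole space. -/
noncomputable def glue : PathHom X G where
  toFun {_ _} := Quotient.lift (fun γ => w.total hc hcov γ.extend) (by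
    rintro γ δ ⟨F⟩
    refine w.total_eq_of_homotopy hc hcov F.toContinuousMap F.source F.target
      (fun t => ?_) (fun t => ?_)
    · rw [Path.extend_extends']; exact (F.map_zero_left t).symm
    · rw [Path.extend_extends']; exact (F.map_one_left t).symm)
  map_trans' p q := by
    induction p using Path.Homotopic.Quotient.ind with | mk p =>
    induction q using Path.Homotopic.Quotient.ind with | mk q =>
    obtain ⟨Φ, Φ0, hΦ⟩ := w.exists_isPotential hc hcov (p.trans q).extend
    have hp := IsPotential.comp_affine w (by norm_num : (0 : ℝ) < 1 / 2) le_rfl hΦ 1 (by norm_num)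
      (g := p.extend) (fun s hs => by
        rw [Path.extend_trans_of_le_half _ _ (by linarith [hs.2])]
        congr 1; ring)
    have hq := IsPotential.comp_affine w (by norm_num : (0 : ℝ) < 1 / 2)
      (by norm_num : (0 : ℝ) ≤ 1 / 2) hΦ 1 (by norm_num)
      (g := q.extend) (fun s hs => by
        rw [Path.extend_trans_of_half_le _ _ (by linarith [hs.1])]
        congr 1; ring)
    change w.total hc hcov (p.trans q).extend = w.total hc hcov q.extend * w.total hc hcov p.extend
    rw [← hΦ.div_eq_total hc hcov, ← hp.div_eq_total hc hcov, ← hq.div_eq_total hc hcov]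
    norm_num

/-- The extension restricts to the given homomorphisms. -/
theorem glue_map_inclusion (i : ι) {a b : c i} (p : PathClass a b) :
    w.glue hc hcov (p.map ⟨Subtype.val, continuous_subtype_val⟩) = w.hom i p := by
  induction p using Path.Homotopic.Quotient.ind with | mk p =>
  obtain ⟨Φ, Φ0, hΦ⟩ := w.exists_isPotential hc hcov (p.map continuous_subtype_val).extend
  change w.total hc hcov (p.map continuous_subtype_val).extend = _
  rw [← hΦ.div_eq_total hc hcov, Φ0, hΦ i 0 1 le_rfl zero_le_one le_rfl, Φ0, inv_one, mul_one,
    mul_one]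
  · have h : ∀ t ∈ Icc (0 : ℝ) 1, (p.map continuous_subtype_val).extend
        ((1 - t) • (0 : ℝ) + t • (1 : ℝ)) ∈ c i := by
      intro t ht
      rw [Path.extend_apply _ (by simpa using ht)]
      exact (p _).2
    rw [disp, dif_pos h]
    have key : ∀ (a b a' b' : c i) (P : Path a b) (Q : Path a' b'), a = a' → b = b' →
        (∀ t, P t = Q t) → w.hom i (Path.Homotopic.Quotient.mk P) =
          w.hom i (Path.Homotopic.Quotient.mk Q) := by
      rintro a b _ _ P Q rfl rfl hPQ
      rw [show P = Q from Path.ext (funext hPQ)]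
    refine key _ _ _ _ _ _ (Subtype.ext (by simp)) (Subtype.ext (by simp)) fun t => Subtype.ext ?_
    change (p.map continuous_subtype_val).extend ((1 - (t : ℝ)) • (0 : ℝ) + (t : ℝ) • (1 : ℝ)) = _
    simp only [smul_eq_mul, mul_zero, mul_one, zero_add]
    rw [Path.extend_extends']
    rfl
  · intro t ht
    rw [Path.extend_apply _ ht]
    exact (p _).2

end LocalPathHom

namespace PathHom

variable {X : Type*} [TopologicalSpace X] {G : Type*} [Group G]

/-- The restrictions of a homomorphism to the members of a family of subsets. -/
def toLocal (W : PathHom X G) {ι : Type*} (c : ι → Set X) : LocalPathHom c G where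
  hom _ := W.comap ⟨Subtype.val, continuous_subtype_val⟩
  agree _ _ _ _ _ := rfl

/-- A homomorphism is the extension of its restrictions: a potential for the cover by the whole
space alone is also a potential for any other cover. -/
theorem glue_toLocal (W : PathHom X G) {ι : Type*} {c : ι → Set X} (hc : ∀ i, IsOpen (c i))
    (hcov : ∀ x, ∃ i, x ∈ c i) {a b : X} (p : PathClass a b) :
    (W.toLocal c).glue hc hcov p = W p := by
  have huniv : ∀ {f : C(ℝ, X)} {Φ : ℝ → G},
      (W.toLocal fun _ : Unit => univ).IsPotential f 1 Φ → (W.toLocal c).IsPotential f 1 Φ := by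
    intro f Φ hΦ i s t hs hst ht hf
    rw [hΦ () s t hs hst ht (mapsTo_univ _ _), LocalPathHom.disp, dif_pos fun _ _ => mem_univ _,
      LocalPathHom.disp, dif_pos]
    · rfl
    · intro r hr
      exact hf (line_mem (convex_Icc s t) ⟨le_rfl, hst⟩ ⟨hst, le_rfl⟩ hr)
  induction p using Path.Homotopic.Quotient.ind with | mk p =>
  have h := (W.toLocal fun _ : Unit => univ).glue_map_inclusion (fun _ => isOpen_univ)
    (fun _ => ⟨(), mem_univ _⟩) () (a := ⟨a, mem_univ a⟩) (b := ⟨b, mem_univ b⟩)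
    (Path.Homotopic.Quotient.mk ⟨⟨fun t => ⟨p t, mem_univ _⟩, by fun_prop⟩, by simp, by simp⟩)
  refine Eq.trans ?_ h
  obtain ⟨Φ, Φ0, hΦ⟩ := (W.toLocal fun _ : Unit => univ).exists_isPotential
    (fun _ => isOpen_univ) (fun _ => ⟨(), mem_univ _⟩) p.extend
  exact ((huniv hΦ).div_eq_total hc hcov).symm.trans (hΦ.div_eq_total
    (fun _ => isOpen_univ) (fun _ => ⟨(), mem_univ _⟩))

/-- Two homomorphisms which agree on the members of an open cover are equal. -/
theorem eq_of_cover {ι : Type*} {c : ι → Set X}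
    (hc : ∀ i, IsOpen (c i)) (hcov : ∀ x, ∃ i, x ∈ c i) (W W' : PathHom X G)
    (h : ∀ i (a b : c i) (p : PathClass a b),
      W (p.map ⟨Subtype.val, continuous_subtype_val⟩) =
        W' (p.map ⟨Subtype.val, continuous_subtype_val⟩))
    {a b : X} (p : PathClass a b) : W p = W' p := by
  have : W.toLocal c = W'.toLocal c := by
    have hom_eq : (W.toLocal c).hom = (W'.toLocal c).hom := by
      funext i
      simp only [toLocal, comap, mk.injEq]
      funext a b p
      exact h i a b p
    unfold toLocal at hom_eq ⊢
    congr 1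
  rw [← W.glue_toLocal hc hcov, ← W'.glue_toLocal hc hcov, this]

end PathHom

/-! ### Attaching simply connected open sets -/

section PathClass

variable {X Y : Type*} [TopologicalSpace X] [TopologicalSpace Y]

theorem quotient_map_trans {a b c : X} (p : PathClass a b) (q : PathClass b c) (f : C(X, Y)) :
    (p.trans q).map f = (p.map f).trans (q.map f) :=
  (FundamentalGroupoid.map f).map_comp (X := ⟨a⟩) (Y := ⟨b⟩) (Z := ⟨c⟩) p q

theorem quotient_map_symm {a b : X} (p : PathClass a b) (f : C(X, Y)) :
    p.symm.map f = (p.map f).symm := by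
  induction p using Path.Homotopic.Quotient.ind with | mk p => rfl

theorem quotient_map_refl (a : X) (f : C(X, Y)) :
    (Path.Homotopic.Quotient.refl a).map f = Path.Homotopic.Quotient.refl (f a) := rfl

theorem quotient_symm_trans_cancel {a b c : X} (p : PathClass a b) (q : PathClass b c) :
    p.symm.trans (p.trans q) = q := by
  rw [← Path.Homotopic.Quotient.trans_assoc, Path.Homotopic.Quotient.symm_trans,
    Path.Homotopic.Quotient.refl_trans]

theorem quotient_trans_symm_cancel {a b c : X} (p : PathClass a b) (q : PathClass a c) :
    p.trans (p.symm.trans q) = q := by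
  rw [← Path.Homotopic.Quotient.trans_assoc, Path.Homotopic.Quotient.trans_symm,
    Path.Homotopic.Quotient.refl_trans]

theorem quotient_symm_trans_rev {a b c : X} (p : PathClass a b) (q : PathClass b c) :
    (p.trans q).symm = q.symm.trans p.symm := by
  have h := quotient_symm_trans_cancel (p.trans q) (q.symm.trans p.symm)
  rw [Path.Homotopic.Quotient.trans_assoc, quotient_trans_symm_cancel,
    Path.Homotopic.Quotient.trans_symm, Path.Homotopic.Quotient.trans_refl] at h
  exact h

/-- The homomorphism which closes up paths to loops by means of paths `B a` from the base point. -/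
noncomputable def PathHom.ofBase {x : X} (B : ∀ a, PathClass x a) :
    PathHom X (FundamentalGroup X x) where
  toFun {a b} p := FundamentalGroup.fromPath (((B a).trans p).trans (B b).symm)
  map_trans' {a b c} p q := by
    rw [FundamentalGroup.mul_def]
    simp only [Path.Homotopic.Quotient.trans_assoc, quotient_symm_trans_cancel]

theorem PathHom.ofBase_apply {x : X} (B : ∀ a, PathClass x a) {a b : X} (p : PathClass a b) :
    PathHom.ofBase B p = FundamentalGroup.fromPath (((B a).trans p).trans (B b).symm) := rfl

end PathClass

/-- The inclusion of a subset, as a continuous map. -/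
abbrev incl {X : Type*} [TopologicalSpace X] (s : Set X) : C(s, X) :=
  ⟨Subtype.val, continuous_subtype_val⟩

/-- The inclusion of a subset in a larger one, as a continuous map. -/
abbrev inclOf {X : Type*} [TopologicalSpace X] {s t : Set X} (h : s ⊆ t) : C(s, t) :=
  ⟨Set.inclusion h, continuous_inclusion h⟩

/-- The open sets `N j` are disjoint and simply connected, and `W j i`, for the various `i`, are the
path components of the intersection of `N j` with the path-connected open set `U`, which are
simply connected as well. -/
structure IsAttachment {X : Type*} [TopologicalSpace X] (U : Set X) {J : Type*} (N : J → Set X)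
    {κ : J → Type*} (W : ∀ j, κ j → Set X) : Prop where
  isOpen_base : IsOpen U
  isPathConnected_base : IsPathConnected U
  isOpen_piece : ∀ j, IsOpen (N j)
  simplyConnected_piece : ∀ j, IsSimplyConnected (N j)
  disjoint_piece : ∀ j k, j ≠ k → Disjoint (N j) (N k)
  isOpen_overlap : ∀ j i, IsOpen (W j i)
  simplyConnected_overlap : ∀ j i, IsSimplyConnected (W j i)
  disjoint_overlap : ∀ j i k, i ≠ k → Disjoint (W j i) (W j k)
  iUnion_overlap : ∀ j, ⋃ i, W j i = U ∩ N j

namespace IsAttachment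

variable {X : Type*} [TopologicalSpace X] {U : Set X} {J : Type*} {N : J → Set X}
  {κ : J → Type*} {W : ∀ j, κ j → Set X}

section
variable (hA : IsAttachment U N W)
include hA

theorem overlap_subset_base (j : J) (i : κ j) : W j i ⊆ U := fun _ h =>
  ((hA.iUnion_overlap j).subset (mem_iUnion_of_mem i h)).1

theorem overlap_subset_piece (j : J) (i : κ j) : W j i ⊆ N j := fun _ h =>
  ((hA.iUnion_overlap j).subset (mem_iUnion_of_mem i h)).2

theorem piece_unique {j k : J} {x : X} (hj : x ∈ N j) (hk : x ∈ N k) : j = k := by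
  by_contra h
  exact (hA.disjoint_piece j k h).le_bot ⟨hj, hk⟩

theorem overlap_unique {j : J} {i k : κ j} {x : X} (hi : x ∈ W j i) (hk : x ∈ W j k) : i = k := by
  by_contra h
  exact (hA.disjoint_overlap j i k h).le_bot ⟨hi, hk⟩

theorem exists_overlap {j : J} {x : X} (hU : x ∈ U) (hj : x ∈ N j) : ∃ i, x ∈ W j i :=
  mem_iUnion.mp ((hA.iUnion_overlap j).superset ⟨hU, hj⟩)

/-- A path in the overlap of `U` and `N j` stays in one component. -/
theorem exists_lift_overlap {j : J} {a b : ↥(U ∩ N j)} (p : Path a b) :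
    ∃ (i : κ j) (ha : a.1 ∈ W j i) (hb : b.1 ∈ W j i) (R : Path (⟨a, ha⟩ : W j i) ⟨b, hb⟩),
      ∀ t, (R t : X) = p t := by
  obtain ⟨i, hi⟩ := hA.exists_overlap a.2.1 a.2.2
  have hp : Continuous fun t => (p t : X) := by fun_prop
  have hmem : ∀ t, (p t : X) ∈ W j i := by
    intro t
    refine (isPreconnected_range hp).subset_left_of_subset_union
      (hA.isOpen_overlap j i) (isOpen_iUnion fun k : {k // k ≠ i} => hA.isOpen_overlap j k)
      (disjoint_iUnion_right.mpr fun k => hA.disjoint_overlap j i k k.2.symm)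
      ?_ ⟨p 0, mem_range_self 0, by simpa using hi⟩ (mem_range_self t)
    rintro _ ⟨s, rfl⟩
    obtain ⟨k, hk⟩ := hA.exists_overlap (p s).2.1 (p s).2.2
    by_cases hki : k = i
    · exact Or.inl (hki ▸ hk)
    · exact Or.inr (mem_iUnion.mpr ⟨⟨k, hki⟩, hk⟩)
  have hb : b.1 ∈ W j i := by simpa using hmem 1
  exact ⟨i, hi, hb, ⟨⟨fun t => ⟨p t, hmem t⟩, hp.subtype_mk _⟩, by simp, by simp⟩, fun _ => rfl⟩

/-- There are paths in `U` from the base point to all points of `U` which are compatible with the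
paths in the overlaps. -/
theorem exists_base_paths (u : U) : ∃ β : ∀ a : U, PathClass u a,
    β u = Path.Homotopic.Quotient.refl u ∧ ∀ j i (a b : W j i) (p : PathClass a b),
      (β (inclOf (hA.overlap_subset_base j i) a)).trans
        (p.map (inclOf (hA.overlap_subset_base j i))) =
        β (inclOf (hA.overlap_subset_base j i) b) := by
  have := isPathConnected_iff_pathConnectedSpace.mp hA.isPathConnected_base
  have hW : ∀ j i, SimplyConnectedSpace (W j i) := fun j i => hA.simplyConnected_overlap j i
  let c : ∀ j i, W j i := fun j i =>
    Classical.choice (hA.simplyConnected_overlap j i).nonempty.to_subtype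
  -- the paths before normalization at the base point
  have hex : ∀ a : U, ∃ P : PathClass u a, ∀ j i (ha : a.1 ∈ W j i)
      (p : PathClass (c j i) ⟨a, ha⟩), P = Path.Homotopic.Quotient.trans
        ⟦PathConnectedSpace.somePath u (inclOf (hA.overlap_subset_base j i) (c j i))⟧
        (p.map (inclOf (hA.overlap_subset_base j i))) := by
    intro a
    by_cases h : ∃ j i, a.1 ∈ W j i
    · obtain ⟨j, i, ha⟩ := h
      let q : PathClass (c j i) ⟨a, ha⟩ := ⟦PathConnectedSpace.somePath _ _⟧
      refine ⟨Path.Homotopic.Quotient.trans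
        ⟦PathConnectedSpace.somePath u (inclOf (hA.overlap_subset_base j i) (c j i))⟧
        (q.map (inclOf (hA.overlap_subset_base j i))), fun j' i' ha' p => ?_⟩
      obtain rfl := hA.piece_unique (hA.overlap_subset_piece j i ha)
        (hA.overlap_subset_piece j' i' ha')
      obtain rfl := hA.overlap_unique ha ha'
      rw [Subsingleton.elim p q]
    · exact ⟨⟦PathConnectedSpace.somePath _ _⟧, fun j i ha => (h ⟨j, i, ha⟩).elim⟩
  choose P hP using hex
  refine ⟨fun a => (P u).symm.trans (P a), Path.Homotopic.Quotient.symm_trans _,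
    fun j i a b p => ?_⟩
  let q : PathClass (c j i) a := ⟦PathConnectedSpace.somePath _ _⟧
  have ha := hP (inclOf (hA.overlap_subset_base j i) a) j i a.2 q
  have hb := hP (inclOf (hA.overlap_subset_base j i) b) j i b.2 (q.trans p)
  rw [quotient_map_trans] at hb
  dsimp only
  rw [ha, hb, Path.Homotopic.Quotient.trans_assoc]
  exact congrArg _ (Path.Homotopic.Quotient.trans_assoc _ _ _)

/-- The whole space is path connected. -/
theorem pathConnectedSpace (hκ : ∀ j, Nonempty (κ j)) (hcov : U ∪ ⋃ j, N j = univ) :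
    PathConnectedSpace X := by
  obtain ⟨u, hu⟩ := hA.isPathConnected_base.nonempty
  refine pathConnectedSpace_iff_univ.mpr ⟨u, mem_univ _, fun {x} _ => ?_⟩
  have hx : x ∈ U ∪ ⋃ j, N j := hcov ▸ mem_univ x
  rcases hx with hx | hx
  · exact ((hA.isPathConnected_base.joinedIn u hu x hx).mono (subset_univ _))
  · obtain ⟨j, hj⟩ := mem_iUnion.mp hx
    obtain ⟨i⟩ := hκ j
    obtain ⟨y, hy⟩ := (hA.simplyConnected_overlap j i).nonempty
    exact ((hA.isPathConnected_base.joinedIn u hu y (hA.overlap_subset_base j i hy)).mono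
      (subset_univ _)).trans (((hA.simplyConnected_piece j).isPathConnected.joinedIn y
        (hA.overlap_subset_piece j i hy) x hj).mono (subset_univ _))

end

section MulEquiv

variable (hA : IsAttachment U N W) (i₀ : ∀ j, κ j) (u : U)

/-- The free product of the fundamental group of `U` with a free group which has a generator for
each overlap `W j i` other than a distinguished one for each `j`. -/
abbrev Target : Type _ :=
  FundamentalGroup U u ∗ FreeGroup (Σ j, {i : κ j // i ≠ i₀ j})

open Classical in
/-- The generator which belongs to the overlap `W j i`. -/
noncomputable def gen (j : J) (i : κ j) : Target (U := U) i₀ u :=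
  if h : i = i₀ j then 1 else Monoid.Coprod.inr (FreeGroup.of ⟨j, i, h⟩)

open Classical in
/-- The function on `N j` which equals `gen j i` on the overlap `W j i`, and `1` off `U`. -/
noncomputable def height (W : ∀ j, κ j → Set X) (j : J) (x : N j) : Target (U := U) i₀ u :=
  if h : ∃ i, x.1 ∈ W j i then gen i₀ u j h.choose else 1

include hA in
theorem height_of_mem {j : J} {x : N j} {i : κ j} (h : x.1 ∈ W j i) :
    height i₀ u W j x = gen i₀ u j i := by
  have h' : ∃ i, x.1 ∈ W j i := ⟨i, h⟩
  rw [height, dif_pos h', hA.overlap_unique h'.choose_spec h]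

theorem height_of_notMem {j : J} {x : N j} (h : ∀ i, x.1 ∉ W j i) : height i₀ u W j x = 1 := by
  rw [height, dif_neg]
  rintro ⟨i, hi⟩
  exact h i hi

/-- The members of the cover: `U`, and the sets `N j`. -/
def cover (U : Set X) (N : J → Set X) : Option J → Set X
  | none => U
  | some j => N j

include hA in
theorem isOpen_cover : ∀ k, IsOpen (cover U N k)
  | none => hA.isOpen_base
  | some j => hA.isOpen_piece j

omit [TopologicalSpace X] in
theorem exists_mem_cover (hcov : U ∪ ⋃ j, N j = univ) (x : X) : ∃ k, x ∈ cover U N k := by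
  have hx : x ∈ U ∪ ⋃ j, N j := hcov ▸ mem_univ x
  rcases hx with hx | hx
  · exact ⟨none, hx⟩
  · obtain ⟨j, hj⟩ := mem_iUnion.mp hx
    exact ⟨some j, hj⟩

/-- The values in the free product on the members of the cover: paths in `U` are closed up by the
base paths, a path in `N j` is assigned the change of the height. -/
noncomputable def localHom (β : ∀ a : U, PathClass u a)
    (W : ∀ j, κ j → Set X) : ∀ k, PathHom (cover U N k) (Target (U := U) i₀ u)
  | none => (PathHom.ofBase β).postcomp Monoid.Coprod.inl
  | some j => PathHom.coboundary (height i₀ u W j)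

include hA in
/-- The homomorphisms on `U` and on `N j` are both trivial on paths in the overlap: the base paths
are compatible with these paths, and the height is constant along them. -/
theorem localHom_agree_aux {β : ∀ a : U, PathClass u a}
    (hβ : ∀ j i (a b : W j i) (p : PathClass a b),
      (β (inclOf (hA.overlap_subset_base j i) a)).trans
        (p.map (inclOf (hA.overlap_subset_base j i))) =
        β (inclOf (hA.overlap_subset_base j i) b)) {j : J} {a b : ↥(U ∩ N j)} (p : Path a b) :
    localHom (N := N) i₀ u β W none (Path.Homotopic.Quotient.mk
      (p.map (f := Set.inclusion Set.inter_subset_left) (continuous_inclusion _))) =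
    localHom (U := U) i₀ u β W (some j) (Path.Homotopic.Quotient.mk
      (p.map (f := Set.inclusion Set.inter_subset_right) (continuous_inclusion _))) := by
  obtain ⟨i, ha, hb, R, hR⟩ := hA.exists_lift_overlap p
  have h2 : localHom (U := U) i₀ u β W (some j) (Path.Homotopic.Quotient.mk
      (p.map (f := Set.inclusion Set.inter_subset_right) (continuous_inclusion _))) = 1 := by
    change height i₀ u W j ⟨b, b.2.2⟩ * (height i₀ u W j ⟨a, a.2.2⟩)⁻¹ = 1
    rw [hA.height_of_mem (x := ⟨a, a.2.2⟩) i₀ u ha, hA.height_of_mem (x := ⟨b, b.2.2⟩) i₀ u hb,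
      mul_inv_cancel]
  have hP : p.map (f := Set.inclusion Set.inter_subset_left) (continuous_inclusion _) =
      R.map (continuous_inclusion (hA.overlap_subset_base j i)) := by
    ext t
    exact (hR t).symm
  have h1 : PathHom.ofBase β (Path.Homotopic.Quotient.mk
      (R.map (continuous_inclusion (hA.overlap_subset_base j i)))) = 1 := by
    have h3 := hβ j i _ _ (Path.Homotopic.Quotient.mk R)
    rw [← Path.Homotopic.Quotient.mk_map] at h3
    rw [PathHom.ofBase_apply, FundamentalGroup.one_def]
    exact (congrArg (fun q => Path.Homotopic.Quotient.trans q _) h3).trans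
      (Path.Homotopic.Quotient.trans_symm _)
  rw [h2, hP]
  exact (congrArg Monoid.Coprod.inl h1).trans (map_one _)

/-- The compatible family formed by these homomorphisms. It extends to an isomorphism from the
fundamental group of the whole space to the free product. -/
noncomputable def localPathHom {β : ∀ a : U, PathClass u a}
    (hβ : ∀ j i (a b : W j i) (p : PathClass a b),
      (β (inclOf (hA.overlap_subset_base j i) a)).trans
        (p.map (inclOf (hA.overlap_subset_base j i))) =
        β (inclOf (hA.overlap_subset_base j i) b)) :
    LocalPathHom (cover U N) (Target (U := U) i₀ u) where
  hom := localHom i₀ u β W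
  agree
    | none, none, _, _, _ => rfl
    | none, some _, _, _, p => hA.localHom_agree_aux i₀ u hβ p
    | some j, none, a, b, p => by
      have hs : cover U N (some j) ∩ cover U N none ⊆ U ∩ N j := fun x hx => ⟨hx.2, hx.1⟩
      exact (hA.localHom_agree_aux i₀ u hβ (p.map (continuous_inclusion hs))).symm
    | some j, some k, a, b, p => by
      obtain rfl := hA.piece_unique (j := j) (k := k) a.2.1 a.2.2
      rfl

end MulEquiv

end IsAttachment
namespace IsAttachment

variable {X : Type*} [TopologicalSpace X] {U : Set X} {J : Type*} {N : J → Set X}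
  {κ : J → Type*} {W : ∀ j, κ j → Set X}

/-- If the sets `N j` cover the complement of `U`, then the fundamental group of the whole space is
the free product of that of `U` with a free group which has a generator for each overlap `W j i`
other than a distinguished one for each `j`. -/
theorem nonempty_mulEquiv (hA : IsAttachment U N W) (i₀ : ∀ j, κ j) (hcov : U ∪ ⋃ j, N j = univ)
    (u : U) : Nonempty (FundamentalGroup X u.1 ≃*
      FundamentalGroup U u ∗ FreeGroup (Σ j, {i : κ j // i ≠ i₀ j})) := by
  classical
  obtain ⟨β, βu, hβ⟩ := hA.exists_base_paths u
  have hN : ∀ j, SimplyConnectedSpace (N j) := fun j => hA.simplyConnected_piece j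
  choose b hb using fun j i => (hA.simplyConnected_overlap j i).nonempty
  have hbU : ∀ j i, b j i ∈ U := fun j i => hA.overlap_subset_base j i (hb j i)
  have hbN : ∀ j i, b j i ∈ N j := fun j i => hA.overlap_subset_piece j i (hb j i)
  let D : ∀ j i, PathClass u.1 (b j i) := fun j i => (β ⟨b j i, hbU j i⟩).map (incl U)
  let k : ∀ j (a : N j), PathClass (⟨b j (i₀ j), hbN j (i₀ j)⟩ : N j) a :=
    fun j a => ⟦PathConnectedSpace.somePath _ _⟧
  -- the loop through `N j` that enters in the distinguished overlap and leaves in `W j i`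
  let τ : ∀ j, κ j → FundamentalGroup X u.1 := fun j i => FundamentalGroup.fromPath
    (((D j (i₀ j)).trans ((k j ⟨b j i, hbN j i⟩).map (incl (N j)))).trans (D j i).symm)
  have hτ₀ : ∀ j, τ j (i₀ j) = 1 := by
    intro j
    have h : k j ⟨b j (i₀ j), hbN j (i₀ j)⟩ = Path.Homotopic.Quotient.refl _ :=
      Subsingleton.elim _ _
    change Path.Homotopic.Quotient.trans (Path.Homotopic.Quotient.trans _ _) _ = _
    rw [h, quotient_map_refl]
    erw [Path.Homotopic.Quotient.trans_refl]
    exact Path.Homotopic.Quotient.trans_symm _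
  let φ : Target (U := U) i₀ u →* FundamentalGroup X u.1 :=
    Monoid.Coprod.lift (FundamentalGroup.map (incl U) u) (FreeGroup.lift fun s => τ s.1 s.2.1)
  -- `φ` is the homomorphism in the other direction, which maps the generators to these loops
  have hφgen : ∀ j i, φ (gen i₀ u j i) = τ j i := by
    intro j i
    rw [gen]
    split_ifs with h
    · rw [map_one, h, hτ₀]
    · simp [φ]
  let Ψ : PathHom X (Target (U := U) i₀ u) :=
    (hA.localPathHom i₀ u hβ).glue (hA.isOpen_cover) (exists_mem_cover hcov)
  have hΨU : ∀ {a c : U} (p : PathClass a c),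
      Ψ (p.map (incl U)) = Monoid.Coprod.inl (PathHom.ofBase β p) := fun p =>
    (hA.localPathHom i₀ u hβ).glue_map_inclusion hA.isOpen_cover (exists_mem_cover hcov) none p
  have hΨN : ∀ j {a c : N j} (p : PathClass a c),
      Ψ (p.map (incl (N j))) = height i₀ u W j c * (height i₀ u W j a)⁻¹ := fun j _ _ p =>
    (hA.localPathHom i₀ u hβ).glue_map_inclusion hA.isOpen_cover (exists_mem_cover hcov) (some j) p
  have hΨβ : ∀ a : U, Ψ ((β a).map (incl U)) = 1 := by
    intro a
    rw [hΨU, PathHom.ofBase_apply, βu, Path.Homotopic.Quotient.refl_trans,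
      Path.Homotopic.Quotient.trans_symm]
    exact map_one _
  have hΨτ : ∀ j i, Ψ (FundamentalGroup.toPath (τ j i)) = gen i₀ u j i := by
    intro j i
    change Ψ ((Path.Homotopic.Quotient.trans (Path.Homotopic.Quotient.trans _ _) _)) = _
    rw [Ψ.map_trans, Ψ.map_trans, Ψ.map_symm]
    erw [hΨβ, hΨβ, hΨN]
    rw [hA.height_of_mem (x := ⟨b j (i₀ j), hbN j (i₀ j)⟩) i₀ u (hb j (i₀ j)),
      hA.height_of_mem (x := ⟨b j i, hbN j i⟩) i₀ u (hb j i)]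
    simp [gen]
  have hψφ : (Ψ.toMonoidHom u.1).comp φ = MonoidHom.id _ := by
    refine Monoid.Coprod.hom_ext ?_ ?_
    · ext p
      change Ψ (FundamentalGroup.toPath (φ (Monoid.Coprod.inl p))) = Monoid.Coprod.inl p
      simp only [φ, Monoid.Coprod.lift_apply_inl]
      refine (hΨU (FundamentalGroup.toPath p)).trans ?_
      rw [PathHom.ofBase_apply, βu, Path.Homotopic.Quotient.refl_trans]
      congr 1
      exact Path.Homotopic.Quotient.trans_refl _
    · ext s
      change Ψ (FundamentalGroup.toPath (φ (Monoid.Coprod.inr (FreeGroup.of s)))) =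
        Monoid.Coprod.inr (FreeGroup.of s)
      simp only [φ, Monoid.Coprod.lift_apply_inr, FreeGroup.lift_apply_of]
      refine (hΨτ s.1 s.2.1).trans ?_
      rw [gen, dif_neg s.2.2]
  -- paths from the base point to all points
  have hex : ∀ a : X, ∃ P : PathClass u.1 a, (∀ h : a ∈ U, P = (β ⟨a, h⟩).map (incl U)) ∧
      ∀ j (h : a ∈ N j), a ∉ U → P = (D j (i₀ j)).trans ((k j ⟨a, h⟩).map (incl (N j))) := by
    intro a
    by_cases h : a ∈ U
    · exact ⟨(β ⟨a, h⟩).map (incl U), fun _ => rfl, fun _ _ h' => (h' h).elim⟩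
    · have ha : a ∈ U ∪ ⋃ j, N j := hcov ▸ mem_univ a
      obtain ⟨j, hj⟩ := mem_iUnion.mp (ha.resolve_left h)
      refine ⟨(D j (i₀ j)).trans ((k j ⟨a, hj⟩).map (incl (N j))), fun h' => (h h').elim,
        fun j' hj' _ => ?_⟩
      obtain rfl := hA.piece_unique hj hj'
      rfl
  choose B hBU hBN using hex
  have hBu : B u.1 = Path.Homotopic.Quotient.refl _ := by
    rw [hBU u.1 u.2]
    change (β u).map (incl U) = _
    rw [βu]
    rfl
  -- on `N j` the height becomes the loop that enters in the distinguished overlap, runs to `a`,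
  -- and returns along the chosen path
  have hθ : ∀ j (a : N j), φ (height i₀ u W j a) = FundamentalGroup.fromPath
      (((D j (i₀ j)).trans ((k j a).map (incl (N j)))).trans (B a.1).symm) := by
    intro j a
    by_cases ha : a.1 ∈ U
    · obtain ⟨i, hi⟩ := hA.exists_overlap ha a.2
      have := hA.simplyConnected_overlap j i
      have : SimplyConnectedSpace (W j i) := this
      let q : PathClass (⟨b j i, hb j i⟩ : W j i) ⟨a.1, hi⟩ := ⟦PathConnectedSpace.somePath _ _⟧
      have h1 : B a.1 = (D j i).trans (q.map (incl (W j i))) := by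
        have h3 := congrArg (fun P => Path.Homotopic.Quotient.map P (incl U)) (hβ j i _ _ q)
        rw [quotient_map_trans, ← Path.Homotopic.Quotient.map_comp] at h3
        exact (hBU _ ha).trans h3.symm
      have h2 : (k j a).map (incl (N j)) = ((k j ⟨b j i, hbN j i⟩).map (incl (N j))).trans
          (q.map (incl (W j i))) := by
        rw [Subsingleton.elim (k j a) ((k j ⟨b j i, hbN j i⟩).trans
          (q.map (inclOf (hA.overlap_subset_piece j i)))), quotient_map_trans,
          ← Path.Homotopic.Quotient.map_comp]
        rfl
      rw [hA.height_of_mem (i := i) i₀ u hi, hφgen, h1, h2]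
      simp only [τ, quotient_symm_trans_rev, Path.Homotopic.Quotient.trans_assoc]
      erw [quotient_trans_symm_cancel]
    · rw [height_of_notMem, map_one, hBN a.1 j a.2 ha, Path.Homotopic.Quotient.trans_symm]
      · rfl
      · exact fun i hi => ha (hA.overlap_subset_base j i hi)
  have hBU' : ∀ a : U, B (incl U a) = (β a).map (incl U) := fun a => hBU a.1 a.2
  have keyU : ∀ {a c : U} (q : PathClass a c),
      (Ψ.postcomp φ) (q.map (incl U)) = PathHom.ofBase B (q.map (incl U)) := by
    intro a c q
    change φ (Ψ (q.map (incl U))) = _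
    rw [hΨU, PathHom.ofBase_apply, PathHom.ofBase_apply, hBU' a, hBU' c]
    simp only [φ, Monoid.Coprod.lift_apply_inl]
    change Path.Homotopic.Quotient.map _ (incl U) = _
    rw [quotient_map_trans, quotient_map_trans, quotient_map_symm]
  have keyN : ∀ j {a c : N j} (q : PathClass a c),
      (Ψ.postcomp φ) (q.map (incl (N j))) = PathHom.ofBase B (q.map (incl (N j))) := by
    intro j a c q
    change φ (Ψ (q.map (incl (N j)))) = _
    have h2 : (k j c).map (incl (N j)) = ((k j a).map (incl (N j))).trans
        (q.map (incl (N j))) := by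
      rw [Subsingleton.elim (k j c) ((k j a).trans q), quotient_map_trans]
    rw [hΨN, map_mul, map_inv, mul_inv_eq_iff_eq_mul, hθ, hθ, h2, PathHom.ofBase_apply,
      FundamentalGroup.mul_def]
    simp only [Path.Homotopic.Quotient.trans_assoc]
    erw [quotient_symm_trans_cancel]
    rfl
  -- `φ ∘ Ψ` and the homomorphism that closes up paths agree on the members of the cover
  have hφψ : ∀ p : FundamentalGroup X u.1, φ (Ψ.toMonoidHom u.1 p) = p := by
    intro p
    have key : (Ψ.postcomp φ) (FundamentalGroup.toPath p) =
        PathHom.ofBase B (FundamentalGroup.toPath p) := by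
      refine PathHom.eq_of_cover hA.isOpen_cover (exists_mem_cover hcov) _ _ ?_ _
      rintro (_ | j) a c q
      · exact keyU q
      · exact keyN j q
    refine key.trans ?_
    rw [PathHom.ofBase_apply, hBu, Path.Homotopic.Quotient.refl_trans]
    exact Path.Homotopic.Quotient.trans_refl _
  exact ⟨{ Ψ.toMonoidHom u.1 with
    invFun := φ
    left_inv := hφψ
    right_inv := fun g => DFunLike.congr_fun hψφ g }⟩

end IsAttachment
/-- A homotopy equivalence induces isomorphisms of fundamental groups. -/
theorem nonempty_mulEquiv_of_homotopyEquiv {X Y : Type*} [TopologicalSpace X] [TopologicalSpace Y]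
    (e : ContinuousMap.HomotopyEquiv X Y) (x : X) :
    Nonempty (FundamentalGroup X x ≃* FundamentalGroup Y (e x)) := by
  have : (FundamentalGroupoid.map e.toFun).IsEquivalence :=
    (FundamentalGroupoidFunctor.equivOfHomotopyEquiv e).isEquivalence_functor
  refine ⟨MulEquiv.ofBijective (FundamentalGroup.map e.toFun x) ⟨fun p q h => ?_, fun p => ?_⟩⟩
  · exact (FundamentalGroupoid.map e.toFun).map_injective h
  · exact (FundamentalGroupoid.map e.toFun).map_surjective p

theorem isSimplyConnected_preimage_val {X : Type*} [TopologicalSpace X] {A S : Set X} (h : S ⊆ A)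
    (hS : IsSimplyConnected S) : IsSimplyConnected ((↑) ⁻¹' S : Set A) := by
  rw [← IsEmbedding.subtypeVal.isSimplyConnected_image, Subtype.image_preimage_val,
    inter_eq_right.mpr h]
  exact hS

namespace IsAttachment

variable {X : Type*} [TopologicalSpace X] {U : Set X} {J : Type*} {N : J → Set X}
  {κ : J → Type*} {W : ∀ j, κ j → Set X}

theorem preimage_val (hA : IsAttachment U N W) : IsAttachment
    ((↑) ⁻¹' U : Set ↥(U ∪ ⋃ j, N j)) (fun j => (↑) ⁻¹' N j) (fun j i => (↑) ⁻¹' W j i) where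
  isOpen_base := hA.isOpen_base.preimage continuous_subtype_val
  isPathConnected_base := by
    rw [IsInducing.subtypeVal.isPathConnected_iff, Subtype.image_preimage_val,
      inter_eq_right.mpr subset_union_left]
    exact hA.isPathConnected_base
  isOpen_piece j := (hA.isOpen_piece j).preimage continuous_subtype_val
  simplyConnected_piece j := isSimplyConnected_preimage_val
    (subset_union_of_subset_right (subset_iUnion N j) U) (hA.simplyConnected_piece j)
  disjoint_piece j k h := (hA.disjoint_piece j k h).preimage _
  isOpen_overlap j i := (hA.isOpen_overlap j i).preimage continuous_subtype_val
  simplyConnected_overlap j i := isSimplyConnected_preimage_val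
    ((hA.overlap_subset_base j i).trans subset_union_left) (hA.simplyConnected_overlap j i)
  disjoint_overlap j i k h := (hA.disjoint_overlap j i k h).preimage _
  iUnion_overlap j := by rw [← preimage_iUnion, hA.iUnion_overlap, preimage_inter]

theorem isPathConnected (hA : IsAttachment U N W) [∀ j, Nonempty (κ j)] :
    IsPathConnected (U ∪ ⋃ j, N j) := by
  rw [isPathConnected_iff_pathConnectedSpace]
  refine hA.preimage_val.pathConnectedSpace inferInstance ?_
  rw [← preimage_iUnion, ← preimage_union, Subtype.coe_preimage_self]

/-- The fundamental group of the union of `U` and the sets `N j`. -/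
theorem nonempty_mulEquiv_union (hA : IsAttachment U N W) (i₀ : ∀ j, κ j) (x : X) (hx : x ∈ U) :
    Nonempty (FundamentalGroup ↥(U ∪ ⋃ j, N j) ⟨x, Or.inl hx⟩ ≃*
      FundamentalGroup U ⟨x, hx⟩ ∗ FreeGroup (Σ j, {i : κ j // i ≠ i₀ j})) := by
  obtain ⟨e⟩ := hA.preimage_val.nonempty_mulEquiv i₀
    (by rw [← preimage_iUnion, ← preimage_union, Subtype.coe_preimage_self])
    ⟨⟨x, Or.inl hx⟩, hx⟩
  let h : ↥((↑) ⁻¹' U : Set ↥(U ∪ ⋃ j, N j)) ≃ₜ U :=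
    { toFun := fun y => ⟨y.1.1, y.2⟩
      invFun := fun y => ⟨⟨y.1, Or.inl y.2⟩, y.2⟩
      left_inv := fun _ => rfl
      right_inv := fun _ => rfl
      continuous_toFun := by fun_prop
      continuous_invFun := by fun_prop }
  obtain ⟨e'⟩ := nonempty_mulEquiv_of_homotopyEquiv h.toHomotopyEquiv ⟨⟨x, Or.inl hx⟩, hx⟩
  exact ⟨e.trans (MulEquiv.coprodCongr e' (MulEquiv.refl _))⟩

end IsAttachment

/-- The free product of two free groups is free on the disjoint union of the bases. -/
def freeGroupSumEquiv (α β : Type*) : FreeGroup α ∗ FreeGroup β ≃* FreeGroup (α ⊕ β) :=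
  MonoidHom.toMulEquiv
    (Monoid.Coprod.lift (FreeGroup.map Sum.inl) (FreeGroup.map Sum.inr))
    (FreeGroup.lift (Sum.elim (fun a => Monoid.Coprod.inl (FreeGroup.of a))
      fun b => Monoid.Coprod.inr (FreeGroup.of b)))
    (by ext <;> simp)
    (by ext (a | b) <;> simp)

/-! ### Cells of the discrete configuration space -/

section Cells

variable {α : Type*} {G : SimpleGraph α}

theorem pairCell_comm (σ τ : Set α) : pairCell σ τ = pairCell τ σ := by
  ext z
  simp only [pairCell, mem_image2]
  constructor <;> rintro ⟨a, ha, b, hb, rfl⟩ <;> exact ⟨b, hb, a, ha, Sym2.eq_swap⟩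

theorem mem_pairCell {σ τ : Set α} {a b : α} :
    s(a, b) ∈ pairCell σ τ ↔ a ∈ σ ∧ b ∈ τ ∨ b ∈ σ ∧ a ∈ τ := by
  simp only [pairCell, mem_image2]
  constructor
  · rintro ⟨x, hx, y, hy, h⟩
    rcases Sym2.eq_iff.mp h with ⟨rfl, rfl⟩ | ⟨rfl, rfl⟩
    · exact Or.inl ⟨hx, hy⟩
    · exact Or.inr ⟨hx, hy⟩
  · rintro (⟨h, h'⟩ | ⟨h, h'⟩)
    · exact ⟨a, h, b, h', rfl⟩
    · exact ⟨b, h, a, h', Sym2.eq_swap⟩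

theorem isCell_singleton (a : α) : IsCell G {a} := Or.inl ⟨a, rfl⟩

theorem isCell_pair {a b : α} (h : G.Adj a b) : IsCell G {a, b} := Or.inr ⟨a, b, h, rfl⟩

/-- A cell that contains `a` is `{a}` or an edge at `a`. -/
theorem IsCell.eq_of_mem {σ : Set α} (hσ : IsCell G σ) {a : α} (ha : a ∈ σ) :
    σ = {a} ∨ ∃ b, G.Adj a b ∧ σ = {a, b} := by
  rcases hσ with ⟨b, rfl⟩ | ⟨b, c, h, rfl⟩
  · exact Or.inl (by rw [mem_singleton_iff.mp ha])
  · rcases ha with rfl | rfl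
    · exact Or.inr ⟨c, h, rfl⟩
    · exact Or.inr ⟨b, h.symm, pair_comm _ _⟩

theorem IsCell.nonempty {σ : Set α} (hσ : IsCell G σ) : σ.Nonempty := by
  rcases hσ with ⟨b, rfl⟩ | ⟨b, c, h, rfl⟩ <;> simp

/-- A cell of the discrete configuration space which contains `s(a, b)` is the product of a cell
at `a` and a cell at `b`. -/
theorem exists_cells_of_mem_UD₂ {c : Set (Sym2 α)} (hc : c ∈ UD₂ G) {a b : α} (h : s(a, b) ∈ c) :
    ∃ σ τ, IsCell G σ ∧ IsCell G τ ∧ Disjoint σ τ ∧ c = pairCell σ τ ∧ a ∈ σ ∧ b ∈ τ := by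
  obtain ⟨σ, τ, hσ, hτ, hd, rfl⟩ := hc
  rcases mem_pairCell.mp h with ⟨ha, hb⟩ | ⟨hb, ha⟩
  · exact ⟨σ, τ, hσ, hτ, hd, rfl, ha, hb⟩
  · exact ⟨τ, σ, hτ, hσ, hd.symm, pairCell_comm _ _, ha, hb⟩

theorem ne_of_mem_UD₂ {c : Set (Sym2 α)} (hc : c ∈ UD₂ G) {a b : α} (h : s(a, b) ∈ c) : a ≠ b := by
  obtain ⟨σ, τ, -, -, hd, -, ha, hb⟩ := exists_cells_of_mem_UD₂ hc h
  rintro rfl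
  exact hd.le_bot ⟨ha, hb⟩

end Cells

/-! ### Squares in product structures -/

section Square

variable {α β γ : Type*} {G : SimpleGraph α} {H : SimpleGraph β} {Γ : SimpleGraph γ}
  {f : α × β → Sym2 γ}

theorem prod_mem_prodComplex {σ : Set α} {τ : Set β} (hσ : IsCell G σ) (hτ : IsCell H τ) :
    σ ×ˢ τ ∈ prodComplex G H := ⟨σ, τ, hσ, hτ, rfl⟩

/-- A pair of diagonally opposite vertices of a square is not an edge. -/
theorem pair_notMem_UD₂ {z w z' w' : γ} (hzz : z ≠ z') (hww : w ≠ w') (hzw : z ≠ w')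
    (hwz : w ≠ z') : ({s(z, w), s(z', w')} : Set (Sym2 γ)) ∉ UD₂ Γ := by
  intro h
  obtain ⟨σ, τ, -, -, -, h2, hz, hw⟩ := exists_cells_of_mem_UD₂ h (Or.inl rfl)
  have h3 : s(z', w') ∈ pairCell σ τ := h2 ▸ Or.inr rfl
  have key : ∀ {a b}, a ∈ σ → b ∈ τ → s(a, b) = s(z, w) ∨ s(a, b) = s(z', w') := by
    intro a b ha hb
    have : s(a, b) ∈ pairCell σ τ := mem_pairCell.mpr (Or.inl ⟨ha, hb⟩)
    rw [← h2] at this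
    exact this
  rcases mem_pairCell.mp h3 with ⟨ha, hb⟩ | ⟨hb, ha⟩
  · have := key hz hb
    simp only [Sym2.eq_iff] at this
    grind
  · have := key hz ha
    simp only [Sym2.eq_iff] at this
    grind

/-- In a square of a combinatorial map to the discrete configuration space, one direction moves one
of the two points, and the other direction moves the other point. -/
theorem IsCombinatorialMap.square (hf : IsCombinatorialMap (prodComplex G H) (UD₂ Γ) f) {a a' : α}
    {b b' : β} (ha : G.Adj a a') (hb : H.Adj b b') {z w : γ} (h : f (a, b) = s(z, w)) :
    ∃ z' w', Γ.Adj z z' ∧ Γ.Adj w w' ∧ z ≠ w' ∧ z' ≠ w ∧ z' ≠ w' ∧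
      ((f (a', b) = s(z', w) ∧ f (a, b') = s(z, w')) ∨
        (f (a', b) = s(z, w') ∧ f (a, b') = s(z', w))) := by
  obtain ⟨hinj, hmem⟩ := hf _ (prod_mem_prodComplex (isCell_pair ha) (isCell_pair hb))
  have m00 : (a, b) ∈ ({a, a'} : Set α) ×ˢ ({b, b'} : Set β) := by simp
  have m10 : (a', b) ∈ ({a, a'} : Set α) ×ˢ ({b, b'} : Set β) := by simp
  have m01 : (a, b') ∈ ({a, a'} : Set α) ×ˢ ({b, b'} : Set β) := by simp
  have m11 : (a', b') ∈ ({a, a'} : Set α) ×ˢ ({b, b'} : Set β) := by simp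
  have n1 : f (a', b) ≠ s(z, w) := by
    rw [← h]; intro e; have := hinj m10 m00 e; simp [ha.ne'] at this
  have n2 : f (a, b') ≠ s(z, w) := by
    rw [← h]; intro e; have := hinj m01 m00 e; simp [hb.ne'] at this
  have n3 : f (a', b) ≠ f (a, b') := by
    intro e; have := hinj m10 m01 e; simp [ha.ne'] at this
  have n4 : f (a', b') ≠ s(z, w) := by
    rw [← h]; intro e; have := hinj m11 m00 e; simp [hb.ne'] at this
  have n5 : f (a', b') ≠ f (a, b') := by
    intro e; have := hinj m11 m01 e; simp [ha.ne'] at this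
  have n6 : f (a', b') ≠ f (a', b) := by
    intro e; have := hinj m11 m10 e; simp [hb.ne'] at this
  obtain ⟨σ, τ, hσ, hτ, hd, he, hz, hw⟩ := exists_cells_of_mem_UD₂ hmem ⟨_, m00, h⟩
  have i10 : f (a', b) ∈ pairCell σ τ := he ▸ mem_image_of_mem f m10
  have i01 : f (a, b') ∈ pairCell σ τ := he ▸ mem_image_of_mem f m01
  have i11 : f (a', b') ∈ pairCell σ τ := he ▸ mem_image_of_mem f m11
  have e1 := (hf _ (prod_mem_prodComplex (isCell_pair ha) (isCell_singleton b))).2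
  have e2 := (hf _ (prod_mem_prodComplex (isCell_singleton a) (isCell_pair hb))).2
  rw [prod_singleton, image_image, image_pair, h] at e1
  rw [singleton_prod, image_image, image_pair, h] at e2
  rcases hσ.eq_of_mem hz with rfl | ⟨z', hzz, rfl⟩
  · rcases hτ.eq_of_mem hw with rfl | ⟨w', hww, rfl⟩ <;>
      simp only [pairCell, image2_singleton_left, image_pair, image_singleton, mem_insert_iff,
        mem_singleton_iff] at i10 i01 i11 <;> grind
  rcases hτ.eq_of_mem hw with rfl | ⟨w', hww, rfl⟩
  · simp only [pairCell, image2_singleton_right, image_pair, mem_insert_iff,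
      mem_singleton_iff] at i10 i01 i11
    grind
  simp only [disjoint_insert_left, disjoint_singleton_left, mem_insert_iff, mem_singleton_iff,
    not_or] at hd
  refine ⟨z', w', hzz, hww, hd.1.2, hd.2.1, hd.2.2, ?_⟩
  simp only [pairCell, image2_insert_left, image2_singleton_left, image_pair, mem_insert_iff,
    mem_singleton_iff, mem_union] at i10 i01
  have d1 : f (a', b) ≠ s(z', w') := fun e => pair_notMem_UD₂ (Γ := Γ) hzz.ne hww.ne hd.1.2
    (Ne.symm hd.2.1) (e ▸ e1)
  have d2 : f (a, b') ≠ s(z', w') := fun e => pair_notMem_UD₂ (Γ := Γ) hzz.ne hww.ne hd.1.2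
    (Ne.symm hd.2.1) (e ▸ e2)
  grind

/-- If every vertex of the factors has two neighbours, then at every vertex of an immersed product
both points can be moved in two ways, independently of each other. -/
theorem IsImmersion.exists_moves (hf : IsImmersion (prodComplex G H) (UD₂ Γ) f)
    {a a₁ a₂ : α} {b b₁ b₂ : β} (ha₁ : G.Adj a a₁) (ha₂ : G.Adj a a₂) (hane : a₁ ≠ a₂)
    (hb₁ : H.Adj b b₁) (hb₂ : H.Adj b b₂) (hbne : b₁ ≠ b₂) {z w : γ} (h : f (a, b) = s(z, w)) :
    ∃ z₁ z₂ w₁ w₂, Γ.Adj z z₁ ∧ Γ.Adj z z₂ ∧ z₁ ≠ z₂ ∧ Γ.Adj w w₁ ∧ Γ.Adj w w₂ ∧ w₁ ≠ w₂ ∧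
      z₁ ≠ w ∧ z₂ ≠ w ∧ z ≠ w₁ ∧ z ≠ w₂ ∧ z₁ ≠ w₁ ∧ z₁ ≠ w₂ ∧ z₂ ≠ w₁ ∧ z₂ ≠ w₂ := by
  have hzw : z ≠ w := by
    refine ne_of_mem_UD₂ (hf.1 _ (prod_mem_prodComplex (isCell_singleton a)
      (isCell_singleton b))).2 ?_
    exact ⟨(a, b), by simp, h⟩
  have hv : ({(a, b)} : Set (α × β)) ∈ prodComplex G H :=
    ⟨_, _, isCell_singleton a, isCell_singleton b, by simp⟩
  have na : f (a₁, b) ≠ f (a₂, b) := by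
    intro e
    have := hf.2 _ hv
      (x₁ := ({a, a₁} : Set α) ×ˢ {b}) (x₂ := ({a, a₂} : Set α) ×ˢ {b})
      ⟨prod_mem_prodComplex (isCell_pair ha₁) (isCell_singleton b), by simp⟩
      ⟨prod_mem_prodComplex (isCell_pair ha₂) (isCell_singleton b), by simp⟩
      (by simp only [prod_singleton, image_pair, e])
    have : (a₁, b) ∈ ({a, a₂} : Set α) ×ˢ ({b} : Set β) := this ▸ by simp
    simp [ha₁.ne', hane] at this
  have nb : f (a, b₁) ≠ f (a, b₂) := by
    intro e
    have := hf.2 _ hv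
      (x₁ := ({a} : Set α) ×ˢ {b, b₁}) (x₂ := ({a} : Set α) ×ˢ {b, b₂})
      ⟨prod_mem_prodComplex (isCell_singleton a) (isCell_pair hb₁), by simp⟩
      ⟨prod_mem_prodComplex (isCell_singleton a) (isCell_pair hb₂), by simp⟩
      (by simp only [singleton_prod, image_pair, e])
    have : (a, b₁) ∈ ({a} : Set α) ×ˢ ({b, b₂} : Set β) := this ▸ by simp
    simp [hb₁.ne', hbne] at this
  obtain ⟨z₁, w₁, h11⟩ := hf.1.square ha₁ hb₁ h
  obtain ⟨z₂, w₂, h22⟩ := hf.1.square ha₂ hb₂ h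
  obtain ⟨z₃, w₃, h12⟩ := hf.1.square ha₁ hb₂ h
  obtain ⟨z₄, w₄, h21⟩ := hf.1.square ha₂ hb₁ h
  have n1 := h11.1.ne
  have n2 := h11.2.1.ne
  have n3 := h22.1.ne
  have n4 := h22.2.1.ne
  have n5 := h12.1.ne
  have n6 := h12.2.1.ne
  have n7 := h21.1.ne
  have n8 := h21.2.1.ne
  refine ⟨z₁, z₂, w₁, w₂, h11.1, h22.1, ?_, h11.2.1, h22.2.1, ?_, h11.2.2.2.1, h22.2.2.2.1,
    h11.2.2.1, h22.2.2.1, h11.2.2.2.2.1, ?_, ?_, h22.2.2.2.2.1⟩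
  all_goals
    rcases h11 with ⟨-, -, -, -, -, ⟨p1, q1⟩ | ⟨p1, q1⟩⟩ <;>
    rcases h22 with ⟨-, -, -, -, -, ⟨p2, q2⟩ | ⟨p2, q2⟩⟩ <;>
    rcases h12 with ⟨-, -, -, -, _, ⟨p3, q3⟩ | ⟨p3, q3⟩⟩ <;>
    rcases h21 with ⟨-, -, -, -, _, ⟨p4, q4⟩ | ⟨p4, q4⟩⟩ <;>
    rw [p1] at p3 na <;> rw [p2] at p4 na <;> rw [q1] at q4 nb <;> rw [q2] at q3 nb <;>
    simp only [Sym2.eq_iff, ne_eq] at p3 p4 q3 q4 na nb <;> grind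

end Square
/-! ### Products of disjoint leafless subgraphs -/

section Disjoint

variable {γ : Type u} {Γ : SimpleGraph γ}

/-- The map from the product of two subsets to the unordered pairs. -/
def pairMap (A B : Set γ) (p : A × B) : Sym2 γ := s(p.1.1, p.2.1)

theorem pairMap_injective {A B : Set γ} (h : Disjoint A B) :
    Function.Injective (pairMap A B) := by
  rintro ⟨⟨a, ha⟩, ⟨b, hb⟩⟩ ⟨⟨a', ha'⟩, ⟨b', hb'⟩⟩ e
  rcases Sym2.eq_iff.mp e with ⟨rfl, rfl⟩ | ⟨rfl, rfl⟩
  · rfl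
  · exact (h.le_bot ⟨ha, hb'⟩).elim

theorem pairMap_image {A B : Set γ} (σ : Set A) (τ : Set B) :
    pairMap A B '' (σ ×ˢ τ) = pairCell ((↑) '' σ) ((↑) '' τ) := by
  ext z
  simp only [pairMap, pairCell, mem_image, mem_image2, mem_prod, Prod.exists]
  constructor
  · rintro ⟨a, b, ⟨ha, hb⟩, rfl⟩
    exact ⟨a, ⟨a, ha, rfl⟩, b, ⟨b, hb, rfl⟩, rfl⟩
  · rintro ⟨_, ⟨a, ha, rfl⟩, _, ⟨b, hb, rfl⟩, rfl⟩
    exact ⟨a, b, ⟨ha, hb⟩, rfl⟩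

theorem IsCell.image_val {A : Set γ} {σ : Set A} (h : IsCell (Γ.induce A) σ) :
    IsCell Γ ((↑) '' σ : Set γ) := by
  rcases h with ⟨a, rfl⟩ | ⟨a, b, hab, rfl⟩
  · rw [image_singleton]; exact isCell_singleton _
  · rw [image_pair]; exact isCell_pair hab

theorem IsCell.preimage_val {A : Set γ} {σ : Set γ} (h : IsCell Γ σ) (hA : σ ⊆ A) :
    IsCell (Γ.induce A) ((↑) ⁻¹' σ) := by
  rcases h with ⟨a, rfl⟩ | ⟨a, b, hab, rfl⟩
  · refine Or.inl ⟨⟨a, hA rfl⟩, ?_⟩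
    ext x
    simp [Subtype.ext_iff]
  · refine Or.inr ⟨⟨a, hA (Or.inl rfl)⟩, ⟨b, hA (Or.inr rfl)⟩, hab, ?_⟩
    ext x
    simp [Subtype.ext_iff]

/-- If the edges at `s(a, b)` of a cell are in the image, then both factors of the cell lie in the
given subsets. -/
theorem isLocalIsometry_pairMap {A B : Set γ} (h : Disjoint A B) :
    IsLocalIsometry (prodComplex (Γ.induce A) (Γ.induce B)) (UD₂ Γ) (pairMap A B) := by
  have hinj := pairMap_injective h
  refine ⟨⟨?_, fun _ _ _ _ _ _ e => hinj.image_injective e⟩, ?_⟩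
  · rintro _ ⟨σ, τ, hσ, hτ, rfl⟩
    refine ⟨hinj.injOn, _, _, hσ.image_val, hτ.image_val, ?_, pairMap_image σ τ⟩
    exact h.mono (Subtype.coe_image_subset _ _) (Subtype.coe_image_subset _ _)
  rintro ⟨⟨a, ha⟩, ⟨b, hb⟩⟩ - d ⟨hd, hab⟩ he
  obtain ⟨σ, τ, hσ, hτ, hστ, rfl, haσ, hbτ⟩ := exists_cells_of_mem_UD₂ hd hab
  have hσA : σ ⊆ A := by
    rcases hσ.eq_of_mem haσ with rfl | ⟨a', haa, rfl⟩
    · simpa using ha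
    refine insert_subset ha (singleton_subset_iff.mpr ?_)
    have hne : s(a, b) ≠ s(a', b) := fun e => haa.ne (Sym2.congr_left.mp e)
    obtain ⟨e', -, hfe⟩ := he {s(a, b), s(a', b)} ⟨⟨{a, a'}, {b}, isCell_pair haa,
      isCell_singleton b, hστ.mono_right (singleton_subset_iff.mpr hbτ),
      by simp [pairCell, image_pair]⟩, Or.inl rfl, ncard_pair hne⟩
      (insert_subset hab (singleton_subset_iff.mpr (mem_pairCell.mpr (Or.inl ⟨by simp, hbτ⟩))))
    obtain ⟨⟨⟨x, hx⟩, ⟨y, hy⟩⟩, -, hxy⟩ : s(a', b) ∈ pairMap A B '' e' := hfe ▸ Or.inr rfl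
    rcases Sym2.eq_iff.mp hxy with ⟨rfl, rfl⟩ | ⟨rfl, rfl⟩
    · exact hx
    · exact (h.le_bot ⟨hx, hb⟩).elim
  have hτB : τ ⊆ B := by
    rcases hτ.eq_of_mem hbτ with rfl | ⟨b', hbb, rfl⟩
    · simpa using hb
    refine insert_subset hb (singleton_subset_iff.mpr ?_)
    have hne : s(a, b) ≠ s(a, b') := fun e => hbb.ne (Sym2.congr_right.mp e)
    obtain ⟨e', -, hfe⟩ := he {s(a, b), s(a, b')} ⟨⟨{a}, {b, b'}, isCell_singleton a,
      isCell_pair hbb, hστ.mono_left (singleton_subset_iff.mpr haσ),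
      by simp [pairCell, pair_comm]⟩, Or.inl rfl, ncard_pair hne⟩
      (insert_subset hab (singleton_subset_iff.mpr (mem_pairCell.mpr (Or.inl ⟨haσ, by simp⟩))))
    obtain ⟨⟨⟨x, hx⟩, ⟨y, hy⟩⟩, -, hxy⟩ : s(a, b') ∈ pairMap A B '' e' := hfe ▸ Or.inr rfl
    rcases Sym2.eq_iff.mp hxy with ⟨rfl, rfl⟩ | ⟨rfl, rfl⟩
    · exact hy
    · exact (h.le_bot ⟨ha, hy⟩).elim
  refine ⟨(((↑) : A → γ) ⁻¹' σ) ×ˢ (((↑) : B → γ) ⁻¹' τ),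
    ⟨prod_mem_prodComplex (hσ.preimage_val hσA) (hτ.preimage_val hτB), haσ, hbτ⟩, ?_⟩
  simp only [pairMap_image, Subtype.image_preimage_coe, inter_eq_right.mpr hσA,
    inter_eq_right.mpr hτB]

theorem nontrivial_of_two_neighbours {A : Set γ} (hne : A.Nonempty)
    (hA : ∀ a ∈ A, ∃ b ∈ A, ∃ c ∈ A, b ≠ c ∧ Γ.Adj a b ∧ Γ.Adj a c) : Nontrivial A := by
  obtain ⟨a, ha⟩ := hne
  obtain ⟨b, hb, -, -, -, hab, -⟩ := hA a ha
  exact ⟨⟨a, ha⟩, ⟨b, hb⟩, fun e => hab.ne (congrArg Subtype.val e)⟩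

theorem noLeaves_of_two_neighbours {A : Set γ}
    (hA : ∀ a ∈ A, ∃ b ∈ A, ∃ c ∈ A, b ≠ c ∧ Γ.Adj a b ∧ Γ.Adj a c) :
    NoLeaves (Γ.induce A) := by
  rintro ⟨a, ha⟩ h
  obtain ⟨b, hb, c, hc, hbc, hab, hac⟩ := hA a ha
  obtain ⟨x, hx⟩ := ncard_eq_one.mp h
  have h1 : (⟨b, hb⟩ : A) ∈ (Γ.induce A).neighborSet ⟨a, ha⟩ := hab
  have h2 : (⟨c, hc⟩ : A) ∈ (Γ.induce A).neighborSet ⟨a, ha⟩ := hac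
  rw [hx, mem_singleton_iff] at h1 h2
  exact hbc (congrArg Subtype.val (h1.trans h2.symm))

/-- Two disjoint connected subgraphs without leaves span a standard product subcomplex. -/
theorem isStandardProduct_pairMap [Finite γ] {A B : Set γ} (h : Disjoint A B)
    (hAc : (Γ.induce A).Connected) (hBc : (Γ.induce B).Connected)
    (hA : ∀ a ∈ A, ∃ b ∈ A, ∃ c ∈ A, b ≠ c ∧ Γ.Adj a b ∧ Γ.Adj a c)
    (hB : ∀ a ∈ B, ∃ b ∈ B, ∃ c ∈ B, b ≠ c ∧ Γ.Adj a b ∧ Γ.Adj a c) :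
    IsStandardProduct (UD₂ Γ)
      ((fun c => pairMap A B '' c) '' prodComplex (Γ.induce A) (Γ.induce B)) := by
  obtain ⟨a⟩ := hAc.nonempty
  obtain ⟨b⟩ := hBc.nonempty
  refine ⟨A, B, inferInstance, inferInstance, Γ.induce A, Γ.induce B, pairMap A B, hAc, hBc,
    nontrivial_of_two_neighbours ⟨a, a.2⟩ hA, nontrivial_of_two_neighbours ⟨b, b.2⟩ hB,
    noLeaves_of_two_neighbours hA, noLeaves_of_two_neighbours hB,
    ⟨isLocalIsometry_pairMap h, ⟨b, ?_⟩, ⟨a, ?_⟩⟩, rfl⟩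
  · exact fun x y e => congrArg Prod.fst (pairMap_injective h e)
  · exact fun x y e => congrArg Prod.snd (pairMap_injective h e)

theorem NoLeaves.exists_two_neighbours {α : Type*} [Finite α] [Nontrivial α] {G : SimpleGraph α}
    (hG : G.Connected) (h : NoLeaves G) (a : α) : ∃ b c, b ≠ c ∧ G.Adj a b ∧ G.Adj a c := by
  obtain ⟨b, hb⟩ := exists_ne a
  have hne : (G.neighborSet a).Nonempty := by
    obtain ⟨p⟩ := hG.preconnected a b
    cases p with
    | nil => exact (hb rfl).elim
    | cons h _ => exact ⟨_, h⟩
  have h1 := (ncard_pos (s := G.neighborSet a)).mpr hne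
  have h2 := h a
  obtain ⟨b, hb, c, hc, hbc⟩ := (one_lt_ncard (s := G.neighborSet a)).mp (by omega)
  exact ⟨b, c, hbc, hb, hc⟩

end Disjoint

/-! ### Separating subtrees of a tree -/

section Tree

variable {V : Type u} {T : SimpleGraph V}

/-- A walk which ends off `P` either avoids `P`, or has a last exit from `P`. -/
theorem exists_last_exit {P : Set V} {x q : V} (p : T.Walk x q) :
    (∀ y ∈ p.support, y ∉ P) ∨ q ∈ P ∨ ∃ c c', c ∈ P ∧ T.Adj c c' ∧
      ∃ r : T.Walk c' q, ∀ y ∈ r.support, y ∉ P := by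
  induction p with
  | nil =>
    rename_i y
    by_cases hy : y ∈ P
    · exact Or.inr (Or.inl hy)
    · exact Or.inl (by simpa using hy)
  | cons h p ih =>
    rename_i x y z
    rcases ih with ih | ih | ih
    · by_cases hx : x ∈ P
      · exact Or.inr (Or.inr ⟨x, y, hx, h, p, ih⟩)
      · refine Or.inl ?_
        simpa [hx] using ih
    · exact Or.inr (Or.inl ih)
    · exact Or.inr (Or.inr ih)

theorem reachable_deleteEdges_of_notMem_support {c c' x y : V} (r : T.Walk x y)
    (hr : c ∉ r.support) : (T.deleteEdges {s(c, c')}).Reachable x y := by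
  refine ⟨r.toDeleteEdges {s(c, c')} ?_⟩
  rintro e he rfl
  exact hr (r.fst_mem_support_of_mem_edges he)

/-- Two disjoint cells of a tree lie on different sides of an edge: they are contained in disjoint
connected sets of vertices, such that each vertex has at most one neighbour outside its set. -/
theorem exists_separation (hT : T.IsTree) {P Q : Set V} (hP : IsCell T P) (hQ : IsCell T Q)
    (hPQ : Disjoint P Q) : ∃ A B : Set V, Disjoint A B ∧ P ⊆ A ∧ Q ⊆ B ∧
      (T.induce A).Connected ∧ (T.induce B).Connected ∧
      (∀ v ∈ A, ∀ w, T.Adj v w → w ∉ A → ∀ w', T.Adj v w' → w' ∉ A → w = w') ∧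
      ∀ v ∈ B, ∀ w, T.Adj v w → w ∉ B → ∀ w', T.Adj v w' → w' ∉ B → w = w' := by
  obtain ⟨p, hp⟩ := hP.nonempty
  obtain ⟨q, hq⟩ := hQ.nonempty
  have hqP : q ∉ P := fun h => hPQ.le_bot ⟨h, hq⟩
  obtain ⟨r₀⟩ := hT.1.preconnected p q
  obtain ⟨c, c', hc, hcc, r, hr⟩ : ∃ c c', c ∈ P ∧ T.Adj c c' ∧
      ∃ r : T.Walk c' q, ∀ y ∈ r.support, y ∉ P := by
    rcases exists_last_exit (P := P) r₀ with h | h | h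
    · exact (h p r₀.start_mem_support hp).elim
    · exact (hqP h).elim
    · exact h
  have hc' : c' ∉ P := hr c' r.start_mem_support
  have hcQ : c ∉ Q := fun h => hPQ.le_bot ⟨hc, h⟩
  let D := T.deleteEdges {s(c, c')}
  -- the edge along which the walk last leaves `P` separates the tree
  have hbr : ¬ D.Reachable c c' := by
    have h := SimpleGraph.isAcyclic_iff_forall_adj_isBridge.mp hT.2 hcc
    exact h
  have hDadj : ∀ {x y}, T.Adj x y → s(x, y) ≠ s(c, c') → D.Adj x y := fun h hne => by
    simp only [D, SimpleGraph.deleteEdges_adj, mem_singleton_iff]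
    exact ⟨h, hne⟩
  have hconn : ∀ x, (T.induce {y | D.Reachable y x}).Connected := by
    intro x
    have h : {y | D.Reachable y x} = (D.connectedComponentMk x).supp := by
      ext y
      simp [SimpleGraph.ConnectedComponent.mem_supp_iff]
    rw [h]
    exact (D.connectedComponentMk x).connected_toSimpleGraph.mono
      fun a b hab => T.deleteEdges_le _ hab
  refine ⟨{y | D.Reachable y c}, {y | D.Reachable y c'}, ?_, ?_, ?_, hconn c, hconn c', ?_, ?_⟩
  · rw [Set.disjoint_left]
    exact fun x hx hx' => hbr (hx.symm.trans hx')
  · intro x hx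
    rcases hP.eq_of_mem hc with rfl | ⟨b, hb, rfl⟩
    · rw [mem_singleton_iff.mp hx]
      exact SimpleGraph.Reachable.refl _
    · rcases hx with rfl | rfl
      · exact SimpleGraph.Reachable.refl _
      · refine (hDadj hb ?_).reachable.symm
        rw [Ne, Sym2.congr_right]
        rintro rfl
        simp at hc'
  · have hqB : D.Reachable q c' :=
      (reachable_deleteEdges_of_notMem_support r fun h => hr c h hc).symm
    intro x hx
    rcases hQ.eq_of_mem hq with rfl | ⟨b, hb, rfl⟩
    · rw [mem_singleton_iff.mp hx]
      exact hqB
    · rcases hx with rfl | rfl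
      · exact hqB
      · refine (hDadj hb ?_).reachable.symm.trans hqB
        intro e
        have : c ∈ s(q, x) := e ▸ Sym2.mem_mk_left c c'
        rcases Sym2.mem_iff.mp this with rfl | rfl <;> simp at hcQ
  · have key : ∀ v, D.Reachable v c → ∀ w, T.Adj v w → ¬ D.Reachable w c → w = c' := by
      intro v hv w hvw hw
      by_contra hne
      refine hw ((hDadj hvw ?_).reachable.symm.trans hv)
      intro e
      rcases Sym2.eq_iff.mp e with ⟨-, h⟩ | ⟨rfl, rfl⟩
      · exact hne h
      · exact hbr hv.symm
    intro v hv w hvw hw w' hvw' hw'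
    rw [key v hv w hvw hw, key v hv w' hvw' hw']
  · have key : ∀ v, D.Reachable v c' → ∀ w, T.Adj v w → ¬ D.Reachable w c' → w = c := by
      intro v hv w hvw hw
      by_contra hne
      refine hw ((hDadj hvw ?_).reachable.symm.trans hv)
      intro e
      rcases Sym2.eq_iff.mp e with ⟨rfl, rfl⟩ | ⟨rfl, h⟩
      · exact hbr hv
      · exact hne h
    intro v hv w hvw hw w' hvw' hw'
    rw [key v hv w hvw hw, key v hv w' hvw' hw']

end Tree
/-! ### The union of the maximal product subcomplexes -/

section Bunch

variable {V : Type u} {T : SimpleGraph V} {ℓ : V → ℕ}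

/-- The map from the vertices of a bunch of grapes to those of the stem that collapses every grape
to the vertex to which it is attached. -/
def stem : GrapeVertex ℓ → V
  | .inl v => v
  | .inr (g, _) => g.1

@[simp] theorem stem_inr (g : Σ v : V, Fin (ℓ v)) (i : Bool) : stem (ℓ := ℓ) (.inr (g, i)) = g.1 :=
  rfl

theorem adj_inl {a b : V} : (bunch T ℓ).Adj (.inl a) (.inl b) ↔ T.Adj a b := Iff.rfl

theorem adj_inl_inr {a : V} {g : Σ v : V, Fin (ℓ v)} {i : Bool} :
    (bunch T ℓ).Adj (.inl a) (.inr (g, i)) ↔ a = g.1 := Iff.rfl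

theorem adj_inr_inl {a : V} {g : Σ v : V, Fin (ℓ v)} {i : Bool} :
    (bunch T ℓ).Adj (.inr (g, i)) (.inl a) ↔ a = g.1 := Iff.rfl

theorem adj_inr {g h : Σ v : V, Fin (ℓ v)} {i j : Bool} :
    (bunch T ℓ).Adj (.inr (g, i)) (.inr (h, j)) ↔ g = h ∧ i ≠ j := Iff.rfl

/-- An edge whose ends lie over different vertices of the stem is an edge of the stem. -/
theorem adj_of_stem_ne {x y : GrapeVertex ℓ} (h : (bunch T ℓ).Adj x y) (hne : stem x ≠ stem y) :
    x = .inl (stem x) ∧ y = .inl (stem y) ∧ T.Adj (stem x) (stem y) := by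
  rcases x with a | ⟨g, i⟩ <;> rcases y with b | ⟨k, j⟩
  · exact ⟨rfl, rfl, h⟩
  · exact (hne h).elim
  · exact (hne (Eq.symm h)).elim
  · exact (hne (congrArg Sigma.fst h.1)).elim

theorem isCell_image_stem {σ : Set (GrapeVertex ℓ)} (h : IsCell (bunch T ℓ) σ) :
    IsCell T (stem '' σ) := by
  rcases h with ⟨a, rfl⟩ | ⟨a, b, hab, rfl⟩
  · rw [image_singleton]; exact isCell_singleton _
  · rw [image_pair]
    by_cases hne : stem a = stem b
    · rw [hne, pair_eq_singleton]; exact isCell_singleton _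
    · exact isCell_pair (adj_of_stem_ne hab hne).2.2

/-- If a vertex of a grape has two distinct neighbours, one of them is on the stem. -/
theorem mem_of_two_neighbours {g : Σ v : V, Fin (ℓ v)} {i : Bool} {y z : GrapeVertex ℓ}
    (hy : (bunch T ℓ).Adj (.inr (g, i)) y) (hz : (bunch T ℓ).Adj (.inr (g, i)) z) (hne : y ≠ z) :
    y = .inl g.1 ∨ z = .inl g.1 := by
  rcases y with a | ⟨k, j⟩
  · exact Or.inl (by rw [adj_inr_inl.mp hy])
  rcases z with b | ⟨k', j'⟩
  · exact Or.inr (by rw [adj_inr_inl.mp hz])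
  obtain ⟨rfl, hj⟩ := adj_inr.mp hy
  obtain ⟨rfl, hj'⟩ := adj_inr.mp hz
  exact (hne (by rw [show j = j' by revert hj hj'; cases i <;> cases j <;> cases j' <;> simp])).elim

/-- The cells of the discrete configuration space whose two points are separated, that is, lie over
disjoint parts of the stem. -/
def separated (T : SimpleGraph V) (ℓ : V → ℕ) : Set (Set (Sym2 (GrapeVertex ℓ))) :=
  {c | c ∈ UD₂ (bunch T ℓ) ∧ ∀ a b, s(a, b) ∈ c → stem a ≠ stem b}

theorem pairCell_mem_separated {σ τ : Set (GrapeVertex ℓ)} (hσ : IsCell (bunch T ℓ) σ)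
    (hτ : IsCell (bunch T ℓ) τ) :
    pairCell σ τ ∈ separated T ℓ ↔ ∀ a ∈ σ, ∀ b ∈ τ, stem a ≠ stem b := by
  constructor
  · intro h a ha b hb
    exact h.2 a b (mem_pairCell.mpr (Or.inl ⟨ha, hb⟩))
  · intro h
    refine ⟨⟨σ, τ, hσ, hτ, ?_, rfl⟩, fun a b hab => ?_⟩
    · rw [Set.disjoint_left]
      exact fun x hx hx' => h x hx x hx' rfl
    · rcases mem_pairCell.mp hab with ⟨ha, hb⟩ | ⟨hb, ha⟩
      · exact h a ha b hb
      · exact (h b hb a ha).symm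

/-- The cells of a standard product subcomplex are separated: where both points lie over the same
vertex of the stem, one of them is on a grape, and since both can be moved in two ways, both could
be moved to that vertex. -/
theorem IsStandardProduct.subset_separated {K : Set (Set (Sym2 (GrapeVertex ℓ)))}
    (hK : IsStandardProduct (UD₂ (bunch T ℓ)) K) : K ⊆ separated T ℓ := by
  obtain ⟨α, β, _, _, G, H, f, hG, hH, _, _, hGl, hHl, ⟨⟨hf, -⟩, -⟩, rfl⟩ := hK
  rintro _ ⟨c, hc, rfl⟩
  refine ⟨(hf.1 c hc).2, ?_⟩
  rintro z w ⟨⟨a, b⟩, -, h⟩ hzw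
  obtain ⟨a₁, a₂, hane, ha₁, ha₂⟩ := hGl.exists_two_neighbours hG a
  obtain ⟨b₁, b₂, hbne, hb₁, hb₂⟩ := hHl.exists_two_neighbours hH b
  obtain ⟨z₁, z₂, w₁, w₂, hz₁, hz₂, hz, hw₁, hw₂, hw, h1, h2, h1', h2', h3, h4, h5,
    h6⟩ :=
    hf.exists_moves ha₁ ha₂ hane hb₁ hb₂ hbne h
  have hne : z ≠ w := ne_of_mem_UD₂ (hf.1 _ (prod_mem_prodComplex (isCell_singleton a)
    (isCell_singleton b))).2 ⟨(a, b), by simp, h⟩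
  -- `z` and `w` lie over the same vertex of the stem; if one of them is on a grape, one of its two
  -- moves leads to this vertex
  rcases z with v | ⟨g, i⟩ <;> rcases w with v' | ⟨k, j⟩
  · exact hne (congrArg Sum.inl hzw)
  · have hv : v = k.1 := hzw
    subst hv
    rcases mem_of_two_neighbours hw₁ hw₂ hw with e | e
    · exact h1' e.symm
    · exact h2' e.symm
  · have hv : g.1 = v' := hzw
    subst hv
    rcases mem_of_two_neighbours hz₁ hz₂ hz with e | e
    · exact h1 e
    · exact h2 e
  · have hv : g.1 = k.1 := hzw
    rcases mem_of_two_neighbours hz₁ hz₂ hz with e | e <;>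
      rcases mem_of_two_neighbours hw₁ hw₂ hw with e' | e' <;> rw [← hv] at e' <;> grind

/-- If the vertices of `A` have at most one neighbour outside `A` in the stem, then the part of a
normal bunch of grapes over `A` has no leaves. -/
theorem two_neighbours_preimage [Finite V] (hnormal : IsNormal T ℓ) {A : Set V}
    (hA : ∀ v ∈ A, ∀ w, T.Adj v w → w ∉ A → ∀ w', T.Adj v w' → w' ∉ A → w = w') :
    ∀ a ∈ stem (ℓ := ℓ) ⁻¹' A, ∃ b ∈ stem (ℓ := ℓ) ⁻¹' A, ∃ c ∈ stem (ℓ := ℓ) ⁻¹' A,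
      b ≠ c ∧ (bunch T ℓ).Adj a b ∧ (bunch T ℓ).Adj a c := by
  rintro (v | ⟨g, i⟩) ha
  · by_contra hcon
    push Not at hcon
    have hsub : ((bunch T ℓ).neighborSet (.inl v) ∩ stem ⁻¹' A).Subsingleton := by
      intro x hx y hy
      by_contra hxy
      exact hcon x hx.2 y hy.2 hxy hx.1 hy.1
    have hsub' : ((bunch T ℓ).neighborSet (.inl v) \ stem ⁻¹' A).Subsingleton := by
      have key : ∀ x ∈ (bunch T ℓ).neighborSet (.inl v) \ stem ⁻¹' A,
          x = .inl (stem x) ∧ T.Adj v (stem x) ∧ stem x ∉ A := by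
        intro x hx
        have h := adj_of_stem_ne hx.1 (fun e => hx.2 (by
          change stem x ∈ A
          rw [← e]; exact ha))
        exact ⟨h.2.1, h.2.2, hx.2⟩
      intro x hx y hy
      rw [(key x hx).1, (key y hy).1, hA v ha _ (key x hx).2.1 (key x hx).2.2 _ (key y hy).2.1
        (key y hy).2.2]
    have h1 := ncard_le_one_iff_subsingleton.mpr hsub
    have h2 := ncard_le_one_iff_subsingleton.mpr hsub'
    have h3 := ncard_inter_add_ncard_sdiff_eq_ncard ((bunch T ℓ).neighborSet (.inl v)) (stem ⁻¹' A)
    have h4 := hnormal v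
    omega
  · refine ⟨.inl g.1, ha, .inr (g, !i), ha, Sum.inl_ne_inr, ?_, ?_⟩
    · exact adj_inr_inl.mpr rfl
    · exact adj_inr.mpr ⟨rfl, by cases i <;> simp⟩

theorem connected_preimage {A : Set V} (hA : (T.induce A).Connected) :
    ((bunch T ℓ).induce (stem ⁻¹' A)).Connected := by
  let φ : T.induce A →g (bunch T ℓ).induce (stem ⁻¹' A) :=
    { toFun := fun v => ⟨.inl v.1, v.2⟩
      map_rel' := fun h => h }
  have hbase : ∀ x : ↥(stem (ℓ := ℓ) ⁻¹' A),
      ((bunch T ℓ).induce (stem ⁻¹' A)).Reachable x (φ ⟨stem x.1, x.2⟩) := by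
    rintro ⟨v | ⟨g, i⟩, hx⟩
    · exact SimpleGraph.Reachable.refl _
    · exact SimpleGraph.Adj.reachable (adj_inr_inl (T := T) (i := i).mpr rfl)
  obtain ⟨v⟩ := hA.nonempty
  have : Nonempty ↥(stem (ℓ := ℓ) ⁻¹' A) := ⟨φ v⟩
  exact ⟨fun x y => (hbase x).trans (((hA.preconnected _ _).map φ).trans (hbase y).symm)⟩

/-- The union of the maximal product subcomplexes consists of the separated cells. -/
theorem UP₂_bunch [Finite V] (hT : T.IsTree) (hnormal : IsNormal T ℓ) :
    UP₂ (bunch T ℓ) = separated T ℓ := by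
  ext c
  constructor
  · rintro ⟨K, hK, hc⟩
    exact hK.1.subset_separated hc
  rintro ⟨⟨σ, τ, hσ, hτ, -, rfl⟩, hc⟩
  have hd : Disjoint (stem '' σ) (stem '' τ) := by
    rw [Set.disjoint_left]
    rintro _ ⟨a, ha, rfl⟩ ⟨b, hb, e⟩
    exact hc a b (mem_pairCell.mpr (Or.inl ⟨ha, hb⟩)) e.symm
  obtain ⟨A, B, hAB, hPA, hQB, hAc, hBc, hA, hB⟩ :=
    exists_separation hT (isCell_image_stem hσ) (isCell_image_stem hτ) hd
  have hK := isStandardProduct_pairMap (Γ := bunch T ℓ)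
    (A := stem ⁻¹' A) (B := stem ⁻¹' B) (hAB.preimage _)
    (connected_preimage hAc) (connected_preimage hBc) (two_neighbours_preimage hnormal hA)
    (two_neighbours_preimage hnormal hB)
  obtain ⟨M, hKM, hM⟩ := (toFinite {K | IsStandardProduct (UD₂ (bunch T ℓ)) K}).exists_le_maximal hK
  have hσA : σ ⊆ stem ⁻¹' A := image_subset_iff.mp hPA
  have hτB : τ ⊆ stem ⁻¹' B := image_subset_iff.mp hQB
  refine ⟨M, hM, hKM ⟨_, prod_mem_prodComplex (hσ.preimage_val hσA) (hτ.preimage_val hτB), ?_⟩⟩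
  simp only [pairMap_image, Subtype.image_preimage_coe, inter_eq_right.mpr hσA,
    inter_eq_right.mpr hτB]

/-- A square all of whose edges at one vertex are separated is separated: its edges would otherwise
lead to the same vertex of the stem, and its factors would not be disjoint. -/
theorem isLocallyConvex_separated : IsLocallyConvex (separated T ℓ) (UD₂ (bunch T ℓ)) := by
  refine ⟨⟨fun c hc => hc.1, fun c hc d hd hdc => ⟨hd, fun a b h => hc.2 a b (hdc h)⟩⟩,
    ⟨fun c hc => ⟨injOn_id _, by rw [image_id]; exact hc.1⟩, fun a _ c _ d _ h => by
      simpa using h⟩, ?_⟩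
  intro z hz d ⟨hd, hzd⟩ he
  refine ⟨d, ⟨⟨hd, ?_⟩, hzd⟩, image_id d⟩
  induction z using Sym2.ind with | _ x y =>
  obtain ⟨σ, τ, hσ, hτ, hστ, rfl, hx, hy⟩ := exists_cells_of_mem_UD₂ hd hzd
  have hxy : stem x ≠ stem y := hz.2 x y rfl
  -- the points which are connected to the vertex by an edge of the cell are separated
  have h1 : ∀ x' ∈ σ, stem x' ≠ stem y := by
    intro x' hx'
    rcases hσ.eq_of_mem hx with rfl | ⟨x'', hxx, rfl⟩
    · rwa [mem_singleton_iff.mp hx']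
    rcases hx' with rfl | rfl
    · exact hxy
    have hne : s(x, y) ≠ s(x', y) := fun e => hxx.ne (Sym2.congr_left.mp e)
    obtain ⟨e', he', hee⟩ := he {s(x, y), s(x', y)} ⟨⟨{x, x'}, {y}, hσ,
      isCell_singleton y, hστ.mono_right (singleton_subset_iff.mpr hy),
      by simp [pairCell, image_pair]⟩, Or.inl rfl, ncard_pair hne⟩
      (insert_subset hzd (singleton_subset_iff.mpr (mem_pairCell.mpr (Or.inl ⟨by simp, hy⟩))))
    rw [image_id] at hee
    exact he'.1.2 x' y (hee ▸ Or.inr rfl)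
  have h2 : ∀ y' ∈ τ, stem x ≠ stem y' := by
    intro y' hy'
    rcases hτ.eq_of_mem hy with rfl | ⟨y'', hyy, rfl⟩
    · rwa [mem_singleton_iff.mp hy']
    rcases hy' with rfl | rfl
    · exact hxy
    have hne : s(x, y) ≠ s(x, y') := fun e => hyy.ne (Sym2.congr_right.mp e)
    obtain ⟨e', he', hee⟩ := he {s(x, y), s(x, y')} ⟨⟨{x}, {y, y'}, isCell_singleton x, hτ,
      hστ.mono_left (singleton_subset_iff.mpr hx),
      by simp [pairCell, pair_comm]⟩, Or.inl rfl, ncard_pair hne⟩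
      (insert_subset hzd (singleton_subset_iff.mpr (mem_pairCell.mpr (Or.inl ⟨hx, by simp⟩))))
    rw [image_id] at hee
    exact he'.1.2 x y' (hee ▸ Or.inr rfl)
  refine ((pairCell_mem_separated hσ hτ).mpr fun x' hx' y' hy' => ?_).2
  rcases hσ.eq_of_mem hx with rfl | ⟨x'', hxx, rfl⟩
  · rw [mem_singleton_iff.mp hx']
    exact h2 y' hy'
  rcases hτ.eq_of_mem hy with rfl | ⟨y'', hyy, rfl⟩
  · rw [mem_singleton_iff.mp hy']
    exact h1 x' hx'
  rcases hx' with rfl | rfl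
  · exact h2 y' hy'
  rcases hy' with rfl | rfl
  · exact h1 x' (by simp)
  intro e
  have e1 := (adj_of_stem_ne hxx (fun e' => h2 y' (by simp) (e'.trans e))).2.1
  have e2 := (adj_of_stem_ne hyy (fun e' => h1 x' (by simp) (e.trans e'.symm))).2.1
  exact hστ.le_bot ⟨Or.inr rfl, (by rw [e1, e, ← e2]; simp : x' ∈ _)⟩

end Bunch
/-! ### The unordered configuration space -/

section Configurations

variable {X : Type u} [TopologicalSpace X]

/-- The unordered configuration underlying an ordered one. -/
def unord (p : C₂ X) : UC₂ X := Quotient.mk (swapSetoid X) p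

/-- The exchange of the two points of an ordered configuration. -/
def swapC₂ (p : C₂ X) : C₂ X := ⟨p.1.swap, p.2.symm⟩

omit [TopologicalSpace X] in
theorem unord_eq_iff {p p' : C₂ X} : unord p = unord p' ↔ p' = p ∨ p' = swapC₂ p := by
  refine Quotient.eq.trans ?_
  change (p'.1 = p.1 ∨ p'.1 = p.1.swap) ↔ _
  rw [Subtype.ext_iff, Subtype.ext_iff]
  rfl

theorem continuous_swapC₂ : Continuous (swapC₂ (X := X)) :=
  (continuous_swap.comp continuous_subtype_val).subtype_mk _

theorem isOpenQuotientMap_unord : IsOpenQuotientMap (unord (X := X)) := by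
  refine ⟨Quotient.mk_surjective, continuous_quotient_mk', fun O hO => ?_⟩
  have h : unord ⁻¹' (unord '' O) = O ∪ swapC₂ ⁻¹' O := by
    ext p
    simp only [mem_preimage, mem_image, unord_eq_iff, mem_union]
    constructor
    · rintro ⟨p', hp', rfl | rfl⟩
      · exact Or.inl hp'
      · exact Or.inr hp'
    · rintro (h | h)
      · exact ⟨p, h, Or.inl rfl⟩
      · exact ⟨_, h, Or.inr rfl⟩
  have hq : IsQuotientMap (unord (X := X)) := isQuotientMap_quotient_mk'
  rw [← hq.isOpen_preimage, h]
  exact hO.union (hO.preimage continuous_swapC₂)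

/-- An open set of ordered configurations on which the order of the points is determined can be
regarded as a set of unordered configurations. -/
theorem isSimplyConnected_unord_image {O : Set (C₂ X)} (hO : IsOpen O)
    (hinj : ∀ p ∈ O, swapC₂ p ∉ O) (h : IsSimplyConnected O) : IsSimplyConnected (unord '' O) := by
  have hemb : IsOpenEmbedding fun p : O => unord p.1 := by
    refine IsOpenEmbedding.of_continuous_injective_isOpenMap
      (isOpenQuotientMap_unord.continuous.comp continuous_subtype_val) ?_
      (isOpenQuotientMap_unord.isOpenMap.comp hO.isOpenMap_subtype_val)
    rintro ⟨p, hp⟩ ⟨p', hp'⟩ e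
    rcases unord_eq_iff.mp e with rfl | rfl
    · rfl
    · exact (hinj p hp hp').elim
  have h2 : unord '' O = (fun p : O => unord p.1) '' univ := by
    rw [image_univ]
    ext z
    simp
  rw [h2, hemb.isEmbedding.isSimplyConnected_image]
  have := h.simplyConnectedSpace
  exact (Homeomorph.Set.univ O).toHomotopyEquiv.simplyConnectedSpace

/-- A retract of a contractible space is simply connected. -/
theorem isSimplyConnected_of_retract {Z S : Type*} [TopologicalSpace Z] [TopologicalSpace S]
    [ContractibleSpace S] {O : Set Z} (L : O → S) (hL : Continuous L) (Ψ : S → Z)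
    (hΨ : Continuous Ψ) (hO : ∀ s, Ψ s ∈ O) (h : ∀ z, Ψ (L z) = z) : IsSimplyConnected O := by
  let Ψ' : C(S, O) := ⟨fun s => ⟨Ψ s, hO s⟩, hΨ.subtype_mk _⟩
  have hnull := ((id_nullhomotopic S).comp_right Ψ').comp_left (⟨L, hL⟩ : C(O, S))
  have hid : (Ψ'.comp (ContinuousMap.id S)).comp (⟨L, hL⟩ : C(O, S)) = ContinuousMap.id O := by
    ext z
    exact h z
  rw [hid] at hnull
  have hne : Nonempty O := ⟨Ψ' (Classical.arbitrary S)⟩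
  have := (contractible_iff_id_nullhomotopic O).mpr hnull
  exact SimplyConnectedSpace.ofContractible O

/-- A fibrewise constant deformation of the preimage of `U` under an open quotient map gives a
deformation retraction of `U`. -/
theorem exists_homotopyEquiv_of_deformation {Y Z : Type*} [TopologicalSpace Y] [TopologicalSpace Z]
    {q : Y → Z} (hq : IsOpenQuotientMap q) {U A : Set Z} (hAU : A ⊆ U)
    (F : C(↥(q ⁻¹' U) × unitInterval, U))
    (hF : ∀ p p' t, q p.1 = q p'.1 → F (p, t) = F (p', t)) (h0 : ∀ p, (F (p, 0) : Z) = q p)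
    (h1 : ∀ p, (F (p, 1) : Z) ∈ A) (hA : ∀ p t, q p.1 ∈ A → (F (p, t) : Z) = q p) :
    (∃ e : ContinuousMap.HomotopyEquiv A U, ∀ a, e a = inclusion hAU a) ∧
      (IsPathConnected A → IsPathConnected U) := by
  let r : ↥(q ⁻¹' U) × unitInterval → U × unitInterval := Prod.map (U.restrictPreimage q) id
  have hr : IsQuotientMap r :=
    ((hq.restrictPreimage U).prodMap IsOpenQuotientMap.id).isQuotientMap
  let r' : C(↥(q ⁻¹' U) × unitInterval, U × unitInterval) := ⟨r, hr.continuous⟩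
  have hfac : Function.FactorsThrough F r' := by
    rintro ⟨p, t⟩ ⟨p', t'⟩ e
    obtain ⟨e1, rfl⟩ := Prod.mk.inj e
    exact hF p p' t (congrArg Subtype.val e1)
  let H : C(U × unitInterval, U) := IsQuotientMap.lift (f := r') hr F hfac
  have hH : ∀ p t, H (U.restrictPreimage q p, t) = F (p, t) := fun p t =>
    DFunLike.congr_fun (IsQuotientMap.lift_comp (f := r') hr F hfac) (p, t)
  have hsurj := (hq.restrictPreimage U).surjective
  have H0 : ∀ z : U, H (z, 0) = z := by
    intro z
    obtain ⟨p, rfl⟩ := hsurj z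
    rw [hH]
    exact Subtype.ext (h0 p)
  have H1 : ∀ z : U, (H (z, 1) : Z) ∈ A := by
    intro z
    obtain ⟨p, rfl⟩ := hsurj z
    rw [hH]
    exact h1 p
  have HA : ∀ (z : U) t, (z : Z) ∈ A → H (z, t) = z := by
    intro z t hz
    obtain ⟨p, rfl⟩ := hsurj z
    rw [hH]
    exact Subtype.ext (hA p t hz)
  constructor
  · refine ⟨⟨⟨inclusion hAU, continuous_inclusion hAU⟩, ⟨fun z => ⟨H (z, 1), H1 z⟩, by fun_prop⟩,
      ?_, ?_⟩, fun _ => rfl⟩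
    · have : (ContinuousMap.comp (⟨fun z => ⟨H (z, 1), H1 z⟩, by fun_prop⟩ : C(U, A))
          (⟨inclusion hAU, continuous_inclusion hAU⟩ : C(A, U))) = ContinuousMap.id A := by
        ext a
        change (H (inclusion hAU a, 1) : Z) = a
        rw [HA (inclusion hAU a) 1 a.2]
      rw [this]
    · refine ContinuousMap.Homotopic.symm ⟨⟨⟨fun z => H (z.2, z.1), by fun_prop⟩, ?_, ?_⟩⟩
      · intro z
        exact H0 z
      · intro z
        rfl
  · rintro ⟨a, ha, hpa⟩
    refine ⟨a, hAU ha, fun {z} hz => ?_⟩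
    have h2 : JoinedIn U z (H (⟨z, hz⟩, 1)) := by
      let p : Path z (H (⟨z, hz⟩, 1) : Z) :=
        { toFun := fun t => H (⟨z, hz⟩, t)
          continuous_toFun := by fun_prop
          source' := by rw [H0]
          target' := rfl }
      exact ⟨p, fun t => (H (⟨z, hz⟩, t)).2⟩
    exact ((hpa (H1 ⟨z, hz⟩)).mono hAU).trans h2.symm

end Configurations

/-! ### The realization of a graph -/

section Realization

variable {α : Type u} [Fintype α] {G : SimpleGraph α}

theorem continuous_coords : Continuous fun x : Realization G => x.1 := continuous_subtype_val

@[fun_prop]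
theorem continuous_coord (a : α) : Continuous fun x : Realization G => x.1 a :=
  (continuous_apply a).comp continuous_coords

theorem continuous_realization_mk {Y : Type*} [TopologicalSpace Y] {f : Y → Realization G}
    (h : ∀ a, Continuous fun y => (f y).1 a) : Continuous f :=
  continuous_induced_rng.mpr (continuous_pi h)

namespace Realization

theorem nonneg (x : Realization G) (a : α) : 0 ≤ x.1 a := x.2.1.1 a

theorem sum_eq_one (x : Realization G) : ∑ a, x.1 a = 1 := x.2.1.2

theorem ext_coords {x y : Realization G} (h : ∀ a, x.1 a = y.1 a) : x = y :=
  Subtype.ext (funext h)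

end Realization

omit [Fintype α] in
/-- A nonempty subset of a cell is a cell. -/
theorem IsCell.subset {σ τ : Set α} (hσ : IsCell G σ) (hτ : τ ⊆ σ) (hne : τ.Nonempty) :
    IsCell G τ := by
  obtain ⟨a, ha⟩ := hne
  rcases hσ.eq_of_mem (hτ ha) with rfl | ⟨b, hab, rfl⟩
  · rw [Subset.antisymm hτ (singleton_subset_iff.mpr ha)]
    exact isCell_singleton a
  · by_cases hb : b ∈ τ
    · rw [Subset.antisymm hτ (insert_subset ha (singleton_subset_iff.mpr hb))]
      exact isCell_pair hab
    · have : τ = {a} := by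
        refine Subset.antisymm (fun x hx => ?_) (singleton_subset_iff.mpr ha)
        rcases hτ hx with rfl | rfl
        · rfl
        · exact (hb hx).elim
      rw [this]
      exact isCell_singleton a

/-- Points of a cell in barycentric coordinates. -/
theorem mem_realization {σ : Set α} (hσ : IsCell G σ) {x : α → ℝ} (h0 : ∀ a, 0 ≤ x a)
    (h1 : ∑ a, x a = 1) (hs : ∀ a, a ∉ σ → x a = 0) :
    x ∈ stdSimplex ℝ α ∧ IsCell G (Function.support x) := by
  refine ⟨⟨h0, h1⟩, hσ.subset (fun a ha => by_contra fun h => ha (hs a h)) ?_⟩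
  by_contra hne
  rw [not_nonempty_iff_eq_empty, Function.support_eq_empty_iff] at hne
  simp [hne] at h1

open Classical in
/-- A vertex of a graph, as a point of the realization. -/
noncomputable def vertexPoint (G : SimpleGraph α) (a : α) : Realization G :=
  ⟨Pi.single a 1, mem_realization (isCell_singleton a)
    (fun b => by rw [Pi.single_apply]; split_ifs <;> norm_num)
    (by simp) (fun b hb => Pi.single_eq_of_ne hb _)⟩

theorem support_vertexPoint (a : α) : Function.support (vertexPoint G a).1 = {a} := by
  classical
  ext b
  simp [vertexPoint]

/-- The point which divides the straight line from `x` to `y` in the ratio `t : 1 - t`, where `x`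
and `y` lie in a common cell. -/
noncomputable def segmentPoint {σ : Set α} (hσ : IsCell G σ) {x y : Realization G}
    (hx : Function.support x.1 ⊆ σ) (hy : Function.support y.1 ⊆ σ) (t : unitInterval) :
    Realization G :=
  ⟨fun a => (1 - (t : ℝ)) * x.1 a + t * y.1 a, mem_realization hσ
    (fun a => add_nonneg (mul_nonneg (by linarith [t.2.2]) (x.nonneg a))
      (mul_nonneg t.2.1 (y.nonneg a)))
    (by rw [Finset.sum_add_distrib, ← Finset.mul_sum, ← Finset.mul_sum, x.sum_eq_one,
          y.sum_eq_one]; ring)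
    (fun a ha => by
      rw [Function.notMem_support.mp fun h => ha (hx h),
        Function.notMem_support.mp fun h => ha (hy h)]
      ring)⟩

theorem support_segmentPoint {σ : Set α} (hσ : IsCell G σ) {x y : Realization G}
    (hx : Function.support x.1 ⊆ σ) (hy : Function.support y.1 ⊆ σ) (t : unitInterval) :
    Function.support (segmentPoint hσ hx hy t).1 ⊆ σ := by
  intro a ha
  by_contra h
  apply ha
  change (1 - (t : ℝ)) * x.1 a + t * y.1 a = 0
  rw [Function.notMem_support.mp fun h' => h (hx h'),
    Function.notMem_support.mp fun h' => h (hy h')]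
  ring

end Realization
/-! ### Configurations with different projections to the stem -/

section Excess

variable {V : Type u} [Fintype V]

/-- The normalized positive part of `P - Q`. -/
noncomputable def excess (P Q : V → ℝ) (v : V) : ℝ :=
  max (P v - Q v) 0 / ∑ w, max (P w - Q w) 0

variable {P Q : V → ℝ}

/-- The positive parts of `P - Q` and of `Q - P` have the same sum, so that `excess P Q` and
`excess Q P` are normalized by the same factor. -/
theorem sum_excess_comm (hP : ∑ v, P v = 1) (hQ : ∑ v, Q v = 1) :
    ∑ w, max (P w - Q w) 0 = ∑ w, max (Q w - P w) 0 := by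
  have h : ∑ w, (max (P w - Q w) 0 - max (Q w - P w) 0) = ∑ w, (P w - Q w) := by
    refine Finset.sum_congr rfl fun w _ => ?_
    rcases le_total (P w) (Q w) with h | h
    · rw [max_eq_right (by linarith), max_eq_left (by linarith)]; ring
    · rw [max_eq_left (by linarith), max_eq_right (by linarith)]; ring
  rw [Finset.sum_sub_distrib, Finset.sum_sub_distrib, hP, hQ] at h
  linarith

theorem sum_excess_pos (hP : ∑ v, P v = 1) (hQ : ∑ v, Q v = 1) (hne : P ≠ Q) :
    0 < ∑ w, max (P w - Q w) 0 := by
  by_contra h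
  have h0 := Finset.sum_nonneg fun w (_ : w ∈ Finset.univ) => le_max_right (P w - Q w) 0
  have h1 : ∑ w, max (P w - Q w) 0 = 0 := le_antisymm (not_lt.mp h) h0
  have h2 : ∑ w, max (Q w - P w) 0 = 0 := by rw [← sum_excess_comm hP hQ, h1]
  rw [Finset.sum_eq_zero_iff_of_nonneg fun w _ => le_max_right _ _] at h1 h2
  refine hne (funext fun w => le_antisymm ?_ ?_)
  · linarith [le_max_left (P w - Q w) 0, h1 w (Finset.mem_univ w)]
  · linarith [le_max_left (Q w - P w) 0, h2 w (Finset.mem_univ w)]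

theorem excess_mem_stdSimplex (hP : ∑ v, P v = 1) (hQ : ∑ v, Q v = 1) (hne : P ≠ Q) :
    excess P Q ∈ stdSimplex ℝ V := by
  refine ⟨fun v => div_nonneg (le_max_right _ _) (sum_excess_pos hP hQ hne).le, ?_⟩
  unfold excess
  rw [← Finset.sum_div, div_self (sum_excess_pos hP hQ hne).ne']

theorem excess_eq_zero {v : V} (h : P v ≤ Q v) : excess P Q v = 0 := by
  unfold excess
  rw [max_eq_right (by linarith), zero_div]

theorem excess_of_disjoint (hP : P ∈ stdSimplex ℝ V) (hQ : ∀ v, 0 ≤ Q v)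
    (h : ∀ v, P v = 0 ∨ Q v = 0) : excess P Q = P := by
  have h1 : ∀ v, max (P v - Q v) 0 = P v := by
    intro v
    rcases h v with h | h
    · rw [h, max_eq_right (by linarith [hQ v])]
    · rw [h, sub_zero, max_eq_left (hP.1 v)]
  funext v
  unfold excess
  simp_rw [h1]
  rw [hP.2, div_one]

/-- Two points that are pushed apart by passing to their excesses do not collide on the way: their
difference remains a positive multiple of `P - Q`. -/
theorem lerp_excess_ne (hP : ∑ v, P v = 1) (hQ : ∑ v, Q v = 1) (hne : P ≠ Q) {t : ℝ} (h0 : 0 ≤ t)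
    (h1 : t ≤ 1) :
    (fun v => (1 - t) * P v + t * excess P Q v) ≠ fun v => (1 - t) * Q v + t * excess Q P v := by
  intro h
  obtain ⟨v, hv⟩ := Function.ne_iff.mp hne
  have hN := sum_excess_pos hP hQ hne
  have e := congrFun h v
  simp only [excess] at e
  rw [← sum_excess_comm hP hQ] at e
  set N := ∑ w, max (P w - Q w) 0
  have h2 : max (P v - Q v) 0 - max (Q v - P v) 0 = P v - Q v := by
    rcases le_total (P v) (Q v) with h | h
    · rw [max_eq_right (by linarith), max_eq_left (by linarith)]; ring
    · rw [max_eq_left (by linarith), max_eq_right (by linarith)]; ring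
  have h3 : (1 - t + t / N) * (P v - Q v) = 0 := by
    have : (1 - t + t / N) * (P v - Q v) = (1 - t) * P v + t * (max (P v - Q v) 0 / N) -
        ((1 - t) * Q v + t * (max (Q v - P v) 0 / N)) := by
      linear_combination (-(t / N)) * h2
    rw [this, e, sub_self]
  have h4 : 0 < 1 - t + t / N := by
    rcases h0.eq_or_lt with rfl | h0
    · norm_num
    · have := div_pos h0 hN
      linarith
  rcases mul_eq_zero.mp h3 with h | h
  · exact h4.ne' h
  · exact hv (by linarith)

end Excess

section Projection

variable {V : Type u} [Fintype V] {T : SimpleGraph V} {ℓ : V → ℕ}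

open Classical in
/-- The barycentric coordinates of the image of a point of a bunch of grapes under the map to the
stem that collapses the grapes. -/
noncomputable def stemCoord (x : Realization (bunch T ℓ)) (v : V) : ℝ :=
  ∑ a, if stem a = v then x.1 a else 0

theorem continuous_stemCoord (v : V) :
    Continuous fun x : Realization (bunch T ℓ) => stemCoord x v := by
  unfold stemCoord
  refine continuous_finsetSum _ fun a _ => ?_
  split_ifs
  · exact continuous_coord a
  · exact continuous_const

theorem stemCoord_nonneg (x : Realization (bunch T ℓ)) (v : V) : 0 ≤ stemCoord x v :=
  Finset.sum_nonneg fun a _ => by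
    split_ifs
    · exact x.nonneg a
    · exact le_rfl

theorem sum_stemCoord (x : Realization (bunch T ℓ)) : ∑ v, stemCoord x v = 1 := by
  classical
  unfold stemCoord
  rw [Finset.sum_comm, ← x.sum_eq_one]
  refine Finset.sum_congr rfl fun a _ => ?_
  rw [Finset.sum_ite_eq]
  simp

theorem stemCoord_mem (x : Realization (bunch T ℓ)) : stemCoord x ∈ stdSimplex ℝ V :=
  ⟨stemCoord_nonneg x, sum_stemCoord x⟩

theorem le_stemCoord (x : Realization (bunch T ℓ)) (a : GrapeVertex ℓ) :
    x.1 a ≤ stemCoord x (stem a) := by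
  classical
  unfold stemCoord
  refine le_trans (by simp) (Finset.single_le_sum (f := fun b => if stem b = stem a then x.1 b
    else 0) (fun b _ => ?_) (Finset.mem_univ a))
  change 0 ≤ if stem b = stem a then x.1 b else 0
  split_ifs
  · exact x.nonneg b
  · exact le_rfl

theorem stemCoord_eq_zero_iff {x : Realization (bunch T ℓ)} {v : V} :
    stemCoord x v = 0 ↔ ∀ a, stem a = v → x.1 a = 0 := by
  constructor
  · rintro h a rfl
    exact le_antisymm (h ▸ le_stemCoord x a) (x.nonneg a)
  · intro h
    exact Finset.sum_eq_zero fun a _ => by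
      split_ifs with ha
      · exact h a ha
      · rfl

/-- All the coordinates of a point of a grape lie over the same vertex of the stem. -/
theorem stem_eq_of_grape {x : Realization (bunch T ℓ)} {g : Σ v : V, Fin (ℓ v)} {i : Bool}
    (h : x.1 (.inr (g, i)) ≠ 0) {a : GrapeVertex ℓ} (ha : x.1 a ≠ 0) : stem a = g.1 := by
  rcases x.2.2.eq_of_mem (a := .inr (g, i)) h with e | ⟨b, hb, e⟩
  · have : a ∈ Function.support x.1 := ha
    rw [e] at this
    rw [this, stem_inr]
  · have hm : a ∈ Function.support x.1 := ha
    rw [e] at hm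
    rcases hm with rfl | rfl
    · rfl
    · by_contra hne
      have := (adj_of_stem_ne hb (Ne.symm hne)).1
      exact Sum.inr_ne_inl this

theorem stemCoord_of_grape {x : Realization (bunch T ℓ)} {g : Σ v : V, Fin (ℓ v)} {i : Bool}
    (h : x.1 (.inr (g, i)) ≠ 0) {v : V} (hv : v ≠ g.1) : stemCoord x v = 0 := by
  rw [stemCoord_eq_zero_iff]
  rintro a rfl
  by_contra ha
  exact hv (stem_eq_of_grape h ha)

open Classical in
theorem stemCoord_eq_add (x : Realization (bunch T ℓ)) (v : V) : stemCoord x v =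
    x.1 (.inl v) + ∑ b, if stem (ℓ := ℓ) (.inr b) = v then x.1 (.inr b) else 0 := by
  unfold stemCoord
  rw [Fintype.sum_sum_type]
  congr 1
  exact (Finset.sum_ite_eq' Finset.univ v fun a => x.1 (.inl a)).trans
    (if_pos (Finset.mem_univ v))

theorem stemCoord_of_stem {x : Realization (bunch T ℓ)} (h : ∀ b, x.1 (.inr b) = 0) (v : V) :
    stemCoord x v = x.1 (.inl v) := by
  rw [stemCoord_eq_add, Finset.sum_eq_zero, add_zero]
  intro b _
  split_ifs
  · exact h b
  · rfl

/-- A point of the simplex which is concentrated at one vertex. -/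
theorem eq_of_concentrated {P E : V → ℝ} (hP : P ∈ stdSimplex ℝ V) (hE : E ∈ stdSimplex ℝ V)
    {w : V} (hPw : ∀ v, v ≠ w → P v = 0) (hEP : ∀ v, P v = 0 → E v = 0) : E = P := by
  have h1 : ∀ F ∈ stdSimplex ℝ V, (∀ v, v ≠ w → F v = 0) → F w = 1 := fun F hF h => by
    rw [← hF.2, Finset.sum_eq_single w (fun v _ hv => h v hv) (by simp)]
  funext v
  by_cases hv : v = w
  · rw [hv, h1 P hP hPw, h1 E hE fun v hv => hEP v (hPw v hv)]
  · rw [hPw v hv, hEP v (hPw v hv)]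

/-- The coordinates of the point obtained from `x` by moving its projection to the stem towards
`E`. -/
noncomputable def pushCoord (x : Realization (bunch T ℓ)) (E : V → ℝ) (t : ℝ) :
    GrapeVertex ℓ → ℝ
  | .inl v => x.1 (.inl v) + t * (E v - stemCoord x v)
  | .inr b => x.1 (.inr b)

/-- The coordinates stay in the cell of `x`. If `x` is on a grape, its projection is a vertex and
does not move. -/
theorem pushCoord_mem (x : Realization (bunch T ℓ)) {E : V → ℝ} (hE : E ∈ stdSimplex ℝ V)
    (hEx : ∀ v, stemCoord x v = 0 → E v = 0) {t : ℝ} (h0 : 0 ≤ t) (h1 : t ≤ 1) :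
    (∀ a, 0 ≤ pushCoord x E t a) ∧ (∀ a, x.1 a = 0 → pushCoord x E t a = 0) := by
  by_cases h : ∀ b, x.1 (.inr b) = 0
  · have key : ∀ v, pushCoord x E t (.inl v) = (1 - t) * x.1 (.inl v) + t * E v := by
      intro v
      simp only [pushCoord, stemCoord_of_stem h]
      ring
    refine ⟨?_, ?_⟩
    · rintro (v | b)
      · rw [key]
        exact add_nonneg (mul_nonneg (by linarith) (x.nonneg _)) (mul_nonneg h0 (hE.1 v))
      · exact x.nonneg _
    · rintro (v | b) ha
      · rw [key, ha, hEx v (by rw [stemCoord_of_stem h, ha])]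
        ring
      · exact ha
  · push Not at h
    obtain ⟨⟨g, i⟩, hb⟩ := h
    have e : E = stemCoord x := eq_of_concentrated (stemCoord_mem x) hE
      (fun v hv => stemCoord_of_grape hb hv) hEx
    have key : pushCoord x E t = x.1 := by
      funext a
      rcases a with v | b
      · simp [pushCoord, e]
      · rfl
    rw [key]
    exact ⟨x.nonneg, fun a ha => ha⟩

/-- The point obtained from `x` by moving its projection to the stem towards `E`. -/
noncomputable def push (x : Realization (bunch T ℓ)) {E : V → ℝ} (hE : E ∈ stdSimplex ℝ V)
    (hEx : ∀ v, stemCoord x v = 0 → E v = 0) (t : unitInterval) : Realization (bunch T ℓ) :=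
  ⟨pushCoord x E t, mem_realization x.2.2 (pushCoord_mem x hE hEx t.2.1 t.2.2).1
    (by
      have h1 : ∑ v, (E v - stemCoord x v) = 0 := by
        rw [Finset.sum_sub_distrib, hE.2, sum_stemCoord, sub_self]
      rw [← x.sum_eq_one, Fintype.sum_sum_type, Fintype.sum_sum_type]
      simp only [pushCoord]
      rw [Finset.sum_add_distrib, ← Finset.mul_sum, h1, mul_zero, add_zero])
    (fun a ha => (pushCoord_mem x hE hEx t.2.1 t.2.2).2 a (Function.notMem_support.mp ha))⟩

theorem stemCoord_push (x : Realization (bunch T ℓ)) {E : V → ℝ} (hE : E ∈ stdSimplex ℝ V)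
    (hEx : ∀ v, stemCoord x v = 0 → E v = 0) (t : unitInterval) (v : V) :
    stemCoord (push x hE hEx t) v = (1 - (t : ℝ)) * stemCoord x v + t * E v := by
  classical
  have h1 := stemCoord_eq_add (push x hE hEx t) v
  have h2 := stemCoord_eq_add x v
  change _ = x.1 (.inl v) + t * (E v - stemCoord x v) + _ at h1
  change _ = _ + ∑ b, if stem (ℓ := ℓ) (.inr b) = v then x.1 (.inr b) else 0 at h1
  linear_combination h1 - h2

theorem push_eq_self (x : Realization (bunch T ℓ)) {E : V → ℝ} (hE : E ∈ stdSimplex ℝ V)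
    (hEx : ∀ v, stemCoord x v = 0 → E v = 0) {t : unitInterval}
    (h : (t : ℝ) = 0 ∨ E = stemCoord x) : push x hE hEx t = x := by
  refine Realization.ext_coords fun a => ?_
  rcases a with v | b
  · change x.1 (.inl v) + t * (E v - stemCoord x v) = _
    rcases h with h | h
    · rw [h]; ring
    · rw [h]; ring
  · rfl

/-- The unordered configurations whose points have different projections to the stem. -/
def stemDistinct (T : SimpleGraph V) (ℓ : V → ℕ) : Set (UC₂ (Realization (bunch T ℓ))) :=
  unord '' {p | stemCoord p.1.1 ≠ stemCoord p.1.2}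

theorem unord_mem_stemDistinct {p : C₂ (Realization (bunch T ℓ))} :
    unord p ∈ stemDistinct T ℓ ↔ stemCoord p.1.1 ≠ stemCoord p.1.2 := by
  constructor
  · rintro ⟨p', hp', e⟩
    rcases unord_eq_iff.mp e with rfl | rfl
    · exact hp'
    · exact hp'.symm
  · exact fun h => ⟨p, h, rfl⟩

theorem isOpen_stemDistinct : IsOpen (stemDistinct T ℓ) := by
  refine isOpenQuotientMap_unord.isOpenMap _ ?_
  have h : Continuous fun x : Realization (bunch T ℓ) => stemCoord x :=
    continuous_pi continuous_stemCoord
  exact isOpen_ne_fun (h.comp (continuous_fst.comp continuous_subtype_val))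
    (h.comp (continuous_snd.comp continuous_subtype_val))

theorem unord_mem_polyhedron {p : C₂ (Realization (bunch T ℓ))} :
    unord p ∈ polyhedron (bunch T ℓ) (separated T ℓ) ↔
      ∀ v, stemCoord p.1.1 v = 0 ∨ stemCoord p.1.2 v = 0 := by
  have key : ∀ p : C₂ (Realization (bunch T ℓ)),
      pairCell (Function.support p.1.1.1) (Function.support p.1.2.1) ∈ separated T ℓ ↔
        ∀ v, stemCoord p.1.1 v = 0 ∨ stemCoord p.1.2 v = 0 := by
    intro p
    rw [pairCell_mem_separated p.1.1.2.2 p.1.2.2.2]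
    constructor
    · intro h v
      by_contra hv
      rw [not_or, stemCoord_eq_zero_iff, stemCoord_eq_zero_iff] at hv
      push Not at hv
      obtain ⟨⟨a, ha, hxa⟩, b, hb, hyb⟩ := hv
      exact h a hxa b hyb (ha.trans hb.symm)
    · intro h a ha b hb e
      rcases h (stem a) with h | h
      · exact ha (stemCoord_eq_zero_iff.mp h a rfl)
      · exact hb (stemCoord_eq_zero_iff.mp h b e.symm)
  constructor
  · rintro ⟨p', e, h⟩
    rw [key] at h
    rcases unord_eq_iff.mp (e : unord p = unord p') with rfl | rfl
    · exact h
    · exact fun v => (h v).symm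
  · exact fun h => ⟨p, rfl, (key p).mpr h⟩

theorem polyhedron_subset_stemDistinct :
    polyhedron (bunch T ℓ) (separated T ℓ) ⊆ stemDistinct T ℓ := by
  intro z hz
  obtain ⟨p, rfl⟩ := isOpenQuotientMap_unord.surjective z
  rw [unord_mem_polyhedron] at hz
  rw [unord_mem_stemDistinct]
  intro e
  have h : ∀ v, stemCoord p.1.1 v = 0 := fun v => by
    rcases hz v with h | h
    · exact h
    · rw [e, h]
  have := sum_stemCoord p.1.1
  simp [h] at this

/-- One of the two points in the deformation that pushes a configuration apart. -/
noncomputable def pushApart (x y : Realization (bunch T ℓ)) (h : stemCoord x ≠ stemCoord y)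
    (t : unitInterval) : Realization (bunch T ℓ) :=
  push x (excess_mem_stdSimplex (sum_stemCoord x) (sum_stemCoord y) h)
    (fun v hv => excess_eq_zero (by rw [hv]; exact stemCoord_nonneg y v)) t

theorem stemCoord_pushApart (x y : Realization (bunch T ℓ)) (h : stemCoord x ≠ stemCoord y)
    (t : unitInterval) : stemCoord (pushApart x y h t) = fun v =>
      (1 - (t : ℝ)) * stemCoord x v + t * excess (stemCoord x) (stemCoord y) v :=
  funext fun _ => stemCoord_push _ _ _ _ _

theorem stemCoord_pushApart_ne (x y : Realization (bunch T ℓ)) (h : stemCoord x ≠ stemCoord y)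
    (t : unitInterval) :
    stemCoord (pushApart x y h t) ≠ stemCoord (pushApart y x h.symm t) := by
  rw [stemCoord_pushApart, stemCoord_pushApart]
  exact lerp_excess_ne (sum_stemCoord x) (sum_stemCoord y) h t.2.1 t.2.2

theorem pushApart_eq_self (x y : Realization (bunch T ℓ)) (h : stemCoord x ≠ stemCoord y)
    {t : unitInterval} (ht : (t : ℝ) = 0 ∨ ∀ v, stemCoord x v = 0 ∨ stemCoord y v = 0) :
    pushApart x y h t = x :=
  push_eq_self _ _ _
    (ht.imp_right fun h => excess_of_disjoint (stemCoord_mem x) (stemCoord_nonneg y) h)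

theorem continuous_pushApart {Y : Type*} [TopologicalSpace Y] {f g : Y → Realization (bunch T ℓ)}
    (hf : Continuous f) (hg : Continuous g) (h : ∀ y, stemCoord (f y) ≠ stemCoord (g y))
    {s : Y → unitInterval} (hs : Continuous s) :
    Continuous fun y => pushApart (f y) (g y) (h y) (s y) := by
  refine continuous_realization_mk fun a => ?_
  rcases a with v | b
  · change Continuous fun y => (f y).1 (.inl v) + (s y : ℝ) *
      (max (stemCoord (f y) v - stemCoord (g y) v) 0 /
        (∑ w, max (stemCoord (f y) w - stemCoord (g y) w) 0) - stemCoord (f y) v)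
    have h1 : ∀ w, Continuous fun y => stemCoord (f y) w := fun w =>
      (continuous_stemCoord w).comp hf
    have h2 : ∀ w, Continuous fun y => stemCoord (g y) w := fun w =>
      (continuous_stemCoord w).comp hg
    have h3 : ∀ w, Continuous fun y => max (stemCoord (f y) w - stemCoord (g y) w) 0 := fun w =>
      ((h1 w).sub (h2 w)).max continuous_const
    have h4 : Continuous fun y => ∑ w, max (stemCoord (f y) w - stemCoord (g y) w) 0 :=
      continuous_finsetSum _ fun w _ => h3 w
    refine ((continuous_coord _).comp hf).add ((continuous_subtype_val.comp hs).mul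
      (((h3 v).div h4 fun y => ?_).sub (h1 v)))
    exact (sum_excess_pos (sum_stemCoord _) (sum_stemCoord _) (h y)).ne'
  · change Continuous fun y => (f y).1 (.inr b)
    exact (continuous_coord _).comp hf

/-- Pushing the two points apart is a deformation retraction of the space of configurations with
different projections onto the polyhedron of the separated cells. -/
theorem exists_homotopyEquiv_stemDistinct :
    (∃ e : ContinuousMap.HomotopyEquiv (polyhedron (bunch T ℓ) (separated T ℓ)) (stemDistinct T ℓ),
        ∀ a, e a = inclusion polyhedron_subset_stemDistinct a) ∧
      (IsPathConnected (polyhedron (bunch T ℓ) (separated T ℓ)) →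
        IsPathConnected (stemDistinct T ℓ)) := by
  have hp : ∀ p : ↥(unord ⁻¹' stemDistinct T ℓ), stemCoord p.1.1.1 ≠ stemCoord p.1.1.2 :=
    fun p => unord_mem_stemDistinct.mp p.2
  let Φ : ↥(unord ⁻¹' stemDistinct T ℓ) × unitInterval → C₂ (Realization (bunch T ℓ)) := fun z =>
    ⟨(pushApart z.1.1.1.1 z.1.1.1.2 (hp z.1) z.2, pushApart z.1.1.1.2 z.1.1.1.1 (hp z.1).symm z.2),
      fun e => stemCoord_pushApart_ne _ _ (hp z.1) z.2 (congrArg stemCoord e)⟩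
  have hΦ : Continuous Φ := by
    have h1 : Continuous fun z : ↥(unord ⁻¹' stemDistinct T ℓ) × unitInterval => z.1.1.1 :=
      continuous_subtype_val.comp (continuous_subtype_val.comp continuous_fst)
    exact ((continuous_pushApart (continuous_fst.comp h1) (continuous_snd.comp h1)
      (fun z => hp z.1) continuous_snd).prodMk (continuous_pushApart (continuous_snd.comp h1)
      (continuous_fst.comp h1) (fun z => (hp z.1).symm) continuous_snd)).subtype_mk _
  refine exists_homotopyEquiv_of_deformation isOpenQuotientMap_unord polyhedron_subset_stemDistinct
    ⟨fun z => ⟨unord (Φ z), unord_mem_stemDistinct.mpr (stemCoord_pushApart_ne _ _ (hp z.1) z.2)⟩,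
      (isOpenQuotientMap_unord.continuous.comp hΦ).subtype_mk _⟩ ?_ ?_ ?_ ?_
  · rintro ⟨p, hp1⟩ ⟨p', hp1'⟩ t e
    refine Subtype.ext (unord_eq_iff.mpr ?_)
    rcases unord_eq_iff.mp e with h | h
    · left
      change p' = p at h
      subst h
      rfl
    · right
      change p' = swapC₂ p at h
      subst h
      rfl
  · intro p
    change unord (Φ (p, 0)) = unord p.1
    congr 1
    exact Subtype.ext (Prod.ext (pushApart_eq_self _ _ (hp p) (Or.inl rfl))
      (pushApart_eq_self _ _ (hp p).symm (Or.inl rfl)))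
  · intro p
    change unord (Φ (p, 1)) ∈ _
    rw [unord_mem_polyhedron]
    intro v
    change stemCoord (pushApart _ _ (hp p) 1) v = 0 ∨ stemCoord (pushApart _ _ (hp p).symm 1) v = 0
    rw [stemCoord_pushApart, stemCoord_pushApart]
    rcases le_total (stemCoord p.1.1.1 v) (stemCoord p.1.1.2 v) with h | h
    · left
      simp [excess_eq_zero h]
    · right
      simp [excess_eq_zero h]
  · intro p t h
    rw [unord_mem_polyhedron] at h
    change unord (Φ (p, t)) = unord p.1
    congr 1
    exact Subtype.ext (Prod.ext
      (pushApart_eq_self _ _ (hp p) (Or.inr h))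
      (pushApart_eq_self _ _ (hp p).symm (Or.inr fun v => (h v).symm)))

end Projection
/-! ### The polyhedron of the separated cells is path-connected -/

section Connectedness

variable {V : Type u} [Fintype V] {T : SimpleGraph V} {ℓ : V → ℕ}

/-- A configuration of two points that lie over disjoint parts of the stem. -/
def separatedConfig (x y : Realization (bunch T ℓ))
    (h : ∀ a, x.1 a ≠ 0 → ∀ b, y.1 b ≠ 0 → stem a ≠ stem b) : C₂ (Realization (bunch T ℓ)) :=
  ⟨(x, y), by
    rintro (rfl : x = y)
    obtain ⟨a, ha⟩ := x.2.2.nonempty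
    exact h a ha a ha rfl⟩

theorem unord_separatedConfig_mem (x y : Realization (bunch T ℓ))
    (h : ∀ a, x.1 a ≠ 0 → ∀ b, y.1 b ≠ 0 → stem a ≠ stem b) :
    unord (separatedConfig x y h) ∈ polyhedron (bunch T ℓ) (separated T ℓ) :=
  ⟨_, rfl, (pairCell_mem_separated x.2.2 y.2.2).mpr h⟩

/-- Configurations in the same separated cell are joined by a straight line. -/
theorem joinedIn_polyhedron {σ τ : Set (GrapeVertex ℓ)} (hσ : IsCell (bunch T ℓ) σ)
    (hτ : IsCell (bunch T ℓ) τ) (hστ : ∀ a ∈ σ, ∀ b ∈ τ, stem a ≠ stem b)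
    {p p' : C₂ (Realization (bunch T ℓ))} (h1 : Function.support p.1.1.1 ⊆ σ)
    (h2 : Function.support p.1.2.1 ⊆ τ) (h1' : Function.support p'.1.1.1 ⊆ σ)
    (h2' : Function.support p'.1.2.1 ⊆ τ) :
    JoinedIn (polyhedron (bunch T ℓ) (separated T ℓ)) (unord p) (unord p') := by
  have hsep : ∀ t, ∀ a, (segmentPoint hσ h1 h1' t).1 a ≠ 0 →
      ∀ b, (segmentPoint hτ h2 h2' t).1 b ≠ 0 → stem a ≠ stem b := fun t a ha b hb =>
    hστ a (support_segmentPoint hσ h1 h1' t ha) b (support_segmentPoint hτ h2 h2' t hb)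
  have hc : ∀ {σ : Set (GrapeVertex ℓ)} (hσ : IsCell (bunch T ℓ) σ)
      {x y : Realization (bunch T ℓ)} (hx : Function.support x.1 ⊆ σ)
      (hy : Function.support y.1 ⊆ σ), Continuous (segmentPoint hσ hx hy) := by
    intro σ hσ x y hx hy
    refine continuous_realization_mk fun a => ?_
    change Continuous fun t : unitInterval => (1 - (t : ℝ)) * x.1 a + t * y.1 a
    fun_prop
  let γ : Path (unord p) (unord p') :=
    { toFun := fun t => unord (separatedConfig _ _ (hsep t))
      continuous_toFun := isOpenQuotientMap_unord.continuous.comp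
        (((hc hσ h1 h1').prodMk (hc hτ h2 h2')).subtype_mk _)
      source' := congrArg unord (Subtype.ext (Prod.ext
        (Realization.ext_coords fun a => by
          change (1 - (0 : ℝ)) * p.1.1.1 a + 0 * p'.1.1.1 a = p.1.1.1 a
          ring)
        (Realization.ext_coords fun a => by
          change (1 - (0 : ℝ)) * p.1.2.1 a + 0 * p'.1.2.1 a = p.1.2.1 a
          ring)))
      target' := congrArg unord (Subtype.ext (Prod.ext
        (Realization.ext_coords fun a => by
          change (1 - (1 : ℝ)) * p.1.1.1 a + 1 * p'.1.1.1 a = p'.1.1.1 a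
          ring)
        (Realization.ext_coords fun a => by
          change (1 - (1 : ℝ)) * p.1.2.1 a + 1 * p'.1.2.1 a = p'.1.2.1 a
          ring))) }
  exact ⟨γ, fun t => unord_separatedConfig_mem _ _ (hsep t)⟩

/-- The configuration of two vertices that lie over different vertices of the stem. -/
noncomputable def vertexConfig (T : SimpleGraph V) (a b : GrapeVertex ℓ) (h : stem a ≠ stem b) :
    C₂ (Realization (bunch T ℓ)) :=
  separatedConfig (vertexPoint _ a) (vertexPoint _ b) (by
    intro c hc d hd
    have hc' : c ∈ Function.support (vertexPoint (bunch T ℓ) a).1 := hc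
    have hd' : d ∈ Function.support (vertexPoint (bunch T ℓ) b).1 := hd
    rw [support_vertexPoint] at hc' hd'
    rw [hc', hd']
    exact h)

theorem joinedIn_vertexConfig {σ τ : Set (GrapeVertex ℓ)} (hσ : IsCell (bunch T ℓ) σ)
    (hτ : IsCell (bunch T ℓ) τ) (hστ : ∀ a ∈ σ, ∀ b ∈ τ, stem a ≠ stem b)
    {a a' b b' : GrapeVertex ℓ} (ha : a ∈ σ) (ha' : a' ∈ σ) (hb : b ∈ τ) (hb' : b' ∈ τ) :
    JoinedIn (polyhedron (bunch T ℓ) (separated T ℓ)) (unord (vertexConfig T a b (hστ a ha b hb)))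
      (unord (vertexConfig T a' b' (hστ a' ha' b' hb'))) :=
  joinedIn_polyhedron hσ hτ hστ
    ((support_vertexPoint a).trans_subset (singleton_subset_iff.mpr ha))
    ((support_vertexPoint b).trans_subset (singleton_subset_iff.mpr hb))
    ((support_vertexPoint a').trans_subset (singleton_subset_iff.mpr ha'))
    ((support_vertexPoint b').trans_subset (singleton_subset_iff.mpr hb'))

omit [Fintype V] in
theorem exists_cell_stem (T : SimpleGraph V) (a : GrapeVertex ℓ) :
    ∃ σ, IsCell (bunch T ℓ) σ ∧ a ∈ σ ∧ .inl (stem a) ∈ σ ∧ ∀ b ∈ σ, stem b = stem a := by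
  rcases a with v | ⟨g, i⟩
  · exact ⟨{.inl v}, isCell_singleton _, rfl, rfl, by rintro b rfl; rfl⟩
  · refine ⟨{.inr (g, i), .inl g.1}, isCell_pair (adj_inr_inl.mpr rfl), by simp, by simp, ?_⟩
    rintro b (rfl | rfl) <;> rfl

/-- The configuration of two different vertices of the stem. -/
noncomputable def stemConfig (T : SimpleGraph V) (ℓ : V → ℕ) (a b : V) (h : a ≠ b) :
    UC₂ (Realization (bunch T ℓ)) :=
  unord (vertexConfig T (.inl a) (.inl b) h)

theorem stemConfig_comm {a b : V} (h : a ≠ b) :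
    stemConfig T ℓ a b h = stemConfig T ℓ b a h.symm :=
  unord_eq_iff.mpr (Or.inr rfl)

theorem joinedIn_stemConfig {a b c : V} (hab : T.Adj a b) (hac : a ≠ c) (hbc : b ≠ c) :
    JoinedIn (polyhedron (bunch T ℓ) (separated T ℓ)) (stemConfig T ℓ a c hac)
      (stemConfig T ℓ b c hbc) :=
  joinedIn_vertexConfig (isCell_pair (adj_inl.mpr hab)) (isCell_singleton (.inl c))
    (by
      rintro x hx y rfl
      rcases hx with rfl | rfl
      · exact hac
      · exact hbc)
    (mem_insert _ _) (mem_insert_of_mem _ rfl) rfl rfl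

/-- One point is moved towards the other one until both are at the ends of an edge. -/
theorem exists_joinedIn_edge {v w : V} (p : T.Walk v w) (h : v ≠ w) :
    ∃ u, ∃ hu : T.Adj u w, JoinedIn (polyhedron (bunch T ℓ) (separated T ℓ))
      (stemConfig T ℓ v w h) (stemConfig T ℓ u w hu.ne) := by
  induction p with
  | nil => exact (h rfl).elim
  | @cons a b c hab p ih =>
    by_cases hbc : b = c
    · subst hbc
      exact ⟨a, hab, JoinedIn.refl (unord_separatedConfig_mem _ _ _)⟩
    · obtain ⟨u, hu, hj⟩ := ih hbc
      exact ⟨u, hu, (joinedIn_stemConfig hab h hbc).trans hj⟩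

theorem joinedIn_edges_at {u v w : V} (hu : T.Adj u w) (hv : T.Adj v w) :
    JoinedIn (polyhedron (bunch T ℓ) (separated T ℓ)) (stemConfig T ℓ u w hu.ne)
      (stemConfig T ℓ v w hv.ne) := by
  by_cases h : u = v
  · subst h
    exact JoinedIn.refl (unord_separatedConfig_mem _ _ _)
  -- one point moves from `w` to `v`, then the other one from `u` to `w`
  have h1 := joinedIn_stemConfig (ℓ := ℓ) hv.symm hu.ne.symm (Ne.symm h)
  have h2 := joinedIn_stemConfig (ℓ := ℓ) hu h hv.ne.symm
  rw [stemConfig_comm hu.ne, stemConfig_comm hv.ne]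
  refine h1.trans ?_
  rw [stemConfig_comm]
  exact h2

theorem joinedIn_edges {w w' : V} (p : T.Walk w w') : ∀ {u u' : V} (hu : T.Adj u w)
    (hu' : T.Adj u' w'), JoinedIn (polyhedron (bunch T ℓ) (separated T ℓ))
      (stemConfig T ℓ u w hu.ne) (stemConfig T ℓ u' w' hu'.ne) := by
  induction p with
  | nil => exact fun hu hu' => joinedIn_edges_at hu hu'
  | cons hab p ih =>
    intro u u' hu hu'
    refine (joinedIn_edges_at hu hab.symm).trans ?_
    rw [stemConfig_comm]
    exact ih hab hu'

theorem isPathConnected_polyhedron_separated (hT : T.Connected) {v w : V} (hvw : v ≠ w) :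
    IsPathConnected (polyhedron (bunch T ℓ) (separated T ℓ)) := by
  have hjoin : ∀ {a b c d : V} (hab : a ≠ b) (hcd : c ≠ d),
      JoinedIn (polyhedron (bunch T ℓ) (separated T ℓ)) (stemConfig T ℓ a b hab)
        (stemConfig T ℓ c d hcd) := by
    intro a b c d hab hcd
    obtain ⟨p⟩ := hT.preconnected a b
    obtain ⟨q⟩ := hT.preconnected c d
    obtain ⟨r⟩ := hT.preconnected b d
    obtain ⟨u, hu, h1⟩ := exists_joinedIn_edge (ℓ := ℓ) p hab
    obtain ⟨u', hu', h2⟩ := exists_joinedIn_edge (ℓ := ℓ) q hcd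
    exact (h1.trans (joinedIn_edges r hu hu')).trans h2.symm
  refine ⟨stemConfig T ℓ v w hvw, unord_separatedConfig_mem _ _ _, ?_⟩
  rintro _ ⟨p, rfl, hp⟩
  obtain ⟨a, ha⟩ := p.1.1.2.2.nonempty
  obtain ⟨b, hb⟩ := p.1.2.2.2.nonempty
  rw [pairCell_mem_separated p.1.1.2.2 p.1.2.2.2] at hp
  obtain ⟨σ, hσ, haσ, haσ', hσs⟩ := exists_cell_stem T a
  obtain ⟨τ, hτ, hbτ, hbτ', hτs⟩ := exists_cell_stem T b
  have h1 : JoinedIn (polyhedron (bunch T ℓ) (separated T ℓ)) (unord p)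
      (unord (vertexConfig T a b (hp a ha b hb))) :=
    joinedIn_polyhedron p.1.1.2.2 p.1.2.2.2 hp subset_rfl subset_rfl
      ((support_vertexPoint a).trans_subset (singleton_subset_iff.mpr ha))
      ((support_vertexPoint b).trans_subset (singleton_subset_iff.mpr hb))
  have h2 := joinedIn_vertexConfig hσ hτ
    (fun a' ha' b' hb' => by rw [hσs a' ha', hτs b' hb']; exact hp a ha b hb) haσ haσ' hbτ hbτ'
  exact (hjoin hvw _).trans (h1.trans h2).symm

end Connectedness
/-! ### Coordinates on a grape -/

section ArcCoordinate

/-- The barycentric coordinate of the point of a triangle with arc coordinate `u` with respect to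
the vertex with arc coordinate `1`; the other vertices have arc coordinates `-1` and `±2`. -/
noncomputable def tent (u : ℝ) : ℝ := max 0 (min ((1 + u) / 2) (2 - u))

theorem tent_of_le_neg_one {u : ℝ} (h : u ≤ -1) : tent u = 0 :=
  max_eq_left ((min_le_left _ _).trans (by linarith))

theorem tent_of_abs_le_one {u : ℝ} (h : |u| ≤ 1) : tent u = (1 + u) / 2 := by
  rw [abs_le] at h
  unfold tent
  rw [min_eq_left (by linarith), max_eq_right (by linarith)]

theorem tent_of_one_le {u : ℝ} (h : 1 ≤ u) : tent u = max 0 (2 - u) := by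
  unfold tent
  rw [min_eq_right (by linarith)]

variable {V : Type u} [Fintype V] {T : SimpleGraph V} {ℓ : V → ℕ}

open Classical in
/-- The barycentric coordinates of the point of the grape `g` with arc coordinate `u`. -/
noncomputable def arcCoords (g : Σ v : V, Fin (ℓ v)) (u : ℝ) : GrapeVertex ℓ → ℝ
  | .inl v => if v = g.1 then min 1 (max 0 (|u| - 1)) else 0
  | .inr (h, i) => if h = g then tent (cond i u (-u)) else 0

omit [Fintype V] in
theorem arcCoords_inl (g : Σ v : V, Fin (ℓ v)) (u : ℝ) :
    arcCoords g u (.inl g.1) = min 1 (max 0 (|u| - 1)) := if_pos rfl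

omit [Fintype V] in
theorem arcCoords_inr (g : Σ v : V, Fin (ℓ v)) (u : ℝ) (i : Bool) :
    arcCoords g u (.inr (g, i)) = tent (cond i u (-u)) := if_pos rfl

/-- The vertices of the grape `g`. -/
def grapeCell (g : Σ v : V, Fin (ℓ v)) : Set (GrapeVertex ℓ) :=
  {.inl g.1, .inr (g, false), .inr (g, true)}

omit [Fintype V] in
theorem arcCoords_of_notMem {g : Σ v : V, Fin (ℓ v)} {u : ℝ} {a : GrapeVertex ℓ}
    (ha : a ∉ grapeCell g) : arcCoords g u a = 0 := by
  rcases a with v | ⟨h, i⟩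
  · exact if_neg (by rintro rfl; exact ha (Or.inl rfl))
  · refine if_neg ?_
    rintro rfl
    cases i
    · exact ha (Or.inr (Or.inl rfl))
    · exact ha (Or.inr (Or.inr rfl))

theorem sum_eq_of_grape {g : Σ v : V, Fin (ℓ v)} {x : GrapeVertex ℓ → ℝ}
    (hx : ∀ a, a ∉ grapeCell g → x a = 0) :
    ∑ a, x a = x (.inl g.1) + (x (.inr (g, false)) + x (.inr (g, true))) := by
  classical
  have h : ∑ a ∈ ({.inl g.1, .inr (g, false), .inr (g, true)} : Finset (GrapeVertex ℓ)), x a =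
      ∑ a, x a := by
    refine Finset.sum_subset (Finset.subset_univ _) fun a _ ha => hx a fun h => ha ?_
    rcases h with rfl | rfl | rfl <;> simp
  rw [← h, Finset.sum_insert (by simp), Finset.sum_insert (by simp), Finset.sum_singleton]

theorem arcCoords_mem (g : Σ v : V, Fin (ℓ v)) (u : ℝ) : arcCoords g u ∈
    stdSimplex ℝ (GrapeVertex ℓ) ∧ IsCell (bunch T ℓ) (Function.support (arcCoords g u)) := by
  have h0 : ∀ a, 0 ≤ arcCoords g u a := by
    rintro (v | ⟨h, i⟩)
    · simp only [arcCoords]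
      split_ifs
      · exact le_min zero_le_one (le_max_left _ _)
      · exact le_rfl
    · simp only [arcCoords]
      split_ifs
      · exact le_max_left _ _
      · exact le_rfl
  have hs : ∑ a, arcCoords g u a =
      min 1 (max 0 (|u| - 1)) + (tent (-u) + tent u) := by
    rw [sum_eq_of_grape fun a => arcCoords_of_notMem, arcCoords_inl, arcCoords_inr, arcCoords_inr]
    rfl
  -- one of the three coordinates vanishes
  have key : ∀ {σ : Set (GrapeVertex ℓ)} {b : GrapeVertex ℓ}, grapeCell g ⊆ insert b σ →
      arcCoords g u b = 0 → ∀ a, a ∉ σ → arcCoords g u a = 0 := by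
    intro σ b hσ hb a ha
    by_cases hag : a ∈ grapeCell g
    · rcases hσ hag with rfl | h
      · exact hb
      · exact (ha h).elim
    · exact arcCoords_of_notMem hag
  rcases le_or_gt u (-1) with h | h
  · refine mem_realization (σ := {.inl g.1, .inr (g, false)}) (isCell_pair (adj_inl_inr.mpr rfl))
      h0 ?_ (key (b := .inr (g, true)) ?_ ?_)
    · rw [hs, abs_of_nonpos (by linarith), tent_of_le_neg_one h, tent_of_one_le (by linarith),
        max_eq_right (by linarith)]
      rcases le_total (-u) 2 with h2 | h2
      · rw [min_eq_right (by linarith), max_eq_right (by linarith)]; ring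
      · rw [min_eq_left (by linarith), max_eq_left (by linarith)]; ring
    · rintro a (rfl | rfl | rfl) <;> simp
    · rw [arcCoords_inr]
      exact tent_of_le_neg_one h
  rcases le_or_gt 1 u with h' | h'
  · refine mem_realization (σ := {.inl g.1, .inr (g, true)}) (isCell_pair (adj_inl_inr.mpr rfl))
      h0 ?_ (key (b := .inr (g, false)) ?_ ?_)
    · rw [hs, abs_of_nonneg (by linarith), tent_of_le_neg_one (u := -u) (by linarith),
        tent_of_one_le (by linarith), max_eq_right (by linarith)]
      rcases le_total u 2 with h2 | h2
      · rw [min_eq_right (by linarith), max_eq_right (by linarith)]; ring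
      · rw [min_eq_left (by linarith), max_eq_left (by linarith)]; ring
    · rintro a (rfl | rfl | rfl) <;> simp
    · rw [arcCoords_inr]
      exact tent_of_le_neg_one (by simp; linarith)
  · have hu : |u| ≤ 1 := abs_le.mpr ⟨h.le, h'.le⟩
    refine mem_realization (σ := {.inr (g, false), .inr (g, true)})
      (isCell_pair (adj_inr.mpr ⟨rfl, by simp⟩)) h0 ?_ (key (b := .inl g.1) ?_ ?_)
    · rw [hs, tent_of_abs_le_one hu, tent_of_abs_le_one (by rwa [abs_neg]),
        max_eq_left (by linarith), min_eq_right (by linarith)]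
      ring
    · rintro a (rfl | rfl | rfl) <;> simp
    · rw [arcCoords_inl, max_eq_left (by linarith), min_eq_right (by linarith)]

/-- The point of the grape `g` with arc coordinate `u`. The arc coordinates between `-2` and `2`
parametrize the complement of the vertex at which `g` is attached. -/
noncomputable def arcPoint (T : SimpleGraph V) (g : Σ v : V, Fin (ℓ v)) (u : ℝ) :
    Realization (bunch T ℓ) :=
  ⟨arcCoords g u, arcCoords_mem g u⟩

theorem continuous_arcPoint (g : Σ v : V, Fin (ℓ v)) : Continuous (arcPoint T g) := by
  have ht : Continuous tent := by
    unfold tent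
    fun_prop
  refine continuous_realization_mk fun a => ?_
  change Continuous fun u => arcCoords g u a
  rcases a with v | ⟨h, i⟩
  · simp only [arcCoords]
    split_ifs
    · fun_prop
    · exact continuous_const
  · simp only [arcCoords]
    split_ifs
    · cases i
      · exact ht.comp continuous_neg
      · exact ht
    · exact continuous_const

/-- The complement in the grape `g` of the vertex at which it is attached. -/
def openGrape (T : SimpleGraph V) (g : Σ v : V, Fin (ℓ v)) : Set (Realization (bunch T ℓ)) :=
  {x | 0 < x.1 (.inr (g, false)) + x.1 (.inr (g, true))}

theorem isOpen_openGrape (g : Σ v : V, Fin (ℓ v)) : IsOpen (openGrape T g) :=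
  isOpen_lt continuous_const ((continuous_coord _).add (continuous_coord _))

theorem mem_openGrape_of_ne {x : Realization (bunch T ℓ)} {g : Σ v : V, Fin (ℓ v)} {i : Bool}
    (h : x.1 (.inr (g, i)) ≠ 0) : x ∈ openGrape T g := by
  have := (x.nonneg (.inr (g, i))).lt_of_ne' h
  cases i
  · exact add_pos_of_pos_of_nonneg this (x.nonneg _)
  · exact add_pos_of_nonneg_of_pos (x.nonneg _) this

theorem exists_ne_of_mem_openGrape {x : Realization (bunch T ℓ)} {g : Σ v : V, Fin (ℓ v)}
    (h : x ∈ openGrape T g) : ∃ i, x.1 (.inr (g, i)) ≠ 0 := by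
  by_contra hx
  push Not at hx
  change 0 < x.1 (.inr (g, false)) + x.1 (.inr (g, true)) at h
  rw [hx, hx] at h
  simp at h

/-- A point of a grape lies on one of the three edges of the grape. -/
theorem coords_of_mem_openGrape {x : Realization (bunch T ℓ)} {g : Σ v : V, Fin (ℓ v)}
    (h : x ∈ openGrape T g) : (∀ a, a ∉ grapeCell g → x.1 a = 0) ∧
      (x.1 (.inl g.1) = 0 ∨ x.1 (.inr (g, false)) = 0 ∨ x.1 (.inr (g, true)) = 0) := by
  obtain ⟨i, hi⟩ := exists_ne_of_mem_openGrape h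
  have key : ∀ {a : GrapeVertex ℓ}, a ∉ Function.support x.1 → x.1 a = 0 :=
    fun h => Function.notMem_support.mp h
  have hmem : ∀ i : Bool, (.inr (g, i) : GrapeVertex ℓ) ∈ grapeCell g := by
    intro i
    cases i <;> simp [grapeCell]
  rcases x.2.2.eq_of_mem (a := .inr (g, i)) hi with e | ⟨b, hb, e⟩
  · refine ⟨fun a ha => key ?_, Or.inl (key ?_)⟩
    · rw [e]
      rintro rfl
      exact ha (hmem i)
    · rw [e]
      simp
  · rcases b with v | ⟨k, j⟩
    · obtain rfl := adj_inr_inl.mp hb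
      refine ⟨fun a ha => key ?_, Or.inr ?_⟩
      · rw [e]
        rintro (rfl | rfl)
        · exact ha (hmem i)
        · exact ha (Or.inl rfl)
      · cases i
        · exact Or.inr (key (by rw [e]; simp))
        · exact Or.inl (key (by rw [e]; simp))
    · obtain ⟨rfl, -⟩ := adj_inr.mp hb
      refine ⟨fun a ha => key ?_, Or.inl (key (by rw [e]; simp))⟩
      rw [e]
      rintro (rfl | rfl)
      · exact ha (hmem i)
      · exact ha (hmem j)

theorem sum_coords_of_mem_openGrape {x : Realization (bunch T ℓ)} {g : Σ v : V, Fin (ℓ v)}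
    (h : x ∈ openGrape T g) :
    x.1 (.inl g.1) + (x.1 (.inr (g, false)) + x.1 (.inr (g, true))) = 1 := by
  rw [← sum_eq_of_grape (coords_of_mem_openGrape h).1, x.sum_eq_one]

/-- Different grapes only meet in vertices of the stem. -/
theorem eq_of_mem_openGrape {x : Realization (bunch T ℓ)} {g h : Σ v : V, Fin (ℓ v)}
    (hg : x ∈ openGrape T g) (hh : x ∈ openGrape T h) : g = h := by
  obtain ⟨i, hi⟩ := exists_ne_of_mem_openGrape hh
  by_contra hne
  refine hi ((coords_of_mem_openGrape hg).1 _ ?_)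
  rintro (e | e | e)
  · exact Sum.inr_ne_inl e
  · exact hne (congrArg Prod.fst (Sum.inr_injective e)).symm
  · exact hne (congrArg Prod.fst (Sum.inr_injective e)).symm

/-- The arc coordinate of a point of the grape `g`: the difference of the barycentric coordinates of
the two outer vertices, stretched so that it becomes a bijection to the interval from `-2` to `2`.
It is only meaningful on `openGrape T g`. -/
noncomputable def arc (g : Σ v : V, Fin (ℓ v)) (x : Realization (bunch T ℓ)) : ℝ :=
  (x.1 (.inr (g, true)) - x.1 (.inr (g, false))) *
    (1 + 2 * x.1 (.inl g.1) / (x.1 (.inr (g, false)) + x.1 (.inr (g, true))))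

theorem continuousOn_arc (g : Σ v : V, Fin (ℓ v)) : ContinuousOn (arc (T := T) g) (openGrape T g) :=
  ((continuous_coord _).sub (continuous_coord _)).continuousOn.mul
    (continuousOn_const.add ((continuous_const.mul (continuous_coord _)).continuousOn.div
      ((continuous_coord _).add (continuous_coord _)).continuousOn fun _ h => ne_of_gt h))

/-- The possible values of the arc coordinate, and the point that it determines. -/
theorem arc_spec {x : Realization (bunch T ℓ)} {g : Σ v : V, Fin (ℓ v)} (h : x ∈ openGrape T g) :
    |arc g x| < 2 ∧ arcPoint T g (arc g x) = x := by
  have hpos : 0 < x.1 (.inr (g, false)) + x.1 (.inr (g, true)) := h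
  obtain ⟨hoff, hcase⟩ := coords_of_mem_openGrape h
  have hsum := sum_coords_of_mem_openGrape h
  have h1 := x.nonneg (.inr (g, false))
  have h2 := x.nonneg (.inr (g, true))
  have h3 := x.nonneg (.inl g.1)
  have key : ∀ u : ℝ, min 1 (max 0 (|u| - 1)) = x.1 (.inl g.1) →
      tent (-u) = x.1 (.inr (g, false)) → tent u = x.1 (.inr (g, true)) → arcPoint T g u = x := by
    intro u e1 e2 e3
    refine Realization.ext_coords fun a => ?_
    change arcCoords g u a = x.1 a
    by_cases ha : a ∈ grapeCell g
    · rcases ha with rfl | rfl | rfl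
      · rw [arcCoords_inl, e1]
      · rw [arcCoords_inr]; exact e2
      · rw [arcCoords_inr]; exact e3
    · rw [arcCoords_of_notMem ha, hoff a ha]
  rcases hcase with e | e | e
  · have ha : arc g x = x.1 (.inr (g, true)) - x.1 (.inr (g, false)) := by
      unfold arc
      rw [e]
      ring
    have hle : |arc g x| ≤ 1 := by
      rw [ha, abs_le]
      constructor <;> linarith
    refine ⟨by linarith, key _ ?_ ?_ ?_⟩
    · rw [max_eq_left (by linarith), e, min_eq_right zero_le_one]
    · rw [tent_of_abs_le_one (by rwa [abs_neg]), ha]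
      linarith
    · rw [tent_of_abs_le_one hle, ha]
      linarith
  · have ha : arc g x = 1 + x.1 (.inl g.1) := by
      have hb : x.1 (.inr (g, true)) ≠ 0 := by
        rw [e, zero_add] at hpos
        exact hpos.ne'
      unfold arc
      rw [e, zero_add, sub_zero]
      field_simp
      linarith
    have hab : |arc g x| = 1 + x.1 (.inl g.1) := by rw [ha, abs_of_nonneg (by linarith)]
    refine ⟨by linarith, key _ ?_ ?_ ?_⟩
    · rw [hab, max_eq_right (by linarith), min_eq_right (by linarith)]
      ring
    · rw [tent_of_le_neg_one (by linarith), e]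
    · rw [tent_of_one_le (by linarith), ha, max_eq_right (by linarith)]
      linarith
  · have ha : arc g x = -(1 + x.1 (.inl g.1)) := by
      have hb : x.1 (.inr (g, false)) ≠ 0 := by
        rw [e, add_zero] at hpos
        exact hpos.ne'
      unfold arc
      rw [e, add_zero, zero_sub]
      field_simp
      linarith
    have hab : |arc g x| = 1 + x.1 (.inl g.1) := by
      rw [ha, abs_neg, abs_of_nonneg (by linarith)]
    refine ⟨by linarith, key _ ?_ ?_ ?_⟩
    · rw [hab, max_eq_right (by linarith), min_eq_right (by linarith)]
      ring
    · rw [tent_of_one_le (by linarith), ha, max_eq_right (by linarith)]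
      linarith
    · rw [tent_of_le_neg_one (by linarith), e]

theorem coord_inl_of_mem_openGrape {x : Realization (bunch T ℓ)} {g : Σ v : V, Fin (ℓ v)}
    (h : x ∈ openGrape T g) : x.1 (.inl g.1) = max 0 (|arc g x| - 1) := by
  obtain ⟨h1, h2⟩ := arc_spec h
  have e : arcCoords g (arc g x) (.inl g.1) = x.1 (.inl g.1) := by
    conv_rhs => rw [← h2]
    rfl
  rw [← e, arcCoords_inl, min_eq_right (max_le zero_le_one (by linarith))]

theorem arcPoint_mem_openGrape {g : Σ v : V, Fin (ℓ v)} {u : ℝ} (h : |u| < 2) :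
    arcPoint T g u ∈ openGrape T g := by
  change 0 < arcCoords g u (.inr (g, false)) + arcCoords g u (.inr (g, true))
  have hs := (arcCoords_mem (T := T) g u).1.2
  rw [sum_eq_of_grape fun a => arcCoords_of_notMem, arcCoords_inl,
    min_eq_right (max_le zero_le_one (by linarith))] at hs
  have : max 0 (|u| - 1) < 1 := max_lt one_pos (by linarith)
  linarith

theorem arc_arcPoint {g : Σ v : V, Fin (ℓ v)} {u : ℝ} (h : |u| < 2) :
    arc g (arcPoint T g u) = u := by
  change (arcCoords g u (.inr (g, true)) - arcCoords g u (.inr (g, false))) *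
    (1 + 2 * arcCoords g u (.inl g.1) /
      (arcCoords g u (.inr (g, false)) + arcCoords g u (.inr (g, true)))) = u
  rw [arcCoords_inl, arcCoords_inr, arcCoords_inr]
  change (tent u - tent (-u)) * (1 + 2 * (min 1 (max 0 (|u| - 1))) / (tent (-u) + tent u)) = u
  rw [min_eq_right (max_le zero_le_one (by linarith))]
  obtain ⟨h1, h2⟩ := abs_lt.mp h
  rcases le_or_gt u (-1) with hu | hu
  · rw [tent_of_le_neg_one hu, tent_of_one_le (by linarith), max_eq_right (by linarith),
      abs_of_nonpos (by linarith), max_eq_right (by linarith)]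
    have : 2 - -u + 0 ≠ 0 := by linarith
    field_simp
    ring
  rcases le_or_gt 1 u with hu' | hu'
  · rw [tent_of_le_neg_one (u := -u) (by linarith), tent_of_one_le hu', max_eq_right (by linarith),
      abs_of_nonneg (by linarith), max_eq_right (by linarith)]
    have : 0 + (2 - u) ≠ 0 := by linarith
    field_simp
    ring
  · have hle : |u| ≤ 1 := abs_le.mpr ⟨hu.le, hu'.le⟩
    rw [tent_of_abs_le_one hle, tent_of_abs_le_one (by rwa [abs_neg]), max_eq_left (by linarith)]
    ring

end ArcCoordinate
/-! ### Pieces of the configuration space with a point on a grape -/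

section Pieces

/-- Attachments to a set of unordered configurations, when the order of the two points is
determined on each of the attached pieces. -/
theorem isAttachment_unord {X : Type u} [TopologicalSpace X] {J : Type*} {κ : J → Type*}
    {U : Set (UC₂ X)} {O : J → Set (C₂ X)} {P : ∀ j, κ j → Set (C₂ X)} (hU : IsOpen U)
    (hU' : IsPathConnected U) (hO : ∀ j, IsOpen (O j)) (hOs : ∀ j, IsSimplyConnected (O j))
    (hswap : ∀ j k, ∀ p ∈ O j, swapC₂ p ∉ O k) (hdisj : ∀ j k, ∀ p ∈ O j, p ∈ O k → j = k)
    (hP : ∀ j i, IsOpen (P j i)) (hPs : ∀ j i, IsSimplyConnected (P j i))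
    (hPO : ∀ j i, P j i ⊆ O j) (hPd : ∀ j i k, ∀ p ∈ P j i, p ∈ P j k → i = k)
    (hmem : ∀ j, ∀ p ∈ O j, unord p ∈ U ↔ ∃ i, p ∈ P j i) :
    IsAttachment U (fun j => unord '' O j) (fun j i => unord '' P j i) where
  isOpen_base := hU
  isPathConnected_base := hU'
  isOpen_piece j := isOpenQuotientMap_unord.isOpenMap _ (hO j)
  simplyConnected_piece j := isSimplyConnected_unord_image (hO j) (hswap j j) (hOs j)
  disjoint_piece j k hjk := by
    rw [Set.disjoint_left]
    rintro _ ⟨p, hp, rfl⟩ ⟨p', hp', e⟩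
    rcases unord_eq_iff.mp e.symm with rfl | rfl
    · exact hjk (hdisj j k _ hp hp')
    · exact hswap j k p hp hp'
  isOpen_overlap j i := isOpenQuotientMap_unord.isOpenMap _ (hP j i)
  simplyConnected_overlap j i := isSimplyConnected_unord_image (hP j i)
    (fun p hp hp' => hswap j j p (hPO j i hp) (hPO j i hp')) (hPs j i)
  disjoint_overlap j i k hik := by
    rw [Set.disjoint_left]
    rintro _ ⟨p, hp, rfl⟩ ⟨p', hp', e⟩
    rcases unord_eq_iff.mp e.symm with rfl | rfl
    · exact hik (hPd j i k _ hp hp')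
    · exact hswap j j p (hPO j i hp) (hPO j k hp')
  iUnion_overlap j := by
    ext z
    simp only [mem_iUnion, mem_inter_iff]
    constructor
    · rintro ⟨i, p, hp, rfl⟩
      exact ⟨(hmem j p (hPO j i hp)).mpr ⟨i, hp⟩, p, hPO j i hp, rfl⟩
    · rintro ⟨hz, p, hp, rfl⟩
      obtain ⟨i, hi⟩ := (hmem j p hp).mp hz
      exact ⟨i, p, hi, rfl⟩

theorem vertexPoint_apply_self {α : Type u} [Fintype α] (G : SimpleGraph α) (a : α) :
    (vertexPoint G a).1 a = 1 := by
  classical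
  exact Pi.single_eq_same (M := fun _ => ℝ) a 1

theorem vertexPoint_apply_of_ne {α : Type u} [Fintype α] (G : SimpleGraph α) {a b : α}
    (h : b ≠ a) : (vertexPoint G a).1 b = 0 := by
  classical
  exact Pi.single_eq_of_ne (M := fun _ => ℝ) h 1

/-- A point of a graph with two nonzero coordinates lies on an edge. -/
theorem edge_coords {α : Type u} [Fintype α] {G : SimpleGraph α} {x : Realization G} {a b : α}
    (hab : a ≠ b) (ha : x.1 a ≠ 0) (hb : x.1 b ≠ 0) :
    G.Adj a b ∧ (∀ c, c ≠ a → c ≠ b → x.1 c = 0) ∧ x.1 a + x.1 b = 1 := by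
  classical
  have hb' : b ∈ Function.support x.1 := hb
  rcases x.2.2.eq_of_mem (a := a) ha with e | ⟨c, hc, e⟩
  · rw [e] at hb'
    exact (hab hb'.symm).elim
  · rw [e] at hb'
    obtain rfl : b = c := by
      rcases hb' with h | h
      · exact (hab h.symm).elim
      · exact h
    have h0 : ∀ c, c ≠ a → c ≠ b → x.1 c = 0 := fun c hca hcb =>
      Function.notMem_support.mp (by rw [e]; rintro (h | h); exacts [hca h, hcb h])
    refine ⟨hc, h0, ?_⟩
    rw [← x.sum_eq_one, ← Finset.sum_pair hab]
    refine Finset.sum_subset (Finset.subset_univ _) fun c _ hc => ?_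
    rw [Finset.mem_insert, Finset.mem_singleton, not_or] at hc
    exact h0 c hc.1 hc.2

variable {V : Type u} [Fintype V] {T : SimpleGraph V} {ℓ : V → ℕ}

/-- The configurations of a point on the grape `g` and a point closer to the vertex at which this
grape is attached. -/
def nearStem (T : SimpleGraph V) (g : Σ v : V, Fin (ℓ v)) : Set (C₂ (Realization (bunch T ℓ))) :=
  {p | p.1.2 ∈ openGrape T g ∧ p.1.2.1 (.inl g.1) < p.1.1.1 (.inl g.1)}

/-- The part of `nearStem` where the other point is on the edge of the stem that leads to `w`. -/
def nearStemEdge (T : SimpleGraph V) (g : Σ v : V, Fin (ℓ v)) (w : V) :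
    Set (C₂ (Realization (bunch T ℓ))) :=
  nearStem T g ∩ {p | 0 < p.1.1.1 (.inl w)}

theorem continuous_fst_config {X : Type u} [TopologicalSpace X] :
    Continuous fun p : C₂ X => p.1.1 :=
  continuous_fst.comp continuous_subtype_val

theorem continuous_snd_config {X : Type u} [TopologicalSpace X] :
    Continuous fun p : C₂ X => p.1.2 :=
  continuous_snd.comp continuous_subtype_val

theorem isOpen_nearStem (g : Σ v : V, Fin (ℓ v)) : IsOpen (nearStem T g) :=
  ((isOpen_openGrape g).preimage continuous_snd_config).inter
    (isOpen_lt ((continuous_coord _).comp continuous_snd_config)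
      ((continuous_coord _).comp continuous_fst_config))

theorem isOpen_nearStemEdge (g : Σ v : V, Fin (ℓ v)) (w : V) : IsOpen (nearStemEdge T g w) :=
  (isOpen_nearStem g).inter
    (isOpen_lt continuous_const ((continuous_coord _).comp continuous_fst_config))

/-- A point of the grape `g` has only one stem coordinate. -/
theorem stemCoord_of_mem_openGrape {x : Realization (bunch T ℓ)} {g : Σ v : V, Fin (ℓ v)}
    (h : x ∈ openGrape T g) {v : V} (hv : v ≠ g.1) : stemCoord x v = 0 := by
  obtain ⟨i, hi⟩ := exists_ne_of_mem_openGrape h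
  exact stemCoord_of_grape hi hv

theorem nearStem_swap {g h : Σ v : V, Fin (ℓ v)} {p : C₂ (Realization (bunch T ℓ))}
    (hp : p ∈ nearStem T g) : swapC₂ p ∉ nearStem T h := by
  rintro ⟨h1, h2⟩
  change p.1.1 ∈ openGrape T h at h1
  change p.1.1.1 (.inl h.1) < p.1.2.1 (.inl h.1) at h2
  by_cases e : h.1 = g.1
  · rw [e] at h2
    exact lt_asymm hp.2 h2
  · have := stemCoord_eq_zero_iff.mp (stemCoord_of_mem_openGrape hp.1 e) (.inl h.1) rfl
    rw [this] at h2
    exact absurd h2 (not_lt.mpr (p.1.1.nonneg _))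

theorem unord_mem_nearStem {g : Σ v : V, Fin (ℓ v)} {p : C₂ (Realization (bunch T ℓ))}
    (hp : p ∈ nearStem T g) :
    unord p ∈ stemDistinct T ℓ ↔ ∃ w : T.neighborSet g.1, p ∈ nearStemEdge T g w := by
  rw [unord_mem_stemDistinct]
  have hv : p.1.1.1 (.inl g.1) ≠ 0 := ((p.1.2.nonneg _).trans_lt hp.2).ne'
  constructor
  · intro h
    by_contra hw
    push Not at hw
    refine h (eq_of_concentrated (w := g.1) (stemCoord_mem _) (stemCoord_mem _)
      (fun v hv => stemCoord_of_mem_openGrape hp.1 hv) fun w hw0 => ?_)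
    rw [stemCoord_eq_zero_iff]
    rintro a rfl
    by_contra ha
    by_cases hs : stem a = g.1
    · obtain ⟨i, hi⟩ := exists_ne_of_mem_openGrape hp.1
      have h1 : stemCoord p.1.2 g.1 = 0 := by rw [← hs]; exact hw0
      exact hi (stemCoord_eq_zero_iff.mp h1 _ rfl)
    · obtain ⟨hadj, -⟩ := edge_coords (a := .inl g.1) (b := a) (by rintro rfl; exact hs rfl) hv ha
      obtain ⟨-, hal, hT⟩ := adj_of_stem_ne hadj (Ne.symm hs)
      exact hw ⟨stem a, hT⟩ ⟨hp, (p.1.1.nonneg _).lt_of_ne' (by rwa [hal] at ha)⟩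
  · rintro ⟨w, hw⟩ e
    have h1 := stemCoord_of_mem_openGrape hp.1 w.2.ne'
    rw [← e] at h1
    exact (hw.2 : 0 < p.1.1.1 (.inl w.1)).ne' (stemCoord_eq_zero_iff.mp h1 _ rfl)

theorem continuous_arc_snd {g : Σ v : V, Fin (ℓ v)} {O : Set (C₂ (Realization (bunch T ℓ)))}
    (hO : ∀ p ∈ O, p.1.2 ∈ openGrape T g) : Continuous fun p : O => arc g p.1.1.2 :=
  (continuousOn_arc g).comp_continuous (continuous_snd_config.comp continuous_subtype_val)
    fun p => hO p.1 p.2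

theorem continuous_arc_fst {g : Σ v : V, Fin (ℓ v)} {O : Set (C₂ (Realization (bunch T ℓ)))}
    (hO : ∀ p ∈ O, p.1.1 ∈ openGrape T g) : Continuous fun p : O => arc g p.1.1.1 :=
  (continuousOn_arc g).comp_continuous (continuous_fst_config.comp continuous_subtype_val)
    fun p => hO p.1 p.2

theorem arcPoint_inl {g : Σ v : V, Fin (ℓ v)} {u : ℝ} (hu : |u| < 2) :
    (arcPoint T g u).1 (.inl g.1) = max 0 (|u| - 1) :=
  (arcCoords_inl g u).trans (min_eq_right (max_le zero_le_one (by linarith)))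

/-- In the coordinates given by the first point and the arc coordinate of the second one, this set
is star-shaped. -/
theorem isSimplyConnected_nearStem (g : Σ v : V, Fin (ℓ v)) : IsSimplyConnected (nearStem T g) := by
  classical
  let S : Set ((GrapeVertex ℓ → ℝ) × ℝ) :=
    {s | (s.1 ∈ stdSimplex ℝ (GrapeVertex ℓ) ∧ IsCell (bunch T ℓ) (Function.support s.1)) ∧
      |s.2| < 2 ∧ max 0 (|s.2| - 1) < s.1 (.inl g.1)}
  let e : GrapeVertex ℓ → ℝ := (vertexPoint (bunch T ℓ) (.inl g.1)).1
  have he : e (.inl g.1) = 1 := vertexPoint_apply_self _ _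
  have hS : StarConvex ℝ (e, (0 : ℝ)) S := by
    rintro ⟨x, u⟩ ⟨⟨hx, hx'⟩, hu, hxu⟩ a b ha hb hab
    change |u| < 2 at hu
    change max 0 (|u| - 1) < x (.inl g.1) at hxu
    obtain ⟨h1, h2⟩ := max_lt_iff.mp hxu
    have hconv := convex_stdSimplex ℝ (GrapeVertex ℓ)
      (vertexPoint (bunch T ℓ) (.inl g.1)).2.1 hx ha hb hab
    refine ⟨mem_realization hx' hconv.1 hconv.2 fun c hc => ?_, ?_, ?_⟩
    · change a * e c + b * x c = 0
      have : c ∉ Function.support e := by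
        rw [support_vertexPoint]
        rintro rfl
        exact hc h1.ne'
      have hc' : x c = 0 := Function.notMem_support.mp hc
      rw [Function.notMem_support.mp this, hc']
      ring
    · change |a * 0 + b * u| < 2
      rw [mul_zero, zero_add, abs_mul, abs_of_nonneg hb]
      nlinarith [abs_nonneg u]
    · change max 0 (|a * 0 + b * u| - 1) < a * e (.inl g.1) + b * x (.inl g.1)
      rw [mul_zero, zero_add, abs_mul, abs_of_nonneg hb, he]
      rcases hb.eq_or_lt with rfl | hb
      · have : a = 1 := by linarith
        subst this
        norm_num
      · have h3 := mul_pos hb h1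
        have h4 := mul_lt_mul_of_pos_left h2 hb
        exact max_lt (by linarith) (by linarith)
  have hmem : (e, (0 : ℝ)) ∈ S := by
    refine ⟨(vertexPoint (bunch T ℓ) (.inl g.1)).2, ?_, ?_⟩
    · change |(0 : ℝ)| < 2
      norm_num
    · change max 0 (|(0 : ℝ)| - 1) < e (.inl g.1)
      rw [he]
      norm_num
  have : ContractibleSpace S := hS.contractibleSpace ⟨_, hmem⟩
  have hx : Continuous fun s : S => (⟨s.1.1, s.2.1⟩ : Realization (bunch T ℓ)) :=
    continuous_realization_mk fun a =>
      (continuous_apply a).comp (continuous_fst.comp continuous_subtype_val)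
  refine isSimplyConnected_of_retract (S := S)
    (fun p => ⟨(p.1.1.1.1, arc g p.1.1.2), p.1.1.1.2, (arc_spec p.2.1).1, by
      change max 0 (|arc g p.1.1.2| - 1) < p.1.1.1.1 (.inl g.1)
      rw [← coord_inl_of_mem_openGrape p.2.1]
      exact p.2.2⟩)
    ((Continuous.prodMk (continuous_coords.comp
      (continuous_fst_config.comp continuous_subtype_val))
      (continuous_arc_snd fun p hp => hp.1)).subtype_mk _)
    (fun s => ⟨(⟨s.1.1, s.2.1⟩, arcPoint T g s.1.2), fun h => by
      have h1 := congrArg (fun x : Realization (bunch T ℓ) => x.1 (.inl g.1)) h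
      have h2 := s.2.2.2
      rw [← arcPoint_inl (T := T) s.2.2.1] at h2
      exact h2.ne' h1⟩)
    ((hx.prodMk
      ((continuous_arcPoint g).comp (continuous_snd.comp continuous_subtype_val))).subtype_mk _)
    (fun s => ⟨arcPoint_mem_openGrape s.2.2.1, by
      change (arcPoint T g s.1.2).1 (.inl g.1) < s.1.1 (.inl g.1)
      rw [arcPoint_inl s.2.2.1]
      exact s.2.2.2⟩)
    fun p => Subtype.ext (Prod.ext rfl (arc_spec p.2.1).2)

theorem isSimplyConnected_nearStemEdge (g : Σ v : V, Fin (ℓ v)) {w : V} (hw : T.Adj g.1 w) :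
    IsSimplyConnected (nearStemEdge T g w) := by
  classical
  let S : Set (ℝ × ℝ) := {s | (0 < s.1 ∧ s.1 < 1) ∧ |s.2| < 2 ∧ |s.2| + s.1 < 2}
  have hS : Convex ℝ S := by
    rintro ⟨s, u⟩ ⟨⟨h1, h2⟩, h3, h4⟩ ⟨s', u'⟩ ⟨⟨h1', h2'⟩, h3', h4'⟩ a b ha hb hab
    change 0 < s at h1; change s < 1 at h2; change |u| < 2 at h3; change |u| + s < 2 at h4
    change 0 < s' at h1'; change s' < 1 at h2'; change |u'| < 2 at h3'; change |u'| + s' < 2 at h4'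
    have h5 : |a * u + b * u'| ≤ a * |u| + b * |u'| := by
      refine (abs_add_le _ _).trans ?_
      rw [abs_mul, abs_mul, abs_of_nonneg ha, abs_of_nonneg hb]
    refine ⟨⟨convex_Ioi (0 : ℝ) h1 h1' ha hb hab, convex_Iio (1 : ℝ) h2 h2' ha hb hab⟩,
      h5.trans_lt (convex_Iio (2 : ℝ) h3 h3' ha hb hab), ?_⟩
    have h6 : a * (|u| + s) + b * (|u'| + s') < 2 := convex_Iio (2 : ℝ) h4 h4' ha hb hab
    change |a * u + b * u'| + (a * s + b * s') < 2
    linarith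
  have : ContractibleSpace S := hS.contractibleSpace ⟨(1 / 2, 0), by norm_num [S]⟩
  have hne : (Sum.inl g.1 : GrapeVertex ℓ) ≠ .inl w := fun h => hw.ne (Sum.inl_injective h)
  have hcell : IsCell (bunch T ℓ) {.inl g.1, .inl w} := isCell_pair (adj_inl.mpr hw)
  have hsupp : Function.support (vertexPoint (bunch T ℓ) (.inl g.1)).1 ⊆ {.inl g.1, .inl w} :=
    (support_vertexPoint _).trans_subset (by simp)
  have hsupp' : Function.support (vertexPoint (bunch T ℓ) (.inl w)).1 ⊆ {.inl g.1, .inl w} :=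
    (support_vertexPoint _).trans_subset (by simp)
  let E : unitInterval → Realization (bunch T ℓ) := segmentPoint hcell hsupp hsupp'
  have hE : ∀ t a, (E t).1 a = (1 - (t : ℝ)) * (vertexPoint (bunch T ℓ) (.inl g.1)).1 a
    + t * (vertexPoint (bunch T ℓ) (.inl w)).1 a := fun _ _ => rfl
  have hEg : ∀ t, (E t).1 (.inl g.1) = 1 - t := fun t => by
    rw [hE, vertexPoint_apply_self, vertexPoint_apply_of_ne _ hne]
    ring
  have hEw : ∀ t, (E t).1 (.inl w) = t := fun t => by
    rw [hE, vertexPoint_apply_self, vertexPoint_apply_of_ne _ hne.symm]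
    ring
  have hEc : Continuous E := by
    refine continuous_realization_mk fun a => ?_
    simp only [hE]
    fun_prop
  have hcoord : ∀ p ∈ nearStemEdge T g w, 0 < p.1.1.1 (.inl w) ∧
      (∀ c, c ≠ .inl g.1 → c ≠ .inl w → p.1.1.1 c = 0) ∧
      p.1.1.1 (.inl g.1) + p.1.1.1 (.inl w) = 1 ∧ 0 < p.1.1.1 (.inl g.1) := by
    rintro p ⟨⟨h1, h2⟩, h3⟩
    have h4 := (p.1.2.nonneg (.inl g.1)).trans_lt h2
    have h5 := (edge_coords hne h4.ne' (ne_of_gt h3)).2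
    exact ⟨h3, h5.1, h5.2, h4⟩
  have hI : ∀ s : S, s.1.1 ∈ unitInterval := fun s => ⟨s.2.1.1.le, s.2.1.2.le⟩
  have hlt : ∀ s : S, (arcPoint T g s.1.2).1 (.inl g.1) < (E ⟨s.1.1, hI s⟩).1 (.inl g.1) := by
    intro s
    rw [arcPoint_inl s.2.2.1, hEg]
    have h1 := s.2.1.2
    have h2 := s.2.2.2
    refine max_lt ?_ ?_
    · change 0 < 1 - s.1.1
      linarith
    · change |s.1.2| - 1 < 1 - s.1.1
      linarith
  have hL : ∀ p : nearStemEdge T g w, (p.1.1.1.1 (.inl w), arc g p.1.1.2) ∈ S := by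
    intro p
    obtain ⟨h1, -, h2, h3⟩ := hcoord p.1 p.2
    have h4 := p.2.1.2
    rw [coord_inl_of_mem_openGrape p.2.1.1] at h4
    obtain ⟨h5, h6⟩ := max_lt_iff.mp h4
    refine ⟨⟨h1, ?_⟩, (arc_spec p.2.1.1).1, ?_⟩
    · change p.1.1.1.1 (.inl w) < 1
      linarith
    · change |arc g p.1.1.2| + p.1.1.1.1 (.inl w) < 2
      linarith
  refine isSimplyConnected_of_retract (S := S) (fun p => ⟨_, hL p⟩)
    ((Continuous.prodMk ((continuous_coord _).comp
      (continuous_fst_config.comp continuous_subtype_val))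
      (continuous_arc_snd fun p hp => hp.1.1)).subtype_mk hL)
    (fun s => ⟨(E ⟨s.1.1, hI s⟩, arcPoint T g s.1.2), fun h =>
      (hlt s).ne' (congrArg (fun x : Realization (bunch T ℓ) => x.1 (.inl g.1)) h)⟩)
    (((hEc.comp ((continuous_fst.comp continuous_subtype_val).subtype_mk _)).prodMk
      ((continuous_arcPoint g).comp (continuous_snd.comp continuous_subtype_val))).subtype_mk _)
    (fun s => ⟨⟨arcPoint_mem_openGrape s.2.2.1, hlt s⟩, by
      change 0 < (E ⟨s.1.1, hI s⟩).1 (.inl w)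
      rw [hEw]
      exact s.2.1.1⟩)
    fun p => ?_
  obtain ⟨h1, h2, h3, h4⟩ := hcoord p.1 p.2
  refine Subtype.ext (Prod.ext (Realization.ext_coords fun c => ?_) (arc_spec p.2.1.1).2)
  by_cases hc : c = .inl g.1
  · subst hc
    refine (hEg _).trans ?_
    change 1 - p.1.1.1.1 (.inl w) = _
    linarith
  by_cases hc' : c = .inl w
  · subst hc'
    exact hEw _
  · rw [h2 c hc hc']
    refine (hE _ c).trans ?_
    rw [vertexPoint_apply_of_ne _ hc, vertexPoint_apply_of_ne _ hc']
    ring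

/-- The configurations of points on the grapes `g` and `h` whose arc coordinates form a pair in
`C`. -/
def grapePair (T : SimpleGraph V) (g h : Σ v : V, Fin (ℓ v)) (C : Set (ℝ × ℝ)) :
    Set (C₂ (Realization (bunch T ℓ))) :=
  {p | (p.1.1 ∈ openGrape T g ∧ p.1.2 ∈ openGrape T h) ∧ (arc g p.1.1, arc h p.1.2) ∈ C}

theorem isOpen_grapePair (g h : Σ v : V, Fin (ℓ v)) {C : Set (ℝ × ℝ)} (hC : IsOpen C) :
    IsOpen (grapePair T g h C) := by
  refine ContinuousOn.isOpen_inter_preimage (f := fun p : C₂ (Realization (bunch T ℓ)) =>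
    (arc g p.1.1, arc h p.1.2)) ?_ (((isOpen_openGrape g).preimage continuous_fst_config).inter
      ((isOpen_openGrape h).preimage continuous_snd_config)) hC
  exact ((continuousOn_arc g).comp continuous_fst_config.continuousOn fun p hp => hp.1).prodMk
    ((continuousOn_arc h).comp continuous_snd_config.continuousOn fun p hp => hp.2)

theorem isSimplyConnected_grapePair {g h : Σ v : V, Fin (ℓ v)} {C : Set (ℝ × ℝ)}
    (hC : Convex ℝ C) (hne : C.Nonempty) (hbd : ∀ q ∈ C, |q.1| < 2 ∧ |q.2| < 2)
    (hgh : g ≠ h ∨ ∀ q ∈ C, q.1 ≠ q.2) : IsSimplyConnected (grapePair T g h C) := by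
  have : ContractibleSpace C := hC.contractibleSpace hne
  refine isSimplyConnected_of_retract (S := C) (fun p => ⟨(arc g p.1.1.1, arc h p.1.1.2), p.2.2⟩)
    ((Continuous.prodMk (continuous_arc_fst fun p hp => hp.1.1)
      (continuous_arc_snd fun p hp => hp.1.2)).subtype_mk _)
    (fun q => ⟨(arcPoint T g q.1.1, arcPoint T h q.1.2), fun e => ?_⟩)
    ((((continuous_arcPoint g).comp (continuous_fst.comp continuous_subtype_val)).prodMk
      ((continuous_arcPoint h).comp (continuous_snd.comp continuous_subtype_val))).subtype_mk _)
    (fun q => ⟨⟨arcPoint_mem_openGrape (hbd q.1 q.2).1, arcPoint_mem_openGrape (hbd q.1 q.2).2⟩,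
      ?_⟩)
    fun p => Subtype.ext (Prod.ext (arc_spec p.2.1.1).2 (arc_spec p.2.1.2).2)
  · change arcPoint T g q.1.1 = arcPoint T h q.1.2 at e
    have h1 := arcPoint_mem_openGrape (T := T) (g := g) (hbd q.1 q.2).1
    have h2 := arcPoint_mem_openGrape (T := T) (g := h) (hbd q.1 q.2).2
    rw [← e] at h2
    obtain rfl := eq_of_mem_openGrape h1 h2
    rcases hgh with hgh | hgh
    · exact hgh rfl
    · refine hgh q.1 q.2 ?_
      rw [← arc_arcPoint (T := T) (g := g) (hbd q.1 q.2).1, e, arc_arcPoint (hbd q.1 q.2).2]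
  · change (arc g (arcPoint T g q.1.1), arc h (arcPoint T h q.1.2)) ∈ C
    rw [arc_arcPoint (hbd q.1 q.2).1, arc_arcPoint (hbd q.1 q.2).2]
    exact q.2

theorem max_sub_one_lt_iff {a b : ℝ} : max 0 (a - 1) < max 0 (b - 1) ↔ 1 < b ∧ a < b := by
  rw [max_lt_iff, lt_max_iff, lt_max_iff]
  constructor
  · rintro ⟨h1 | h1, h2 | h2⟩ <;> constructor <;> linarith
  · rintro ⟨h1, h2⟩
    exact ⟨Or.inr (by linarith), Or.inr (by linarith)⟩

/-- Two points on grapes at the same vertex of the stem form a configuration in one of the sets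
`nearStem T k` exactly if one of them is closer to this vertex than the other, and lies in the
interior of an edge at this vertex. -/
theorem unord_mem_union_nearStem {g h : Σ v : V, Fin (ℓ v)} (hgh : g.1 = h.1)
    {p : C₂ (Realization (bunch T ℓ))} (hg : p.1.1 ∈ openGrape T g) (hh : p.1.2 ∈ openGrape T h) :
    (unord p ∈ stemDistinct T ℓ ∪ ⋃ k, unord '' nearStem T k) ↔
      (1 < |arc g p.1.1| ∧ |arc h p.1.2| < |arc g p.1.1|) ∨
        (1 < |arc h p.1.2| ∧ |arc g p.1.1| < |arc h p.1.2|) := by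
  have h1 := coord_inl_of_mem_openGrape hg
  have h2 := coord_inl_of_mem_openGrape hh
  rw [← max_sub_one_lt_iff, ← max_sub_one_lt_iff, ← h1, ← h2]
  constructor
  · rintro (hp | hp)
    · refine (unord_mem_stemDistinct.mp hp ?_).elim
      refine eq_of_concentrated (w := g.1) (stemCoord_mem _) (stemCoord_mem _)
        (fun v hv => stemCoord_of_mem_openGrape hh (by rwa [← hgh])) fun v hv => ?_
      refine stemCoord_of_mem_openGrape hg ?_
      rintro rfl
      obtain ⟨i, hi⟩ := exists_ne_of_mem_openGrape hh
      rw [hgh] at hv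
      exact hi (stemCoord_eq_zero_iff.mp hv _ rfl)
    · obtain ⟨k, p', hp', e⟩ := mem_iUnion.mp hp
      rcases unord_eq_iff.mp e.symm with rfl | rfl
      · left
        obtain rfl := eq_of_mem_openGrape hh hp'.1
        rw [hgh]
        exact hp'.2
      · right
        obtain rfl := eq_of_mem_openGrape hg hp'.1
        rw [← hgh]
        exact hp'.2
  · rintro (hlt | hlt)
    · refine Or.inr (mem_iUnion.mpr ⟨h, p, ⟨hh, ?_⟩, rfl⟩)
      rw [hgh] at hlt
      exact hlt
    · refine Or.inr (mem_iUnion.mpr ⟨g, swapC₂ p, ⟨hg, ?_⟩, unord_eq_iff.mpr (Or.inr rfl)⟩)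
      rw [← hgh] at hlt
      exact hlt

end Pieces
/-! ### Building the configuration space from the separated configurations -/

section Wedge

/-- A real number or its negative. -/
def signed : Bool → ℝ → ℝ
  | true, r => r
  | false, r => -r

/-- The set of pairs of arc coordinates of which one (the first one if `e.1` is true) has larger
absolute value than the other, is larger than `1` in absolute value, and has the sign `e.2`. -/
def wedge (e : Bool × Bool) : Set (ℝ × ℝ) :=
  {q | 1 < signed e.2 (cond e.1 q.1 q.2) ∧ signed e.2 (cond e.1 q.1 q.2) < 2 ∧
    |cond e.1 q.2 q.1| < signed e.2 (cond e.1 q.1 q.2)}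

theorem continuous_signed (b : Bool) : Continuous (signed b) := by
  cases b
  · exact continuous_neg
  · exact continuous_id

theorem isOpen_wedge (e : Bool × Bool) : IsOpen (wedge e) := by
  have h1 : Continuous fun q : ℝ × ℝ => signed e.2 (cond e.1 q.1 q.2) := by
    refine (continuous_signed _).comp ?_
    cases e.1
    · exact continuous_snd
    · exact continuous_fst
  have h2 : Continuous fun q : ℝ × ℝ => |cond e.1 q.2 q.1| := by
    refine continuous_abs.comp ?_
    cases e.1
    · exact continuous_fst
    · exact continuous_snd
  exact (isOpen_lt continuous_const h1).inter ((isOpen_lt h1 continuous_const).inter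
    (isOpen_lt h2 h1))

theorem convex_wedge (e : Bool × Bool) : Convex ℝ (wedge e) := by
  rintro p ⟨h1, h2, h3⟩ q ⟨h1', h2', h3'⟩ a b ha hb hab
  have e1 : signed e.2 (cond e.1 (a • p + b • q).1 (a • p + b • q).2) =
      a * signed e.2 (cond e.1 p.1 p.2) + b * signed e.2 (cond e.1 q.1 q.2) := by
    obtain ⟨i, j⟩ := e
    cases i <;> cases j <;> simp [signed] <;> ring
  have e2 : cond e.1 (a • p + b • q).2 (a • p + b • q).1 =
      a * cond e.1 p.2 p.1 + b * cond e.1 q.2 q.1 := by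
    cases e.1 <;> simp
  have e3 : |a * cond e.1 p.2 p.1 + b * cond e.1 q.2 q.1| ≤
      a * |cond e.1 p.2 p.1| + b * |cond e.1 q.2 q.1| := by
    refine (abs_add_le _ _).trans ?_
    rw [abs_mul, abs_mul, abs_of_nonneg ha, abs_of_nonneg hb]
  refine ⟨?_, ?_, ?_⟩
  · rw [e1]
    exact convex_Ioi (1 : ℝ) h1 h1' ha hb hab
  · rw [e1]
    exact convex_Iio (2 : ℝ) h2 h2' ha hb hab
  · rw [e1, e2]
    refine e3.trans_lt ?_
    have h4 : a * (|cond e.1 p.2 p.1| - signed e.2 (cond e.1 p.1 p.2)) +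
        b * (|cond e.1 q.2 q.1| - signed e.2 (cond e.1 q.1 q.2)) < 0 :=
      convex_Iio (0 : ℝ) (sub_neg.mpr h3) (sub_neg.mpr h3') ha hb hab
    linarith

theorem nonempty_wedge (e : Bool × Bool) : (wedge e).Nonempty := by
  refine ⟨(cond e.1 (signed e.2 (3 / 2)) 0, cond e.1 0 (signed e.2 (3 / 2))), ?_⟩
  obtain ⟨i, j⟩ := e
  cases i <;> cases j <;> norm_num [wedge, signed]

theorem wedge_bounded {e : Bool × Bool} {q : ℝ × ℝ} (h : q ∈ wedge e) : |q.1| < 2 ∧ |q.2| < 2 := by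
  obtain ⟨i, j⟩ := e
  obtain ⟨h1, h2, h3⟩ := h
  cases i <;> cases j <;> simp only [signed, cond_true, cond_false] at h1 h2 h3 <;>
    rw [abs_lt] at h3 ⊢ <;> rw [abs_lt] <;> refine ⟨⟨?_, ?_⟩, ?_, ?_⟩ <;> linarith

theorem wedge_disjoint {e e' : Bool × Bool} {q : ℝ × ℝ} (h : q ∈ wedge e) (h' : q ∈ wedge e') :
    e = e' := by
  obtain ⟨i, j⟩ := e
  obtain ⟨i', j'⟩ := e'
  obtain ⟨h1, -, h3⟩ := h
  obtain ⟨h1', -, h3'⟩ := h'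
  cases i <;> cases j <;> cases i' <;> cases j' <;> first
    | rfl
    | (simp only [signed, cond_true, cond_false] at h1 h3 h1' h3'
       rw [abs_lt] at h3 h3'
       linarith)

/-- The wedges make up the set of pairs which are not equal in absolute value and of which one is
larger than `1` in absolute value. -/
theorem exists_mem_wedge {q : ℝ × ℝ} (hq : |q.1| < 2 ∧ |q.2| < 2) :
    (∃ e, q ∈ wedge e) ↔ (1 < |q.1| ∧ |q.2| < |q.1|) ∨ (1 < |q.2| ∧ |q.1| < |q.2|) := by
  constructor
  · rintro ⟨⟨i, j⟩, h1, -, h3⟩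
    cases i <;> cases j <;> simp only [signed, cond_true, cond_false] at h1 h3
    · exact Or.inr ⟨h1.trans_le (neg_le_abs _), h3.trans_le (neg_le_abs _)⟩
    · exact Or.inr ⟨h1.trans_le (le_abs_self _), h3.trans_le (le_abs_self _)⟩
    · exact Or.inl ⟨h1.trans_le (neg_le_abs _), h3.trans_le (neg_le_abs _)⟩
    · exact Or.inl ⟨h1.trans_le (le_abs_self _), h3.trans_le (le_abs_self _)⟩
  · rintro (⟨h1, h2⟩ | ⟨h1, h2⟩)
    · rcases abs_choice q.1 with e | e
      · exact ⟨(true, true), by rw [← e]; exact h1, by rw [← e]; exact hq.1, by rw [← e]; exact h2⟩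
      · exact ⟨(true, false), by
          change 1 < -q.1 ∧ -q.1 < 2 ∧ |q.2| < -q.1
          rw [← e]
          exact ⟨h1, hq.1, h2⟩⟩
    · rcases abs_choice q.2 with e | e
      · exact ⟨(false, true), by
          change 1 < q.2 ∧ q.2 < 2 ∧ |q.1| < q.2
          rw [← e]
          exact ⟨h1, hq.2, h2⟩⟩
      · exact ⟨(false, false), by
          change 1 < -q.2 ∧ -q.2 < 2 ∧ |q.1| < -q.2
          rw [← e]
          exact ⟨h1, hq.2, h2⟩⟩

end Wedge

section Attachments

variable {V : Type u} [Fintype V] {T : SimpleGraph V} {ℓ : V → ℕ}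

/-- For every grape, the configurations of a point on the grape and a point closer to the stem are
attached to the configurations with different projections. They meet this set in one component for
every edge of the stem at the vertex where the grape is attached. -/
theorem isAttachment_nearStem (hpc : IsPathConnected (stemDistinct T ℓ)) :
    IsAttachment (stemDistinct T ℓ) (fun g : Σ v : V, Fin (ℓ v) => unord '' nearStem T g)
      (fun g (w : T.neighborSet g.1) => unord '' nearStemEdge T g w) := by
  refine isAttachment_unord isOpen_stemDistinct hpc isOpen_nearStem isSimplyConnected_nearStem
    (fun g h p hp => nearStem_swap hp) (fun g h p hp hp' => eq_of_mem_openGrape hp.1 hp'.1)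
    (fun g w => isOpen_nearStemEdge g w) (fun g w => isSimplyConnected_nearStemEdge g w.2)
    (fun g w => inter_subset_left) ?_ (fun g p hp => unord_mem_nearStem hp)
  rintro g ⟨w, hw⟩ ⟨w', hw'⟩ p ⟨hp, h1⟩ ⟨-, h2⟩
  by_contra hne
  have h3 : p.1.1.1 (.inl g.1) ≠ 0 := ((p.1.2.nonneg _).trans_lt hp.2).ne'
  have hwg : ∀ {w}, T.Adj g.1 w → (Sum.inl g.1 : GrapeVertex ℓ) ≠ .inl w := fun h e =>
    h.ne (Sum.inl_injective e)
  exact (ne_of_gt h2) ((edge_coords (hwg hw) h3 (ne_of_gt h1)).2.1 _ (hwg hw').symm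
    fun e => hne (Subtype.ext (Sum.inl_injective e).symm))

/-- The configurations with different projections, together with those of a point on a grape and a
point closer to the stem. -/
def withNearStem (T : SimpleGraph V) (ℓ : V → ℕ) : Set (UC₂ (Realization (bunch T ℓ))) :=
  stemDistinct T ℓ ∪ ⋃ g, unord '' nearStem T g

/-- The pairs of arc coordinates of configurations of two points on the same grape. -/
def sameGrape : Set (ℝ × ℝ) := {q | -2 < q.1 ∧ q.1 < q.2 ∧ q.2 < 2}

theorem isOpen_sameGrape : IsOpen sameGrape :=
  (isOpen_lt continuous_const continuous_fst).inter
    ((isOpen_lt continuous_fst continuous_snd).inter (isOpen_lt continuous_snd continuous_const))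

theorem convex_sameGrape : Convex ℝ sameGrape := by
  rintro p ⟨h1, h2, h3⟩ q ⟨h1', h2', h3'⟩ a b ha hb hab
  refine ⟨convex_Ioi (-2 : ℝ) h1 h1' ha hb hab, ?_, convex_Iio (2 : ℝ) h3 h3' ha hb hab⟩
  have h4 : a * (p.1 - p.2) + b * (q.1 - q.2) < 0 :=
    convex_Iio (0 : ℝ) (sub_neg.mpr h2) (sub_neg.mpr h2') ha hb hab
  change a * p.1 + b * q.1 < a * p.2 + b * q.2
  linarith

theorem abs_lt_two_of_mem_sameGrape {q : ℝ × ℝ} (h : q ∈ sameGrape) : |q.1| < 2 ∧ |q.2| < 2 := by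
  obtain ⟨h1, h2, h3⟩ := h
  rw [abs_lt, abs_lt]
  refine ⟨⟨?_, ?_⟩, ?_, ?_⟩ <;> linarith

theorem wedge_subset_sameGrape (b : Bool) : wedge (b, !b) ⊆ sameGrape := by
  rintro q hq
  obtain ⟨h4, h5⟩ := wedge_bounded hq
  obtain ⟨h1, h2, h3⟩ := hq
  rw [abs_lt] at h4 h5
  refine ⟨h4.1, ?_, h5.2⟩
  cases b <;>
    simp only [signed, Bool.not_true, Bool.not_false, cond_true, cond_false] at h1 h2 h3 <;>
    rw [abs_lt] at h3 <;> linarith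

theorem mem_wedge_of_mem_sameGrape {q : ℝ × ℝ} (hq : q ∈ sameGrape) {e : Bool × Bool}
    (he : q ∈ wedge e) : e = (e.1, !e.1) := by
  obtain ⟨i, j⟩ := e
  obtain ⟨h1, h2, h3⟩ := he
  obtain ⟨-, h4, -⟩ := hq
  cases i <;> cases j <;> first
    | rfl
    | (simp only [signed, cond_true, cond_false] at h1 h2 h3
       rw [abs_lt] at h3
       linarith)

/-- For every grape, the configurations of two points on this grape are attached. They meet the
given set in two components, according to which of the points is closer to the stem. -/
theorem isAttachment_sameGrape (hU : IsOpen (withNearStem T ℓ))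
    (hpc : IsPathConnected (withNearStem T ℓ)) :
    IsAttachment (withNearStem T ℓ)
      (fun g : Σ v : V, Fin (ℓ v) => unord '' grapePair T g g sameGrape)
      (fun g (b : Bool) => unord '' grapePair T g g (wedge (b, !b))) := by
  refine isAttachment_unord hU hpc (fun g => isOpen_grapePair g g isOpen_sameGrape)
    (fun g => isSimplyConnected_grapePair convex_sameGrape ⟨(0, 1), by norm_num [sameGrape]⟩
      (fun q hq => abs_lt_two_of_mem_sameGrape hq) (Or.inr fun q hq => hq.2.1.ne)) ?_
    (fun g h p hp hp' => eq_of_mem_openGrape hp.1.1 hp'.1.1)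
    (fun g b => isOpen_grapePair g g (isOpen_wedge _))
    (fun g b => isSimplyConnected_grapePair (convex_wedge _) (nonempty_wedge _)
      (fun q hq => wedge_bounded hq) (Or.inr fun q hq => (wedge_subset_sameGrape b hq).2.1.ne))
    (fun g b p hp => ⟨hp.1, wedge_subset_sameGrape b hp.2⟩)
    (fun g b c p hp hp' => congrArg Prod.fst (wedge_disjoint hp.2 hp'.2)) ?_
  · rintro g h p ⟨⟨h1, h2⟩, h3⟩ ⟨⟨h4, h5⟩, h6⟩
    obtain rfl := eq_of_mem_openGrape h2 h4
    exact lt_asymm h3.2.1 h6.2.1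
  · rintro g p ⟨⟨h1, h2⟩, h3⟩
    refine (unord_mem_union_nearStem rfl h1 h2).trans
      ((exists_mem_wedge (abs_lt_two_of_mem_sameGrape h3)).symm.trans ⟨?_, ?_⟩)
    · rintro ⟨e, he⟩
      refine ⟨e.1, ⟨h1, h2⟩, ?_⟩
      rwa [← mem_wedge_of_mem_sameGrape h3 he]
    · rintro ⟨b, hb⟩
      exact ⟨_, hb.2⟩

/-- The set `withNearStem T ℓ` together with the configurations of two points on the same grape. -/
def withSameGrape (T : SimpleGraph V) (ℓ : V → ℕ) : Set (UC₂ (Realization (bunch T ℓ))) :=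
  withNearStem T ℓ ∪ ⋃ g, unord '' grapePair T g g sameGrape

/-- The unordered pairs of different grapes at the same vertex of the stem, represented by the
ordered pairs whose entries are in a fixed order. -/
def GrapePairs (ℓ : V → ℕ) : Type u :=
  {q : (Σ v : V, Fin (ℓ v)) × (Σ v : V, Fin (ℓ v)) //
    q.1.1 = q.2.1 ∧ Fintype.equivFin _ q.1 < Fintype.equivFin _ q.2}

instance : Finite (GrapePairs ℓ) := inferInstanceAs (Finite (Subtype _))

/-- The pairs of arc coordinates of configurations of points on two different grapes. -/
def box : Set (ℝ × ℝ) := {q | |q.1| < 2 ∧ |q.2| < 2}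

/-- For every pair of different grapes at the same vertex, the configurations with one point on each
of them are attached. They meet the given set in four components, according to which of the points
is closer to the stem, and to the side on which it is. -/
theorem isAttachment_box (hU : IsOpen (withSameGrape T ℓ))
    (hpc : IsPathConnected (withSameGrape T ℓ)) :
    IsAttachment (withSameGrape T ℓ)
      (fun k : GrapePairs ℓ => unord '' grapePair T k.1.1 k.1.2 box)
      (fun k (e : Bool × Bool) => unord '' grapePair T k.1.1 k.1.2 (wedge e)) := by
  have hne : ∀ k : GrapePairs ℓ, k.1.1 ≠ k.1.2 := fun k e => by
    have := k.2.2
    rw [e] at this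
    exact lt_irrefl _ this
  have hbox : IsOpen box :=
    (isOpen_lt continuous_fst.abs continuous_const).inter
      (isOpen_lt continuous_snd.abs continuous_const)
  have hconv : Convex ℝ box := by
    have : box = Ioo (-2) 2 ×ˢ Ioo (-2) 2 := by
      ext q
      simp [box, abs_lt]
    rw [this]
    exact (convex_Ioo _ _).prod (convex_Ioo _ _)
  refine isAttachment_unord hU hpc (fun k => isOpen_grapePair _ _ hbox)
    (fun k => isSimplyConnected_grapePair hconv ⟨(0, 0), by norm_num [box]⟩ (fun q hq => hq)
      (Or.inl (hne k))) ?_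
    (fun j k p hp hp' => Subtype.ext (Prod.ext (eq_of_mem_openGrape hp.1.1 hp'.1.1)
      (eq_of_mem_openGrape hp.1.2 hp'.1.2)))
    (fun k e => isOpen_grapePair _ _ (isOpen_wedge _))
    (fun k e => isSimplyConnected_grapePair (convex_wedge _) (nonempty_wedge _)
      (fun q hq => wedge_bounded hq) (Or.inl (hne k)))
    (fun k e p hp => ⟨hp.1, wedge_bounded hp.2⟩)
    (fun k e e' p hp hp' => wedge_disjoint hp.2 hp'.2) ?_
  · rintro j k p ⟨⟨h1, h2⟩, -⟩ ⟨⟨h3, h4⟩, -⟩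
    have h5 := k.2.2
    rw [← eq_of_mem_openGrape h2 h3, ← eq_of_mem_openGrape h1 h4] at h5
    exact lt_asymm j.2.2 h5
  · rintro k p ⟨⟨h1, h2⟩, h3⟩
    have h4 : unord p ∉ ⋃ g, unord '' grapePair T g g sameGrape := by
      intro h
      obtain ⟨g, p', hp', e⟩ := mem_iUnion.mp h
      rcases unord_eq_iff.mp e.symm with rfl | rfl
      · exact hne k ((eq_of_mem_openGrape h1 hp'.1.1).trans (eq_of_mem_openGrape hp'.1.2 h2))
      · exact hne k ((eq_of_mem_openGrape h1 hp'.1.2).trans (eq_of_mem_openGrape hp'.1.1 h2))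
    refine (or_iff_left h4).trans ((unord_mem_union_nearStem k.2.1 h1 h2).trans
      ((exists_mem_wedge h3).symm.trans (exists_congr fun e => ?_)))
    exact ⟨fun h => ⟨⟨h1, h2⟩, h⟩, fun h => h.2⟩

/-- The whole configuration space is covered: if two different points have the same
projection to the stem, then one of them is on a grape, and the other one is either on a grape at
the same vertex or the vertex itself. -/
theorem withSameGrape_union_eq_univ :
    (withSameGrape T ℓ ∪ ⋃ k : GrapePairs ℓ, unord '' grapePair T k.1.1 k.1.2 box) = univ := by
  rw [eq_univ_iff_forall]
  intro z
  obtain ⟨p, rfl⟩ := isOpenQuotientMap_unord.surjective z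
  by_cases hs : stemCoord p.1.1 = stemCoord p.1.2
  swap
  · exact Or.inl (Or.inl (Or.inl (unord_mem_stemDistinct.mpr hs)))
  -- it is enough to deal with the case in which the second point is on a grape
  have key : ∀ p : C₂ (Realization (bunch T ℓ)), stemCoord p.1.1 = stemCoord p.1.2 →
      (∃ g, p.1.2 ∈ openGrape T g) →
        unord p ∈ withSameGrape T ℓ ∪ ⋃ k : GrapePairs ℓ, unord '' grapePair T k.1.1 k.1.2 box := by
    rintro p hs ⟨g, hg⟩
    by_cases hx : ∃ h, p.1.1 ∈ openGrape T h
    · obtain ⟨h, hh⟩ := hx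
      have hgh : h.1 = g.1 := by
        by_contra hne
        have h1 := stemCoord_of_mem_openGrape hg hne
        rw [← hs] at h1
        obtain ⟨i, hi⟩ := exists_ne_of_mem_openGrape hh
        exact hi (stemCoord_eq_zero_iff.mp h1 _ rfl)
      rcases lt_trichotomy (Fintype.equivFin _ h) (Fintype.equivFin _ g) with hlt | heq | hlt
      · exact Or.inr (mem_iUnion.mpr ⟨⟨(h, g), hgh, hlt⟩, p,
          ⟨⟨hh, hg⟩, (arc_spec hh).1, (arc_spec hg).1⟩, rfl⟩)
      · obtain rfl := (Fintype.equivFin _).injective heq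
        obtain ⟨h1, h2⟩ := abs_lt.mp (arc_spec hh).1
        obtain ⟨h3, h4⟩ := abs_lt.mp (arc_spec hg).1
        refine Or.inl (Or.inr (mem_iUnion.mpr ⟨h, ?_⟩))
        rcases lt_trichotomy (arc h p.1.1) (arc h p.1.2) with hlt | heq | hlt
        · exact ⟨p, ⟨⟨hh, hg⟩, h1, hlt, h4⟩, rfl⟩
        · exact (p.2 (by rw [← (arc_spec hh).2, heq, (arc_spec hg).2])).elim
        · exact ⟨swapC₂ p, ⟨⟨hg, hh⟩, h3, hlt, h2⟩, unord_eq_iff.mpr (Or.inr rfl)⟩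
      · exact Or.inr (mem_iUnion.mpr ⟨⟨(g, h), hgh.symm, hlt⟩, swapC₂ p,
          ⟨⟨hg, hh⟩, (arc_spec hg).1, (arc_spec hh).1⟩, unord_eq_iff.mpr (Or.inr rfl)⟩)
    · -- the first point is the vertex of the stem
      have hx' : ∀ b, p.1.1.1 (.inr b) = 0 := fun b =>
        by_contra fun hb => hx ⟨b.1, mem_openGrape_of_ne (g := b.1) (i := b.2) hb⟩
      refine Or.inl (Or.inl (Or.inr (mem_iUnion.mpr ⟨g, p, ⟨hg, ?_⟩, rfl⟩)))
      have h1 : p.1.1.1 (.inl g.1) = 1 := by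
        rw [← stemCoord_of_stem hx', ← sum_stemCoord p.1.1]
        exact (Finset.sum_eq_single g.1 (fun v _ hv => by
          rw [hs]; exact stemCoord_of_mem_openGrape hg hv) (by simp)).symm
      have h2 := sum_coords_of_mem_openGrape hg
      have h3 : 0 < p.1.2.1 (.inr (g, false)) + p.1.2.1 (.inr (g, true)) := hg
      rw [h1]
      linarith
  by_cases hy : ∃ g, p.1.2 ∈ openGrape T g
  · exact key p hs hy
  by_cases hx : ∃ g, p.1.1 ∈ openGrape T g
  · rw [show unord p = unord (swapC₂ p) from unord_eq_iff.mpr (Or.inr rfl)]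
    exact key (swapC₂ p) hs.symm hx
  · have h0 : ∀ {x : Realization (bunch T ℓ)}, (¬∃ g, x ∈ openGrape T g) →
        ∀ b, x.1 (.inr b) = 0 := fun hx b =>
      by_contra fun hb => hx ⟨b.1, mem_openGrape_of_ne (g := b.1) (i := b.2) hb⟩
    refine (p.2 (Realization.ext_coords fun a => ?_)).elim
    rcases a with v | b
    · rw [← stemCoord_of_stem (h0 hx), ← stemCoord_of_stem (h0 hy), hs]
    · rw [h0 hx, h0 hy]

end Attachments
end GrapeBraid

open GrapeBraid
theorem mainTheorem8 {V : Type u} [Fintype V] (T : SimpleGraph V) (hT : T.IsTree) (ℓ : V → ℕ)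
    (hlarge : IsLarge ℓ) (hnormal : IsNormal T ℓ) :
    IsLocallyConvex (UP₂ (bunch T ℓ)) (UD₂ (bunch T ℓ)) ∧
    IsPathConnected (polyhedron (bunch T ℓ) (UP₂ (bunch T ℓ))) ∧
    ∃ n : ℕ, 2 ≤ n ∧
      ∀ (q : UC₂ (Realization (bunch T ℓ)))
        (p : polyhedron (bunch T ℓ) (UP₂ (bunch T ℓ))),
        Nonempty (braidGroup₂ (bunch T ℓ) q ≃*
          FundamentalGroup (polyhedron (bunch T ℓ) (UP₂ (bunch T ℓ))) p ∗ FreeGroup (Fin n)) := by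
  rw [UP₂_bunch hT hnormal]
  obtain ⟨v, w, hvw, hv, hw⟩ := hlarge
  have hnontriv : Nontrivial V := ⟨v, w, hvw⟩
  have hP := isPathConnected_polyhedron_separated (ℓ := ℓ) hT.connected hvw
  refine ⟨isLocallyConvex_separated, hP, ?_⟩
  obtain ⟨⟨e, he⟩, hpc⟩ := exists_homotopyEquiv_stemDistinct (T := T) (ℓ := ℓ)
  have A₁ := isAttachment_nearStem (hpc hP)
  have hnbr : ∀ g : Σ v : V, Fin (ℓ v), Nonempty (T.neighborSet g.1) := fun g => by
    obtain ⟨w, hw⟩ := hT.connected.preconnected.exists_adj_of_nontrivial g.1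
    exact ⟨⟨w, hw⟩⟩
  have A₂ := isAttachment_sameGrape
    (A₁.isOpen_base.union (isOpen_iUnion A₁.isOpen_piece)) A₁.isPathConnected
  have A₃ := isAttachment_box
    (A₂.isOpen_base.union (isOpen_iUnion A₂.isOpen_piece)) A₂.isPathConnected
  have hpath := A₃.isPathConnected
  rw [withSameGrape_union_eq_univ] at hpath
  have : PathConnectedSpace (UC₂ (Realization (bunch T ℓ))) :=
    pathConnectedSpace_iff_univ.mpr hpath
  let w₀ : ∀ g : Σ v : V, Fin (ℓ v), T.neighborSet g.1 := fun g => (hnbr g).some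
  let F₁ := Σ g : Σ v : V, Fin (ℓ v), {w : T.neighborSet g.1 // w ≠ w₀ g}
  let F₂ := Σ _ : Σ v : V, Fin (ℓ v), {b : Bool // b ≠ true}
  let F₃ := Σ _ : GrapePairs ℓ, {e : Bool × Bool // e ≠ (true, true)}
  refine ⟨Nat.card (F₁ ⊕ (F₂ ⊕ F₃)), ?_, fun q p => ?_⟩
  · -- each of the two grapes provides a generator in the second step
    have : Nontrivial (F₁ ⊕ (F₂ ⊕ F₃)) :=
      ⟨.inr (.inl ⟨⟨v, ⟨0, hv⟩⟩, false, by simp⟩), .inr (.inl ⟨⟨w, ⟨0, hw⟩⟩, false, by simp⟩),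
        fun h => hvw (congrArg (fun f : F₂ => f.1.1) (Sum.inl_injective (Sum.inr_injective h)))⟩
    exact Finite.one_lt_card
  · have hp : p.1 ∈ stemDistinct T ℓ := polyhedron_subset_stemDistinct p.2
    obtain ⟨e₀⟩ := nonempty_mulEquiv_of_homotopyEquiv e p
    rw [he] at e₀
    obtain ⟨e₁⟩ := A₁.nonempty_mulEquiv_union w₀ p.1 hp
    obtain ⟨e₂⟩ := A₂.nonempty_mulEquiv_union (fun _ => true) p.1 (Or.inl hp)
    obtain ⟨e₃⟩ := A₃.nonempty_mulEquiv_union (fun _ => (true, true)) p.1 (Or.inl (Or.inl hp))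
    obtain ⟨e₄⟩ := nonempty_mulEquiv_of_homotopyEquiv
      ((Homeomorph.setCongr withSameGrape_union_eq_univ).trans
        (Homeomorph.Set.univ (UC₂ (Realization (bunch T ℓ))))).toHomotopyEquiv
      ⟨p.1, Or.inl (Or.inl (Or.inl hp))⟩
    have e₅ : FundamentalGroup (UC₂ (Realization (bunch T ℓ))) q ≃*
        FundamentalGroup (UC₂ (Realization (bunch T ℓ))) p.1 :=
      FundamentalGroup.fundamentalGroupMulEquivOfPathConnected _ _
    have f₁ := e₁.trans (MulEquiv.coprodCongr e₀.symm (MulEquiv.refl _))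
    have f₂ := e₂.trans (MulEquiv.coprodCongr f₁ (MulEquiv.refl _))
    have f₃ := e₃.trans (MulEquiv.coprodCongr f₂ (MulEquiv.refl _))
    have f₄ := (e₅.trans e₄.symm).trans f₃
    refine ⟨f₄.trans ((MulEquiv.coprodAssoc _ _ _).trans ((MulEquiv.coprodAssoc _ _ _).trans
      (MulEquiv.coprodCongr (MulEquiv.refl _) ((MulEquiv.coprodCongr (MulEquiv.refl _)
        (freeGroupSumEquiv _ _)).trans ((freeGroupSumEquiv _ _).trans
          (FreeGroup.freeGroupCongr (Finite.equivFin (F₁ ⊕ (F₂ ⊕ F₃)))))))))⟩
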